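/- **Conventions.** Manifolds are smooth and Hausdorff, except that the manifold of arrows of a Lie groupoid need not be Hausdorff; manifolds of objects and arrows need not be second countable. A *transition* on a manifold $M$ is a diffeomorphism between two open subsets of $M$. **Orbifolds.** Let $Q$ be a second countable Hausdorff space. An *orbifold chart* of dimension $n$ on $Q$ is a triple $(V,G,\varphi)$ with $V$ a connected second countable $n$-manifold, $G$ a finite subgroup of $\mathrm{Diff}(V)$ and $\varphi\colon V\to Q$ a continuous map with open image inducing a homeomorphism $G\backslash V\to\varphi(V)$. Charts $(V,G,\varphi)$, $(W,H,\psi)$ are *compatible* if for all $x\in V$, $y\in W$ with $\varphi(x)=\psi(y)$ there is a diffeomorphism $h$ between connected open neighborhoods of $x$ and $y$ with $h(x)=y$ and $\psi\circ h=\varphi$ (a *change of charts*). An *orbifold atlas* is a set of pairwise compatible charts of one dimension covering $Q$; an *orbifold structure* $\mathcal U$ is a maximal atlas; a *(reduced) orbifold* is a pair $(Q,\mathcal U)$. A *representative* of $\mathcal U$ is a family $\mathcal V=\{(V_i,G_i,\pi_i)\}_{i\in I}$ of charts in $\mathcal U$ covering $Q$, where equal charts with distinct indices count as distinct. **Marked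 atlas groupoids.** Given $\mathcal V$, put $V=\coprod_i V_i$, $\pi=\coprod_i\pi_i$, and let $\Psi(\mathcal V)$ be the set of all transitions $f$ on $V$ with $\pi\circ f=\pi|_{\mathrm{dom} f}$. Let $\Gamma(\mathcal V)$ be the étale Lie groupoid with objects $V$ and arrows the germs $\mathrm{germ}_x f\colon x\to f(x)$, $f\in\Psi(\mathcal V)$, with germ topology and germ differential structure. It is *marked* by the homeomorphism $\alpha_{\mathcal V}\colon|\Gamma(\mathcal V)|\to Q$, $[x]\mapsto\pi(x)$, where $|\cdot|$ is the orbit space. The triples $(\Gamma(\mathcal V),\alpha_{\mathcal V},Q)$ are the *marked atlas groupoids*, and $\Gamma(Q,\mathcal U)$ is the class of these for all representatives $\mathcal V$ of $\mathcal U$. A homomorphism $\varphi=(\varphi_0,\varphi_1)\colon G\to H$ of Lie groupoids is a *weak equivalence* if $t\circ\mathrm{pr}_1\colon H_1\times_{s,\varphi_0}G_0\to H_0$ is a surjective submersion and the square formed by $\varphi_1$, the two maps $(s,t)$, and $\varphi_0\times\varphi_0$ is a fibered product. A homomorphism $(G,\alpha,X)\to(H,\beta,X)$ is a *unit weak equivalence*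 if it is a weak equivalence and $\beta\circ|\varphi|\circ\alpha^{-1}=\mathrm{id}_X$. Homomorphisms $\psi_j\colon(G_j,\alpha_j,X)\to(H_j,\beta_j,Y)$, $j=1,2$, of marked atlas groupoids are *unit Morita equivalent* if there are a homomorphism $\chi\colon(G,\alpha,X)\to(H,\beta,Y)$ of marked atlas groupoids and unit weak equivalences $\varepsilon_j\colon G\to G_j$, $\delta_j\colon H\to H_j$ with $\psi_j\circ\varepsilon_j=\delta_j\circ\chi$ for $j=1,2$. **Charted orbifold maps.** Let $\mathcal V$, $\mathcal V'$ be representatives of $(Q,\mathcal U)$, $(Q',\mathcal U')$. A *representative of an orbifold map* is a tuple $\hat f=(f,\{\tilde f_i\},P,\nu)$ where $f\colon Q\to Q'$ is continuous; each $\tilde f_i\colon V_i\to V'_{\tau(i)}$ is smooth with $\pi'_{\tau(i)}\circ\tilde f_i=f\circ\pi_i$; $P\subseteq\Psi(\mathcal V)$ consists of changes of charts between charts of $\mathcal V$, is closed under composition and inversion of germs, and contains a representative of every germ of elements of $\Psi(\mathcal V)$; and $\nu\colon P\to\Psi(\mathcal V')$ assigns to each $\lambda\in P$ an open embedding between charts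 of $\mathcal U'$ such that, with $\psi=\coprod_i\tilde f_i$: (a) $\psi\circ\lambda=\nu(\lambda)\circ\psi|_{\mathrm{dom}\lambda}$; (b) $\mathrm{germ}_x\lambda=\mathrm{germ}_x\mu$ implies $\mathrm{germ}_{\psi(x)}\nu(\lambda)=\mathrm{germ}_{\psi(x)}\nu(\mu)$; (c) $\mathrm{germ}_{\lambda(x)}\mu\cdot\mathrm{germ}_x\lambda=\mathrm{germ}_x h$ implies $\mathrm{germ}_{\psi(\lambda(x))}\nu(\mu)\cdot\mathrm{germ}_{\psi(x)}\nu(\lambda)=\mathrm{germ}_{\psi(x)}\nu(h)$; (d) $\mathrm{germ}_x\lambda=\mathrm{germ}_x\mathrm{id}$ implies $\mathrm{germ}_{\psi(x)}\nu(\lambda)=\mathrm{germ}_{\psi(x)}\mathrm{id}$, for all $\lambda,\mu,h\in P$. Two such tuples are identified if $f$ and all $\tilde f_i$ agree and $\mathrm{germ}_x\lambda_1=\mathrm{germ}_x\lambda_2$ implies $\mathrm{germ}_{\psi(x)}\nu_1(\lambda_1)=\mathrm{germ}_{\psi(x)}\nu_2(\lambda_2)$; the classes form the set $\mathrm{Orb}(\mathcal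 V,\mathcal V')$ of *charted orbifold maps*. The composition of $\hat f\in\mathrm{Orb}(\mathcal V,\mathcal V')$ and $\hat g\in\mathrm{Orb}(\mathcal V',\mathcal V'')$ is the charted map over $g\circ f$ with $\psi_{\hat g\circ\hat f}=\psi_{\hat g}\circ\psi_{\hat f}$ whose action on germs is the composition of the actions of $\nu_f$ and $\nu_g$. A charted map between representatives of the same $\mathcal U$ is a *lift of the identity* if $f=\mathrm{id}_Q$ and all $\tilde f_i$ are local diffeomorphisms. Put $F_1(\hat f)=(\varphi_0,\varphi_1)\colon\Gamma(\mathcal V)\to\Gamma(\mathcal V')$, $\varphi_0=\psi$, $\varphi_1(\mathrm{germ}_x\lambda)=\mathrm{germ}_{\psi(x)}\nu(\lambda)$ for $\lambda\in P$. **The categories.** The category $\mathrm{Orb}$ has reduced orbifolds as objects. Charted maps $\hat f_j\in\mathrm{Orb}(\mathcal V_j,\mathcal V_j')$, $j=1,2$, are equivalent if there are $\hat h\in\mathrm{Orb}(\mathcal W,\mathcal W')$ and lifts of the identity $\varepsilon_j\in\mathrm{Orb}(\mathcal W,\mathcal V_j)$, $\varepsilon_j'\in\mathrm{Orb}(\mathcal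 W',\mathcal V'_j)$ with $\hat f_j\circ\varepsilon_j=\varepsilon'_j\circ\hat h$; morphisms are the equivalence classes $[\hat f]$ of charted maps for arbitrary representatives of the two structures. The identity morphism is the class of all lifts of the identity. For $\hat f\in\mathrm{Orb}(\mathcal V,\mathcal V')$ and $\hat g\in\mathrm{Orb}(\mathcal W',\mathcal W'')$ one sets $[\hat g]\circ[\hat f]=[\hat k\circ\hat h]$ for any $\hat h\in\mathrm{Orb}(\mathcal K,\mathcal K')$, $\hat k\in\mathrm{Orb}(\mathcal K',\mathcal K'')$ and lifts of identities $\varepsilon\in\mathrm{Orb}(\mathcal K,\mathcal V)$, $\varepsilon_1'\in\mathrm{Orb}(\mathcal K',\mathcal V')$, $\varepsilon_2'\in\mathrm{Orb}(\mathcal K',\mathcal W')$, $\varepsilon''\in\mathrm{Orb}(\mathcal K'',\mathcal W'')$ with $\hat f\circ\varepsilon=\varepsilon_1'\circ\hat h$ and $\hat g\circ\varepsilon_2'=\varepsilon''\circ\hat k$. The category $\mathrm{Agr}$ has the classes $\Gamma(Q,\mathcal U)$ as objects and the unit Morita equivalence classes $[\varphi]$ of homomorphisms between members of the two classes as morphisms;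 identities are the classes of unit weak equivalences, and the composition is defined as in $\mathrm{Orb}$ with homomorphisms of groupoids instead of charted maps and unit weak equivalences instead of lifts of identities. **Theorem.** (1) Any $\hat f\in\mathrm{Orb}(\mathcal V,\mathcal V')$ and $\hat g\in\mathrm{Orb}(\mathcal V',\mathcal V'')$ have a unique composition in $\mathrm{Orb}(\mathcal V,\mathcal V'')$. (2) $F_1$ is a well-defined bijection from $\mathrm{Orb}(\mathcal V,\mathcal V')$ onto $\mathrm{Hom}(\Gamma(\mathcal V),\Gamma(\mathcal V'))$, with inverse denoted $F_2$; for $\varphi=F_1(\hat f)$ one has $f=\alpha_{\mathcal V'}\circ|\varphi|\circ\alpha_{\mathcal V}^{-1}$. (3) Equivalence of charted orbifold maps and unit Morita equivalence of homomorphisms are equivalence relations, the compositions just described always exist and are well defined, and $\mathrm{Orb}$ and $\mathrm{Agr}$ are categories. (4) The assignments $(Q,\mathcal U)\mapsto\Gamma(Q,\mathcal U)$ and $[\hat f]\mapsto[F_1(\hat f)]$ define a covariant functor $F\colon\mathrm{Orb}\to\mathrm{Agr}$. (5) $F$ is an isomorphism of categories. Both $F$ and its inverse are given by explicit formulas: $F^{-1}$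 sends $\Gamma(Q,\mathcal U)$ to $(Q,\mathcal U)$ and $[\varphi]$ to $[F_2(\varphi)]$, and $\mathcal U$ is recovered from any one member $(\Gamma(\mathcal V),\alpha_{\mathcal V},Q)$ of the class as the set of all orbifold charts $(W,H,\chi)$ such that any $x\in W$ and $y\in\Gamma(\mathcal V)_0$ with $\chi(x)=\alpha_{\mathcal V}([y])$ are related by a diffeomorphism $h$ between open neighborhoods of $x$ and $y$ with $h(x)=y$ and $\alpha_{\mathcal V}([h(z)])=\chi(z)$ for all $z$. -/

import Mathlib

open Set Filter Topology Manifold ContDiff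

universe u v

namespace ReducedOrbifold

noncomputable section

/-! ### Manifold preliminaries -/

/-- A transition on `M`: a diffeomorphism between two open subsets of `M`.  (The values of the
underlying functions outside of the domain and the codomain are irrelevant.) -/
abbrev Transition (n : ℕ) (M : Type u) [TopologicalSpace M]
    [ChartedSpace (EuclideanSpace ℝ (Fin n)) M] : Type u :=
  PartialDiffeomorph (𝓡 n) (𝓡 n) M M ∞

/-- The group `Diff(M)`. -/
instance diffGroup (n : ℕ) (M : Type u) [TopologicalSpace M]
    [ChartedSpace (EuclideanSpace ℝ (Fin n)) M] : Group (M ≃ₘ^∞⟮𝓡 n, 𝓡 n⟯ M) where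
  mul f g := g.trans f
  one := Diffeomorph.refl (𝓡 n) M ∞
  inv f := f.symm
  mul_assoc _ _ _ := Diffeomorph.ext fun _ => rfl
  one_mul _ := Diffeomorph.ext fun _ => rfl
  mul_one _ := Diffeomorph.ext fun _ => rfl
  inv_mul_cancel f := Diffeomorph.ext fun x => f.symm_apply_apply x

/-- The smooth atlas of a disjoint union `∐ M i` of manifolds. -/
instance sigmaChartedSpace {H : Type*} [TopologicalSpace H] [Nonempty H] {ι : Type*}
    (M : ι → Type*) [∀ i, TopologicalSpace (M i)] [∀ i, ChartedSpace H (M i)] :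
    ChartedSpace H (Σ i, M i) where
  atlas := ⋃ i, (fun e : OpenPartialHomeomorph (M i) H =>
    e.lift_openEmbedding (IsOpenEmbedding.sigmaMk (σ := M) (i := i))) '' atlas H (M i)
  chartAt p := (chartAt H p.2).lift_openEmbedding (IsOpenEmbedding.sigmaMk (σ := M) (i := p.1))
  mem_chart_source p := ⟨p.2, mem_chart_source H p.2, rfl⟩
  chart_mem_atlas p := mem_iUnion.2 ⟨p.1, _, chart_mem_atlas H p.2, rfl⟩

instance sigmaIsManifold {n : ℕ} {ι : Type*} (M : ι → Type*) [∀ i, TopologicalSpace (M i)]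
    [∀ i, ChartedSpace (EuclideanSpace ℝ (Fin n)) (M i)] [∀ i, IsManifold (𝓡 n) ∞ (M i)] :
    IsManifold (𝓡 n) ∞ (Σ i, M i) where
  compatible {e} e' he he' := by
    obtain ⟨i, f, hf, rfl⟩ := mem_iUnion.1 he
    obtain ⟨j, f', hf', rfl⟩ := mem_iUnion.1 he'
    by_cases hij : i = j
    · subst hij
      dsimp only
      rw [f.lift_openEmbedding_trans f']
      exact (contDiffGroupoid ∞ (𝓡 n)).compatible hf hf'
    · apply ContDiffGroupoid.mem_of_source_eq_empty
      ext x
      refine ⟨fun ⟨_, y, _, hy⟩ => hij ?_, fun h => h.elim⟩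
      have := congrArg Sigma.fst hy
      exact this.symm

/-- The inclusion of a summand is a local diffeomorphism. -/
theorem sigmaMk_isLocalDiffeomorph {n : ℕ} {ι : Type*} (M : ι → Type*)
    [∀ i, TopologicalSpace (M i)] [∀ i, ChartedSpace (EuclideanSpace ℝ (Fin n)) (M i)]
    [∀ i, IsManifold (𝓡 n) ∞ (M i)] (i : ι) :
    IsLocalDiffeomorph (𝓡 n) (𝓡 n) ∞ (Sigma.mk i : M i → Σ i, M i) := by
  intro x
  let c : OpenPartialHomeomorph (M i) (EuclideanSpace ℝ (Fin n)) := chartAt _ x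
  let d : OpenPartialHomeomorph (Σ i, M i) (EuclideanSpace ℝ (Fin n)) :=
    chartAt _ (⟨i, x⟩ : Σ i, M i)
  have hc : c ∈ IsManifold.maximalAtlas (𝓡 n) ∞ (M i) := IsManifold.chart_mem_maximalAtlas _
  have hd : d ∈ IsManifold.maximalAtlas (𝓡 n) ∞ (Σ i, M i) := IsManifold.chart_mem_maximalAtlas _
  have a1 := contMDiffOn_of_mem_maximalAtlas hc
  have a2 := contMDiffOn_symm_of_mem_maximalAtlas hc
  have b1 := contMDiffOn_of_mem_maximalAtlas hd
  have b2 := contMDiffOn_symm_of_mem_maximalAtlas hd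
  let k := c.trans d.symm
  refine ⟨⟨k.toPartialEquiv, k.open_source, k.open_target, ?_, ?_⟩, ?_, ?_⟩
  · exact b2.comp (a1.mono inter_subset_left) inter_subset_right
  · exact a2.comp (b1.mono (by intro y hy; exact hy.1)) (by intro y hy; exact hy.2)
  · exact ⟨mem_chart_source _ x, c.map_source (mem_chart_source _ x)⟩
  · intro y hy
    change (⟨i, y⟩ : Σ i, M i) = ⟨i, c.symm (c y)⟩
    rw [c.left_inv hy.1]

section Pullback

variable {n : ℕ} {M : Type u} [TopologicalSpace M] [ChartedSpace (EuclideanSpace ℝ (Fin n)) M]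
  {A : Type v} [TopologicalSpace A]

/-- The smooth atlas on `A` for which a given local homeomorphism `f : A → M` becomes a local
diffeomorphism. -/
@[reducible]
def pullbackChartedSpace (f : A → M) (hf : IsLocalHomeomorph f) :
    ChartedSpace (EuclideanSpace ℝ (Fin n)) A where
  atlas := {e | ∃ h : OpenPartialHomeomorph A M, ∃ c ∈ atlas (EuclideanSpace ℝ (Fin n)) M,
    f = h ∧ e = h.trans c}
  chartAt x := (hf x).choose.trans (chartAt _ (f x))
  mem_chart_source x := by
    have h := (hf x).choose_spec
    refine ⟨h.1, ?_⟩
    have : (hf x).choose x = f x := (congrFun h.2 x).symm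
    simp [this]
  chart_mem_atlas x := ⟨_, _, chart_mem_atlas _ _, (hf x).choose_spec.2, rfl⟩

theorem pullback_isManifold [IsManifold (𝓡 n) ∞ M] (f : A → M) (hf : IsLocalHomeomorph f) :
    letI := pullbackChartedSpace (n := n) f hf
    IsManifold (𝓡 n) ∞ A := by
  let _ := pullbackChartedSpace (n := n) f hf
  refine isManifold_of_contDiffOn (𝓡 n) ∞ A ?_
  rintro _ _ ⟨h, c, hc, hh, rfl⟩ ⟨h', c', hc', hh', rfl⟩
  have key := (contDiffGroupoid ∞ (𝓡 n)).compatible hc hc'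
  rw [contDiffGroupoid, mem_groupoid_of_pregroupoid] at key
  have key := key.1
  have e1 : ∀ y ∈ h.target, h' (h.symm y) = y := fun y hy => by
    rw [← hh', hh]; exact h.right_inv hy
  refine ContDiffOn.congr_mono key ?_ ?_
  · rintro x ⟨hx, -⟩
    simp only [mfld_simps] at hx ⊢
    rw [e1 _ hx.1.2]
  · rintro x ⟨hx, hx2⟩
    refine ⟨?_, hx2⟩
    simp only [mfld_simps] at hx ⊢
    rw [e1 _ hx.1.2] at hx
    exact ⟨hx.1.1, hx.2.2⟩

theorem pullback_isLocalDiffeomorph [IsManifold (𝓡 n) ∞ M] (f : A → M)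
    (hf : IsLocalHomeomorph f) :
    letI := pullbackChartedSpace (n := n) f hf
    IsLocalDiffeomorph (𝓡 n) (𝓡 n) ∞ f := by
  let _ := pullbackChartedSpace (n := n) f hf
  have := pullback_isManifold (n := n) f hf
  intro x
  obtain ⟨h, hx, hh⟩ := hf x
  set c := chartAt (EuclideanSpace ℝ (Fin n)) (f x) with hc
  have hmem : h.trans c ∈ IsManifold.maximalAtlas (𝓡 n) ∞ A :=
    IsManifold.subset_maximalAtlas ⟨h, c, chart_mem_atlas _ _, hh, rfl⟩
  have hcm : c ∈ IsManifold.maximalAtlas (𝓡 n) ∞ M := IsManifold.chart_mem_maximalAtlas _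
  have a1 := contMDiffOn_of_mem_maximalAtlas hmem
  have a2 := contMDiffOn_symm_of_mem_maximalAtlas hmem
  have b1 := contMDiffOn_of_mem_maximalAtlas hcm
  have b2 := contMDiffOn_symm_of_mem_maximalAtlas hcm
  let k := (h.trans c).trans c.symm
  refine ⟨⟨k.toPartialEquiv, k.open_source, k.open_target, ?_, ?_⟩, ?_, ?_⟩
  · exact b2.comp (a1.mono inter_subset_left) inter_subset_right
  · exact a2.comp (b1.mono (by intro y hy; exact hy.1)) (by intro y hy; exact hy.2)
  · have : h x = f x := (congrFun hh x).symm
    simp [k, hx, this, c]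
  · intro y hy
    have hy' : h y ∈ c.source := hy.1.2
    change f y = c.symm (c (h y))
    rw [c.left_inv hy', hh]

theorem contMDiff_of_comp_isLocalDiffeomorph [ChartedSpace (EuclideanSpace ℝ (Fin n)) A]
    {f : A → M} (hf : IsLocalDiffeomorph (𝓡 n) (𝓡 n) ∞ f) {d : ℕ} {N : Type*}
    [TopologicalSpace N] [ChartedSpace (EuclideanSpace ℝ (Fin d)) N] {c : N → A}
    (hc : Continuous c) (hfc : ContMDiff (𝓡 d) (𝓡 n) ∞ (f ∘ c)) :
    ContMDiff (𝓡 d) (𝓡 n) ∞ c := by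
  intro p
  have h := hf (c p)
  have h1 : ContMDiffAt (𝓡 d) (𝓡 n) ∞ (h.localInverse ∘ (f ∘ c)) p :=
    ContMDiffAt.comp p h.localInverse_contMDiffAt (hfc p)
  refine h1.congr_of_eventuallyEq ?_
  have := hc.continuousAt.eventually h.localInverse_eventuallyEq_left
  filter_upwards [this] with q hq
  exact hq.symm

theorem isSubmersion_of_isLocalDiffeomorph [IsManifold (𝓡 n) ∞ M]
    [ChartedSpace (EuclideanSpace ℝ (Fin n)) A] [IsManifold (𝓡 n) ∞ A]
    {f : A → M} (hf : IsLocalDiffeomorph (𝓡 n) (𝓡 n) ∞ f) :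
    Manifold.IsSubmersion (𝓡 n) (𝓡 n) ∞ f := by
  refine ⟨PUnit, inferInstance, inferInstance, fun x => ?_⟩
  obtain ⟨Φ, hx, hΦ⟩ := hf x
  let c : OpenPartialHomeomorph M (EuclideanSpace ℝ (Fin n)) := chartAt _ (f x)
  let h : OpenPartialHomeomorph A M := Φ.toOpenPartialHomeomorph
  have hcm : c ∈ IsManifold.maximalAtlas (𝓡 n) ∞ M := IsManifold.chart_mem_maximalAtlas _
  have hfx : ∀ y ∈ h.source, f y = h y := fun y hy => hΦ hy
  have b1 := contMDiffOn_of_mem_maximalAtlas hcm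
  have b2 := contMDiffOn_symm_of_mem_maximalAtlas hcm
  refine Manifold.IsSubmersionAtOfComplement.mk_of_charts
    (LinearEquiv.prodUnique (R := ℝ) (M := EuclideanSpace ℝ (Fin n))
      (M₂ := PUnit)).symm.toContinuousLinearEquiv
    (h.trans c) c ?_ (mem_chart_source _ _) ?_ hcm ?_ ?_
  · refine ⟨hx, ?_⟩
    change h x ∈ c.source
    rw [← hfx x hx]; exact mem_chart_source _ _
  · rw [IsManifold.mem_maximalAtlas_iff_contMDiffOn]
    exact ⟨b1.comp (Φ.contMDiffOn_toFun.mono inter_subset_left) inter_subset_right,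
      Φ.contMDiffOn_invFun.comp (b2.mono inter_subset_left) inter_subset_right⟩
  · rintro y ⟨hy1, hy2⟩
    change f y ∈ c.source
    rw [hfx y hy1]; exact hy2
  · intro z hz
    have hz' : z ∈ (h.trans c).target := by simpa [mfld_simps] using hz
    have h1 : (h.symm (c.symm z)) ∈ h.source := h.map_target hz'.2
    change c (f (h.symm (c.symm z))) = z
    rw [hfx _ h1, h.right_inv hz'.2, c.right_inv hz'.1]

end Pullback

/-! ### Lie groupoids -/

/-- A Lie groupoid `(G₀, G₁, s, t, m, u, i)` with `dim G₀ = dimObj` and `dim G₁ = dimArr`.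
The base is Hausdorff, the manifold of arrows need not be.  As usual for groupoids attached to
large atlases, second countability is not imposed. -/
structure LieGroupoid : Type (u + 1) where
  dimObj : ℕ
  dimArr : ℕ
  /-- the base `G₀` -/
  Obj : Type u
  /-- the arrows `G₁` -/
  Arr : Type u
  [topObj : TopologicalSpace Obj]
  [chartedObj : ChartedSpace (EuclideanSpace ℝ (Fin dimObj)) Obj]
  [manifoldObj : IsManifold (𝓡 dimObj) ∞ Obj]
  [t2Obj : T2Space Obj]
  [topArr : TopologicalSpace Arr]
  [chartedArr : ChartedSpace (EuclideanSpace ℝ (Fin dimArr)) Arr]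
  [manifoldArr : IsManifold (𝓡 dimArr) ∞ Arr]
  s : Arr → Obj
  t : Arr → Obj
  /-- the composition, defined on the fibered product of `s` and `t` -/
  mul : {p : Arr × Arr // s p.1 = t p.2} → Arr
  one : Obj → Arr
  inv : Arr → Arr
  s_mul : ∀ p, s (mul p) = s p.1.2
  t_mul : ∀ p, t (mul p) = t p.1.1
  mul_assoc : ∀ (h g f : Arr) (hg : s h = t g) (gf : s g = t f),
    mul ⟨(h, mul ⟨(g, f), gf⟩), hg.trans (t_mul ⟨(g, f), gf⟩).symm⟩ =
      mul ⟨(mul ⟨(h, g), hg⟩, f), (s_mul ⟨(h, g), hg⟩).trans gf⟩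
  s_one : ∀ x, s (one x) = x
  t_one : ∀ x, t (one x) = x
  one_mul : ∀ f : Arr, mul ⟨(one (t f), f), s_one _⟩ = f
  mul_one : ∀ g : Arr, mul ⟨(g, one (s g)), (t_one _).symm⟩ = g
  s_inv : ∀ g, s (inv g) = t g
  t_inv : ∀ g, t (inv g) = s g
  mul_inv : ∀ g, mul ⟨(g, inv g), (t_inv g).symm⟩ = one (t g)
  inv_mul : ∀ g, mul ⟨(inv g, g), s_inv g⟩ = one (s g)
  s_submersion : Manifold.IsSubmersion (𝓡 dimArr) (𝓡 dimObj) ∞ s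
  t_submersion : Manifold.IsSubmersion (𝓡 dimArr) (𝓡 dimObj) ∞ t
  one_smooth : ContMDiff (𝓡 dimObj) (𝓡 dimArr) ∞ one
  inv_smooth : ContMDiff (𝓡 dimArr) (𝓡 dimArr) ∞ inv
  /-- The composition is smooth on the manifold `G₁ ×_{s,t} G₁`, an embedded submanifold of
  `G₁ × G₁`: smoothness is tested on smooth maps from open subsets of Euclidean spaces. -/
  mul_smooth : ∀ (d : ℕ) (U : TopologicalSpace.Opens (EuclideanSpace ℝ (Fin d)))
    (c : U → {p : Arr × Arr // s p.1 = t p.2}),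
    ContMDiff (𝓡 d) (𝓡 dimArr) ∞ (fun x => (c x).1.1) →
    ContMDiff (𝓡 d) (𝓡 dimArr) ∞ (fun x => (c x).1.2) →
    ContMDiff (𝓡 d) (𝓡 dimArr) ∞ (fun x => mul (c x))

namespace LieGroupoid

attribute [instance] topObj chartedObj manifoldObj t2Obj topArr chartedArr manifoldArr

variable (G H K : LieGroupoid.{u})

/-- `x ∼ y` iff there is an arrow `x → y`. -/
def orbitSetoid : Setoid G.Obj where
  r x y := ∃ g : G.Arr, G.s g = x ∧ G.t g = y
  iseqv :=
    { refl := fun x => ⟨G.one x, G.s_one x, G.t_one x⟩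
      symm := fun ⟨g, h1, h2⟩ => ⟨G.inv g, (G.s_inv g).trans h2, (G.t_inv g).trans h1⟩
      trans := fun ⟨g, h1, h2⟩ ⟨f, h3, h4⟩ =>
        ⟨G.mul ⟨(f, g), h3.trans h2.symm⟩, (G.s_mul _).trans h1, (G.t_mul _).trans h4⟩ }

/-- The orbit space `|G|` with the quotient topology. -/
def OrbitSpace : Type u := Quotient G.orbitSetoid

instance : TopologicalSpace G.OrbitSpace :=
  inferInstanceAs (TopologicalSpace (Quotient G.orbitSetoid))

/-- The projection `G₀ → |G|`. -/
def pr (x : G.Obj) : G.OrbitSpace := Quotient.mk G.orbitSetoid x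

/-- Homomorphisms of Lie groupoids. -/
@[ext]
structure Hom where
  obj : G.Obj → H.Obj
  arr : G.Arr → H.Arr
  map_s : ∀ g, H.s (arr g) = obj (G.s g)
  map_t : ∀ g, H.t (arr g) = obj (G.t g)
  map_mul : ∀ p : {p : G.Arr × G.Arr // G.s p.1 = G.t p.2},
    arr (G.mul p) = H.mul ⟨(arr p.1.1, arr p.1.2),
      (map_s _).trans ((congrArg obj p.2).trans (map_t _).symm)⟩
  map_one : ∀ x, arr (G.one x) = H.one (obj x)
  map_inv : ∀ g, arr (G.inv g) = H.inv (arr g)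
  smooth_obj : ContMDiff (𝓡 G.dimObj) (𝓡 H.dimObj) ∞ obj
  smooth_arr : ContMDiff (𝓡 G.dimArr) (𝓡 H.dimArr) ∞ arr

variable {G H K}

/-- The composition `ψ ∘ φ` of homomorphisms. -/
def Hom.comp (ψ : Hom H K) (φ : Hom G H) : Hom G K where
  obj := ψ.obj ∘ φ.obj
  arr := ψ.arr ∘ φ.arr
  map_s g := (ψ.map_s _).trans (congrArg ψ.obj (φ.map_s g))
  map_t g := (ψ.map_t _).trans (congrArg ψ.obj (φ.map_t g))
  map_mul p := (congrArg ψ.arr (φ.map_mul p)).trans (ψ.map_mul _)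
  map_one x := (congrArg ψ.arr (φ.map_one x)).trans (ψ.map_one _)
  map_inv g := (congrArg ψ.arr (φ.map_inv g)).trans (ψ.map_inv _)
  smooth_obj := ψ.smooth_obj.comp φ.smooth_obj
  smooth_arr := ψ.smooth_arr.comp φ.smooth_arr

/-- The map `|φ| : |G| → |H|`. -/
def Hom.orbitMap (φ : Hom G H) : G.OrbitSpace → H.OrbitSpace :=
  Quotient.map' φ.obj fun _ _ ⟨g, h1, h2⟩ =>
    ⟨φ.arr g, (φ.map_s g).trans (congrArg φ.obj h1), (φ.map_t g).trans (congrArg φ.obj h2)⟩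

/-- Weak equivalences.  The first two fields say that `t ∘ pr₁ : H₁ ×_{s,φ₀} G₀ → H₀` is a
surjective submersion; here the tangent space of the fibered product at `(h, x)` consists of the
pairs `(a, b)` with `ds(a) = dφ₀(b)`.  The last two fields say that the square formed by
`φ₁`, `(s,t)`, `φ₀ × φ₀`, `(s,t)` is a fibered product of sets and of smooth manifolds (the
universal property is tested on open subsets of Euclidean spaces). -/
structure Hom.IsWeakEquivalence (φ : Hom G H) : Prop where
  surjective : ∀ y : H.Obj, ∃ (h : H.Arr) (x : G.Obj), H.s h = φ.obj x ∧ H.t h = y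
  submersion : ∀ (h : H.Arr) (x : G.Obj), H.s h = φ.obj x →
    ∀ w : EuclideanSpace ℝ (Fin H.dimObj),
      ∃ (a : EuclideanSpace ℝ (Fin H.dimArr)) (b : EuclideanSpace ℝ (Fin G.dimObj)),
        mfderiv (𝓡 H.dimArr) (𝓡 H.dimObj) H.s h a =
          mfderiv (𝓡 G.dimObj) (𝓡 H.dimObj) φ.obj x b ∧
        mfderiv (𝓡 H.dimArr) (𝓡 H.dimObj) H.t h a = w
  pullback : ∀ (x y : G.Obj) (h : H.Arr), H.s h = φ.obj x → H.t h = φ.obj y →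
    ∃! g : G.Arr, G.s g = x ∧ G.t g = y ∧ φ.arr g = h
  pullback_smooth : ∀ (d : ℕ) (U : TopologicalSpace.Opens (EuclideanSpace ℝ (Fin d)))
    (c : U → G.Arr),
    ContMDiff (𝓡 d) (𝓡 G.dimObj) ∞ (G.s ∘ c) →
    ContMDiff (𝓡 d) (𝓡 G.dimObj) ∞ (G.t ∘ c) →
    ContMDiff (𝓡 d) (𝓡 H.dimArr) ∞ (φ.arr ∘ c) →
    ContMDiff (𝓡 d) (𝓡 G.dimArr) ∞ c

end LieGroupoid

/-- A Lie groupoid `G` marked by the topological space `X` through a homeomorphism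
`α : |G| → X`. -/
structure MarkedLieGroupoid (X : Type v) [TopologicalSpace X] extends LieGroupoid.{u} where
  mark : toLieGroupoid.OrbitSpace ≃ₜ X

namespace MarkedLieGroupoid

variable {X : Type v} [TopologicalSpace X] {Y : Type v} [TopologicalSpace Y]

/-- Homomorphisms of marked Lie groupoids, possibly marked by different spaces. -/
abbrev Hom (G : MarkedLieGroupoid.{u} X) (H : MarkedLieGroupoid.{u} Y) : Type u :=
  LieGroupoid.Hom G.toLieGroupoid H.toLieGroupoid

/-- Unit weak equivalences: weak equivalences `φ` with `α_H ∘ |φ| ∘ α_G⁻¹ = id_X`. -/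
def IsUnitWeakEquivalence {G H : MarkedLieGroupoid.{u} X} (φ : Hom G H) : Prop :=
  φ.IsWeakEquivalence ∧ ∀ q : X, H.mark (φ.orbitMap (G.mark.symm q)) = q

end MarkedLieGroupoid

/-! ### The groupoid of germs of a pseudogroup -/

section Germs

variable {n : ℕ} {M : Type u} [TopologicalSpace M] [ChartedSpace (EuclideanSpace ℝ (Fin n)) M]

/-- The identity of an open subset as a transition. -/
def Transition.idOn (U : TopologicalSpace.Opens M) : Transition n M where
  toPartialEquiv := PartialEquiv.ofSet U
  open_source := U.2
  open_target := U.2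
  contMDiffOn_toFun := contMDiffOn_id
  contMDiffOn_invFun := contMDiffOn_id

/-- Full pseudogroups. -/
structure FullPseudogroup (n : ℕ) (M : Type u) [TopologicalSpace M]
    [ChartedSpace (EuclideanSpace ℝ (Fin n)) M] where
  carrier : Set (Transition n M)
  trans_mem : ∀ f ∈ carrier, ∀ g ∈ carrier, f.trans g ∈ carrier
  symm_mem : ∀ f ∈ carrier, f.symm ∈ carrier
  id_mem : ∀ U : TopologicalSpace.Opens M, Transition.idOn U ∈ carrier

namespace FullPseudogroup

variable (P : FullPseudogroup n M)

/-- Pairs `(f, x)` with `f ∈ P` and `x ∈ dom f`, identified if the germs at `x` agree. -/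
def germSetoid : Setoid {p : Transition n M × M // p.1 ∈ P.carrier ∧ p.2 ∈ p.1.source} where
  r p q := p.1.2 = q.1.2 ∧ ∀ᶠ y in 𝓝 p.1.2, p.1.1 y = q.1.1 y
  iseqv :=
    { refl := fun p => ⟨rfl, Eventually.of_forall fun _ => rfl⟩
      symm := fun {p q} h => ⟨h.1.symm, by rw [← h.1]; exact h.2.mono fun _ => Eq.symm⟩
      trans := fun {p q r} h k => ⟨h.1.trans k.1, by
        have k2 := k.2
        rw [← h.1] at k2
        exact (h.2.and k2).mono fun _ h => h.1.trans h.2⟩ }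

/-- The set of germs of elements of `P`. -/
def Germ : Type u := Quotient P.germSetoid

variable {P}

/-- `germ_x f` -/
def germ (f : Transition n M) (hf : f ∈ P.carrier) (x : M) (hx : x ∈ f.source) : P.Germ :=
  Quotient.mk P.germSetoid ⟨(f, x), hf, hx⟩

theorem germ_eq_iff {f g : Transition n M} {hf : f ∈ P.carrier} {hg : g ∈ P.carrier} {x y : M}
    {hx : x ∈ f.source} {hy : y ∈ g.source} :
    (germ f hf x hx : P.Germ) = germ g hg y hy ↔ x = y ∧ ∀ᶠ z in 𝓝 x, f z = g z :=
  Quotient.eq (r := P.germSetoid)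

theorem Germ.ind {p : P.Germ → Prop}
    (h : ∀ f (hf : f ∈ P.carrier) x (hx : x ∈ f.source), p (germ f hf x hx)) (γ : P.Germ) :
    p γ := by
  induction γ using Quotient.inductionOn with
  | _ a => exact h a.1.1 a.2.1 a.1.2 a.2.2

/-- The source `germ_x f ↦ x`. -/
def src (γ : P.Germ) : M := Quotient.lift (s := P.germSetoid) (fun p => p.1.2) (fun _ _ h => h.1) γ

/-- The target `germ_x f ↦ f x`. -/
def tgt (γ : P.Germ) : M := Quotient.lift (s := P.germSetoid) (fun p => p.1.1 p.1.2)
  (fun p q h => by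
    have e : p.1.1 p.1.2 = q.1.1 p.1.2 := h.2.self_of_nhds
    have e' : p.1.2 = q.1.2 := h.1
    exact e.trans (congrArg _ e')) γ

@[simp] theorem src_germ (f : Transition n M) (hf : f ∈ P.carrier) (x : M) (hx : x ∈ f.source) :
    src (germ f hf x hx) = x := rfl

@[simp] theorem tgt_germ (f : Transition n M) (hf : f ∈ P.carrier) (x : M) (hx : x ∈ f.source) :
    tgt (germ f hf x hx) = f x := rfl

theorem mem_trans_source {f g : Transition n M} {x : M} (hx : x ∈ f.source)
    (hy : f x ∈ g.source) : x ∈ (f.trans g).source := ⟨hx, hy⟩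

theorem tendsto_transition {f : Transition n M} {x : M} (hx : x ∈ f.source) :
    Tendsto f (𝓝 x) (𝓝 (f x)) :=
  (f.contMDiffOn_toFun.continuousOn).continuousAt (f.open_source.mem_nhds hx)

/-- The composition `(germ_{f x} g, germ_x f) ↦ germ_x (g ∘ f)`. -/
def germMul (p : {p : P.Germ × P.Germ // src p.1 = tgt p.2}) : P.Germ :=
  Quotient.hrecOn₂ (sa := P.germSetoid) (sb := P.germSetoid)
    (φ := fun a b => src (P := P) a = tgt (P := P) b → P.Germ) p.1.1 p.1.2
    (fun a b h => germ (b.1.1.trans a.1.1) (P.trans_mem _ b.2.1 _ a.2.1) b.1.2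
      (mem_trans_source b.2.2 (by
        have h' : a.1.2 = b.1.1 b.1.2 := h
        rw [← h']; exact a.2.2)))
    (by
      intro a b a' b' ha hb
      apply Function.hfunext
      · have e1 : (Quotient.mk P.germSetoid a : P.Germ) = Quotient.mk P.germSetoid a' :=
          Quotient.sound ha
        have e2 : (Quotient.mk P.germSetoid b : P.Germ) = Quotient.mk P.germSetoid b' :=
          Quotient.sound hb
        simp only [e1, e2]
      · intro h h' _
        apply heq_of_eq
        rw [germ_eq_iff]
        refine ⟨hb.1, ?_⟩
        have h1 : a.1.2 = b.1.1 b.1.2 := h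
        have ha2 := ha.2
        rw [h1] at ha2
        have := (tendsto_transition b.2.2).eventually ha2
        filter_upwards [this, hb.2] with z hz1 hz2
        change a.1.1 (b.1.1 z) = a'.1.1 (b'.1.1 z)
        rw [hz1, hz2]) p.2

@[simp] theorem germMul_germ (f g : Transition n M) (hf : f ∈ P.carrier) (hg : g ∈ P.carrier)
    (x y : M) (hx : x ∈ f.source) (hy : y ∈ g.source) (h : y = f x) :
    germMul ⟨(germ g hg y hy, germ f hf x hx), h⟩ =
      germ (f.trans g) (P.trans_mem _ hf _ hg) x (mem_trans_source hx (h ▸ hy)) := rfl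

theorem src_germMul (p : {p : P.Germ × P.Germ // src p.1 = tgt p.2}) :
    src (germMul p) = src p.1.2 := by
  obtain ⟨⟨γ, δ⟩, h⟩ := p
  induction γ using Germ.ind
  induction δ using Germ.ind
  rfl

/-- The unit `x ↦ germ_x id`. -/
def germOne (x : M) : P.Germ := germ (Transition.idOn ⊤) (P.id_mem ⊤) x trivial

/-- The inversion `germ_x f ↦ germ_{f x} f⁻¹`. -/
def germInv (γ : P.Germ) : P.Germ :=
  Quotient.lift (s := P.germSetoid)
    (fun p => (germ p.1.1.symm (P.symm_mem _ p.2.1) (p.1.1 p.1.2)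
      (p.1.1.map_source p.2.2) : P.Germ))
    (fun p q h => by
      refine germ_eq_iff.2 ?_
      replace h : p.1.2 = q.1.2 ∧ ∀ᶠ y in 𝓝 p.1.2, p.1.1 y = q.1.1 y := h
      have e := h.2.self_of_nhds
      refine ⟨by rw [e, h.1], ?_⟩
      have hp : p.1.1 p.1.2 ∈ p.1.1.symm.source := p.1.1.map_source p.2.2
      have hq : q.1.1 q.1.2 ∈ q.1.1.symm.source := q.1.1.map_source q.2.2
      have l1 := tendsto_transition hp
      have e1 : p.1.1.symm (p.1.1 p.1.2) = p.1.2 := p.1.1.left_inv p.2.2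
      rw [e1] at l1
      have k := l1.eventually h.2
      have k1 := p.1.1.symm.open_source.mem_nhds hp
      have k2 := l1.eventually (q.1.1.open_source.mem_nhds (by rw [h.1]; exact q.2.2))
      filter_upwards [k, k1, k2] with z hz hz1 hz2
      have r : p.1.1 (p.1.1.symm z) = z := p.1.1.right_inv hz1
      change p.1.1.symm z = q.1.1.symm z
      rw [r] at hz
      conv_rhs => rw [hz]
      exact (q.1.1.left_inv hz2).symm) γ

@[simp] theorem germInv_germ (f : Transition n M) (hf : f ∈ P.carrier) (x : M)
    (hx : x ∈ f.source) : germInv (germ f hf x hx) =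
      germ f.symm (P.symm_mem _ hf) (f x) (f.map_source hx) := rfl

/-- The local section `x ↦ germ_x f` of the source map over `dom f`. -/
def sec (f : P.carrier) (x : f.1.source) : P.Germ := germ f.1 f.2 x.1 x.2

/-- The germ topology: the final topology for the sections `x ↦ germ_x f`, `f ∈ P`. -/
instance : TopologicalSpace P.Germ :=
  ⨆ f : P.carrier, TopologicalSpace.coinduced (sec f) inferInstance

theorem continuous_sec (f : P.carrier) : Continuous (sec f) :=
  continuous_iff_coinduced_le.2 (le_iSup (fun f : P.carrier =>
    TopologicalSpace.coinduced (sec f) inferInstance) f)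

theorem isOpen_germ_iff {S : Set P.Germ} : IsOpen S ↔ ∀ f : P.carrier, IsOpen (sec f ⁻¹' S) := by
  rw [isOpen_iSup_iff]; rfl

theorem continuous_src : Continuous (src : P.Germ → M) := by
  refine ⟨fun W hW => isOpen_germ_iff.2 fun f => ?_⟩
  exact hW.preimage continuous_subtype_val

theorem isOpen_range_sec (f : P.carrier) : IsOpen (range (sec f)) := by
  refine isOpen_germ_iff.2 fun g => ?_
  have : sec g ⁻¹' range (sec f) =
      Subtype.val ⁻¹' (f.1.source ∩ {x | ∀ᶠ z in 𝓝 x, f.1 z = g.1 z}) := by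
    ext x
    constructor
    · rintro ⟨y, hy⟩
      obtain ⟨h1, h2⟩ := germ_eq_iff.1 hy
      rw [h1] at h2
      exact ⟨h1 ▸ y.2, h2⟩
    · rintro ⟨h1, h2⟩
      exact ⟨⟨x.1, h1⟩, germ_eq_iff.2 ⟨rfl, h2⟩⟩
  rw [this]
  exact (f.1.open_source.inter isOpen_setOfPred_eventually_nhds).preimage continuous_subtype_val

open Classical in
/-- The bijection `germ_x f ↦ x` from `{germ_x f | x ∈ dom f}` onto `dom f`. -/
def srcHomeo (f : P.carrier) : OpenPartialHomeomorph P.Germ M where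
  toFun := src
  invFun x := if hx : x ∈ f.1.source then germ f.1 f.2 x hx else germOne x
  source := range (sec f)
  target := f.1.source
  map_source' := by rintro _ ⟨x, rfl⟩; exact x.2
  map_target' x hx := by rw [dif_pos hx]; exact ⟨⟨x, hx⟩, rfl⟩
  left_inv' := by
    rintro _ ⟨x, rfl⟩
    change (if hx : x.1 ∈ f.1.source then germ f.1 f.2 x.1 hx else germOne x.1) = _
    rw [dif_pos x.2]; rfl
  right_inv' x hx := by rw [dif_pos hx]; rfl
  open_source := isOpen_range_sec f
  open_target := f.1.open_source
  continuousOn_toFun := continuous_src.continuousOn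
  continuousOn_invFun := by
    rw [continuousOn_iff_continuous_domRestrict]
    convert continuous_sec f using 1
    ext x
    simp only [Set.domRestrict_apply]
    rw [dif_pos x.2]; rfl

theorem isLocalHomeomorph_src : IsLocalHomeomorph (src : P.Germ → M) := by
  intro γ
  induction γ using Germ.ind with
  | h f hf x hx => exact ⟨srcHomeo ⟨f, hf⟩, ⟨⟨x, hx⟩, rfl⟩, rfl⟩

instance : ChartedSpace (EuclideanSpace ℝ (Fin n)) P.Germ :=
  pullbackChartedSpace src isLocalHomeomorph_src

/-- Two maps into the germs which agree locally with a section are continuous. -/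
theorem continuous_of_local_sec {N : Type*} [TopologicalSpace N] {c : N → P.Germ} {a : N → M}
    (ha : Continuous a)
    (h : ∀ p, ∃ f : P.carrier, ∀ᶠ q in 𝓝 p, ∃ hq : a q ∈ f.1.source, c q = sec f ⟨a q, hq⟩) :
    Continuous c := by
  rw [continuous_iff_continuousAt]
  intro p
  obtain ⟨f, hf⟩ := h p
  obtain ⟨hp, hcp⟩ := hf.self_of_nhds
  have h1 : ContinuousAt (srcHomeo f).symm (a p) :=
    (srcHomeo f).continuousAt_symm (x := a p) hp
  have h2 : ContinuousAt ((srcHomeo f).symm ∘ a) p := ContinuousAt.comp h1 ha.continuousAt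
  refine h2.congr ?_
  filter_upwards [hf] with q ⟨hq, hcq⟩
  rw [hcq]
  exact dif_pos hq

/-- Near a point, a continuous map into the germs is given by a section. -/
theorem eventually_sec {N : Type*} [TopologicalSpace N] {c : N → P.Germ} (hc : Continuous c)
    (p : N) {f : P.carrier} {x : f.1.source} (hp : c p = sec f x) :
    ∀ᶠ q in 𝓝 p, ∃ hq : src (c q) ∈ f.1.source, c q = sec f ⟨src (c q), hq⟩ := by
  have := hc.continuousAt.preimage_mem_nhds
    ((isOpen_range_sec f).mem_nhds (x := c p) (hp ▸ ⟨x, rfl⟩))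
  filter_upwards [this] with q ⟨y, hy⟩
  have e : src (c q) = y.1 := by rw [← hy]; rfl
  refine ⟨e ▸ y.2, hy.symm.trans ?_⟩
  exact germ_eq_iff.2 ⟨e.symm, Eventually.of_forall fun _ => rfl⟩

variable [IsManifold (𝓡 n) ∞ M]

instance : IsManifold (𝓡 n) ∞ P.Germ := pullback_isManifold src isLocalHomeomorph_src

theorem isLocalDiffeomorph_src : IsLocalDiffeomorph (𝓡 n) (𝓡 n) ∞ (src : P.Germ → M) :=
  pullback_isLocalDiffeomorph src isLocalHomeomorph_src

theorem isLocalDiffeomorph_tgt : IsLocalDiffeomorph (𝓡 n) (𝓡 n) ∞ (tgt : P.Germ → M) := by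
  intro γ
  induction γ using Germ.ind with
  | h f hf x hx =>
    have h1 := IsLocalDiffeomorphAt.comp (𝓡 n) M
      (isLocalDiffeomorph_src (germ f hf x hx : P.Germ)) (f.isLocalDiffeomorphAt _ _ _ (x := x) hx)
    obtain ⟨Φ, hΦ, hE⟩ := h1
    let O : Set P.Germ := range (sec ⟨f, hf⟩)
    have hO : IsOpen O := isOpen_range_sec _
    let Ψ := (Φ.toOpenPartialHomeomorph).restrOpen O hO
    refine ⟨⟨Ψ.toPartialEquiv, Ψ.open_source, Ψ.open_target,
      Φ.contMDiffOn_toFun.mono ?_, Φ.contMDiffOn_invFun.mono ?_⟩, ?_, ?_⟩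
    · exact inter_subset_left
    · intro y hy; exact hy.1
    · exact ⟨hΦ, ⟨x, hx⟩, rfl⟩
    · rintro _ ⟨h, y, rfl⟩
      exact hE h

theorem continuous_tgt : Continuous (tgt : P.Germ → M) :=
  isLocalDiffeomorph_tgt.contMDiff.continuous

variable (P) in
/-- The Lie groupoid `Γ(P)` of germs of a full pseudogroup `P` on a manifold `M`. -/
def groupoid [T2Space M] : LieGroupoid.{u} where
  dimObj := n
  dimArr := n
  Obj := M
  Arr := P.Germ
  s := src
  t := tgt
  mul := germMul
  one := germOne
  inv := germInv
  s_mul := src_germMul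
  t_mul := by
    rintro ⟨⟨γ, δ⟩, h⟩
    induction γ using Germ.ind
    induction δ using Germ.ind
    simp only [src_germ, tgt_germ] at h
    subst h
    rfl
  mul_assoc := by
    intro γ δ ε h1 h2
    induction γ using Germ.ind
    induction δ using Germ.ind
    induction ε using Germ.ind with
    | h f hf x hx =>
      simp only [src_germ, tgt_germ] at h1 h2
      subst h1 h2
      exact Quotient.sound ⟨rfl, Eventually.of_forall fun _ => rfl⟩
  s_one _ := rfl
  t_one _ := rfl
  one_mul := by
    intro γ
    induction γ using Germ.ind with
    | h f hf x hx => exact Quotient.sound ⟨rfl, Eventually.of_forall fun _ => rfl⟩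
  mul_one := by
    intro γ
    induction γ using Germ.ind with
    | h f hf x hx => exact Quotient.sound ⟨rfl, Eventually.of_forall fun _ => rfl⟩
  s_inv := by
    intro γ
    induction γ using Germ.ind
    rfl
  t_inv := by
    intro γ
    induction γ using Germ.ind with
    | h f hf x hx => exact f.left_inv hx
  mul_inv := by
    intro γ
    induction γ using Germ.ind with
    | h f hf x hx =>
      refine Quotient.sound ⟨rfl, ?_⟩
      filter_upwards [f.open_target.mem_nhds (f.map_source hx)] with z hz
      exact f.right_inv hz
  inv_mul := by
    intro γ
    induction γ using Germ.ind with
    | h f hf x hx =>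
      refine Quotient.sound ⟨rfl, ?_⟩
      filter_upwards [f.open_source.mem_nhds hx] with z hz
      exact f.left_inv hz
  s_submersion := isSubmersion_of_isLocalDiffeomorph isLocalDiffeomorph_src
  t_submersion := isSubmersion_of_isLocalDiffeomorph isLocalDiffeomorph_tgt
  one_smooth := by
    refine contMDiff_of_comp_isLocalDiffeomorph isLocalDiffeomorph_src ?_ contMDiff_id
    refine continuous_of_local_sec continuous_id fun p =>
      ⟨⟨_, P.id_mem ⊤⟩, Eventually.of_forall fun q => ⟨trivial, rfl⟩⟩
  inv_smooth := by
    have e : src ∘ germInv = (tgt : P.Germ → M) := by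
      funext γ
      induction γ using Germ.ind
      rfl
    refine contMDiff_of_comp_isLocalDiffeomorph isLocalDiffeomorph_src ?_
      (by rw [e]; exact isLocalDiffeomorph_tgt.contMDiff)
    refine continuous_of_local_sec continuous_tgt fun γ => ?_
    induction γ using Germ.ind with
    | h f hf x hx =>
      refine ⟨⟨_, P.symm_mem _ hf⟩, ?_⟩
      filter_upwards [eventually_sec continuous_id (germ f hf x hx) (f := ⟨f, hf⟩)
        (x := ⟨x, hx⟩) rfl] with δ ⟨hδ, eδ⟩
      have eδ' : δ = sec ⟨f, hf⟩ ⟨_, hδ⟩ := eδ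
      rw [eδ']
      exact ⟨f.map_source hδ, rfl⟩
  mul_smooth := by
    intro d U c h1 h2
    have e : src ∘ (fun x => germMul (c x)) = fun x => (src (c x).1.2 : M) := by
      funext x
      exact src_germMul (c x)
    have c2 : Continuous (fun x => (src (c x).1.2 : M)) := continuous_src.comp h2.continuous
    refine contMDiff_of_comp_isLocalDiffeomorph isLocalDiffeomorph_src ?_
      (by rw [e]; exact isLocalDiffeomorph_src.contMDiff.comp h2)
    refine continuous_of_local_sec c2 fun p => ?_
    obtain ⟨g, y, hg⟩ : ∃ (g : P.carrier) (y : g.1.source), (c p).1.1 = sec g y := by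
      generalize (c p).1.1 = γ
      induction γ using Germ.ind with
      | h f hf x hx => exact ⟨⟨f, hf⟩, ⟨x, hx⟩, rfl⟩
    obtain ⟨f, x, hf⟩ : ∃ (f : P.carrier) (x : f.1.source), (c p).1.2 = sec f x := by
      generalize (c p).1.2 = γ
      induction γ using Germ.ind with
      | h f hf x hx => exact ⟨⟨f, hf⟩, ⟨x, hx⟩, rfl⟩
    refine ⟨⟨_, P.trans_mem _ f.2 _ g.2⟩, ?_⟩
    filter_upwards [eventually_sec h1.continuous p hg, eventually_sec h2.continuous p hf]
      with q ⟨hq1, eq1⟩ ⟨hq2, eq2⟩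
    have hh := (c q).2
    rw [eq2] at hh
    have hh' : src (c q).1.1 = f.1 (src (c q).1.2) := hh
    refine ⟨mem_trans_source hq2 (hh' ▸ hq1), ?_⟩
    have : c q = ⟨(sec g ⟨_, hq1⟩, sec f ⟨_, hq2⟩), hh'⟩ :=
      Subtype.ext (Prod.ext eq1 eq2)
    exact (congrArg germMul this).trans rfl

end FullPseudogroup

end Germs

/-! ### Orbifolds -/

/-- Orbifold charts `(V, G, φ)` of dimension `n` on `Q`: a connected manifold `V`, a finite
subgroup `G` of `Diff(V)`, and a continuous map `φ : V → Q` with open image which induces a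
homeomorphism from `G \ V` onto `φ(V)`; that is, `φ` is continuous and open, and its fibers are
the `G`-orbits. -/
structure OrbChart (Q : Type u) [TopologicalSpace Q] (n : ℕ) : Type (u + 1) where
  V : Type u
  [topV : TopologicalSpace V]
  [chartedV : ChartedSpace (EuclideanSpace ℝ (Fin n)) V]
  [manifoldV : IsManifold (𝓡 n) ∞ V]
  [t2V : T2Space V]
  [secondCountableV : SecondCountableTopology V]
  [connectedV : ConnectedSpace V]
  G : Subgroup (V ≃ₘ^∞⟮𝓡 n, 𝓡 n⟯ V)
  finite_G : Finite G
  φ : V → Q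
  continuous_φ : Continuous φ
  isOpenMap_φ : IsOpenMap φ
  φ_eq_iff : ∀ x y, φ x = φ y ↔ ∃ g ∈ G, g x = y

attribute [instance] OrbChart.topV OrbChart.chartedV OrbChart.manifoldV OrbChart.t2V
  OrbChart.secondCountableV OrbChart.connectedV

section Orbifold

variable {Q : Type u} [TopologicalSpace Q] {Q' : Type u} [TopologicalSpace Q']
  {Q'' : Type u} [TopologicalSpace Q'']

/-- Two orbifold charts are compatible if any two points over the same point of `Q` are related
by a change of charts, i.e. a diffeomorphism `h` between open connected subsets with
`ψ ∘ h = φ`. -/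
def OrbChart.Compatible {n : ℕ} (c d : OrbChart Q n) : Prop :=
  ∀ (x : c.V) (y : d.V), c.φ x = d.φ y →
    ∃ h : PartialDiffeomorph (𝓡 n) (𝓡 n) c.V d.V ∞, IsConnected h.source ∧ x ∈ h.source ∧
      h x = y ∧ ∀ z ∈ h.source, d.φ (h z) = c.φ z

/-- Orbifold atlases: sets of pairwise compatible charts which cover `Q`. -/
structure IsOrbAtlas {n : ℕ} (U : Set (OrbChart Q n)) : Prop where
  compatible : ∀ c ∈ U, ∀ d ∈ U, c.Compatible d
  cover : ∀ q : Q, ∃ c ∈ U, q ∈ range c.φ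

variable (Q) in
/-- Orbifold structures on `Q`, given by their maximal atlases. -/
structure OrbStr : Type (u + 1) where
  n : ℕ
  charts : Set (OrbChart Q n)
  maximal : Maximal IsOrbAtlas charts

/-- A representative of an orbifold structure: an atlas `{(V_i, G_i, π_i) | i ∈ I}` in it, indexed
by `I`.  Copies of a chart under different indices count as different. -/
structure AtlasRep (S : OrbStr Q) : Type (u + 1) where
  I : Type u
  chart : I → OrbChart Q S.n
  mem : ∀ i, chart i ∈ S.charts
  cover : ∀ q : Q, ∃ i, q ∈ range (chart i).φ

namespace AtlasRep

variable {S : OrbStr Q} (𝒱 : AtlasRep S)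

/-- The manifold `V = ∐ V_i`. -/
abbrev Base : Type u := Σ i, (𝒱.chart i).V

/-- The map `π = ∐ π_i : V → Q`. -/
def π (x : 𝒱.Base) : Q := (𝒱.chart x.1).φ x.2

theorem continuous_π : Continuous 𝒱.π :=
  continuous_sigma fun i => (𝒱.chart i).continuous_φ

theorem isOpenMap_π : IsOpenMap 𝒱.π :=
  isOpenMap_sigma.2 fun i => (𝒱.chart i).isOpenMap_φ

theorem surjective_π : Function.Surjective 𝒱.π := fun q => by
  obtain ⟨i, x, hx⟩ := 𝒱.cover q
  exact ⟨⟨i, x⟩, hx⟩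

/-- The pseudogroup `Ψ(𝒱)` of all transitions `f` on `V` with `π ∘ f = π` on `dom f`. -/
def Ψ : FullPseudogroup S.n 𝒱.Base where
  carrier := {f | ∀ x ∈ f.source, 𝒱.π (f x) = 𝒱.π x}
  trans_mem f hf g hg x hx := (hg (f x) hx.2).trans (hf x hx.1)
  symm_mem f hf x hx := by
    have h := hf (f.symm x) (f.map_target hx)
    have e : f (f.symm x) = x := f.right_inv hx
    rw [e] at h
    exact h.symm
  id_mem _ _ _ := rfl

/-- Points of `V` over the same point of `Q` are related by an element of `Ψ(𝒱)`. -/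
theorem exists_transition {x y : 𝒱.Base} (h : 𝒱.π x = 𝒱.π y) :
    ∃ f ∈ 𝒱.Ψ.carrier, x ∈ f.source ∧ f x = y := by
  obtain ⟨i, x⟩ := x
  obtain ⟨j, y⟩ := y
  obtain ⟨k, -, hx, rfl, hk⟩ :=
    S.maximal.prop.compatible _ (𝒱.mem i) _ (𝒱.mem j) x y h
  obtain ⟨A, hA, eA⟩ := sigmaMk_isLocalDiffeomorph (n := S.n) (fun i => (𝒱.chart i).V) i x
  obtain ⟨B, hB, eB⟩ := sigmaMk_isLocalDiffeomorph (n := S.n) (fun i => (𝒱.chart i).V) j (k x)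
  have l : A.symm (⟨i, x⟩ : 𝒱.Base) = x := by
    have : (⟨i, x⟩ : 𝒱.Base) = A x := eA hA
    rw [this]
    exact A.left_inv hA
  refine ⟨(A.symm.trans k).trans B, ?_, ⟨⟨?_, ?_⟩, ?_⟩, ?_⟩
  · rintro z ⟨⟨hz1, hz2⟩, hz3⟩
    have e1 : (⟨i, A.symm z⟩ : 𝒱.Base) = z :=
      (eA (A.map_target hz1)).trans (A.right_inv hz1)
    have e2 : (⟨j, k (A.symm z)⟩ : 𝒱.Base) = B (k (A.symm z)) := eB hz3
    change 𝒱.π (B (k (A.symm z))) = 𝒱.π z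
    rw [← e2]
    exact (hk (A.symm z) hz2).trans (congrArg 𝒱.π e1)
  · have : (⟨i, x⟩ : 𝒱.Base) = A x := eA hA
    rw [this]
    exact A.map_source hA
  · change A.symm (⟨i, x⟩ : 𝒱.Base) ∈ k.source
    rw [l]; exact hx
  · change k (A.symm (⟨i, x⟩ : 𝒱.Base)) ∈ B.source
    rw [l]; exact hB
  · change B (k (A.symm (⟨i, x⟩ : 𝒱.Base))) = _
    rw [l]
    exact (eB hB).symm

/-- The map `α : |Γ(𝒱)| → Q`, `[x] ↦ π x`. -/
def α : 𝒱.Ψ.groupoid.OrbitSpace → Q :=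
  Quotient.lift (s := 𝒱.Ψ.groupoid.orbitSetoid) 𝒱.π (by
    rintro _ _ ⟨γ, rfl, rfl⟩
    induction γ using FullPseudogroup.Germ.ind with
    | h f hf x hx => exact (hf x hx).symm)

theorem isHomeomorph_α : IsHomeomorph 𝒱.α where
  continuous := 𝒱.continuous_π.quotient_lift _
  isOpenMap := fun W hW => by
    have e : 𝒱.α '' W = 𝒱.π '' (𝒱.Ψ.groupoid.pr ⁻¹' W) := by
      ext q
      constructor
      · rintro ⟨w, hw, rfl⟩
        induction w using Quotient.inductionOn with
        | _ x => exact ⟨x, hw, rfl⟩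
      · rintro ⟨x, hx, rfl⟩
        exact ⟨_, hx, rfl⟩
    rw [e]
    exact 𝒱.isOpenMap_π _ (hW.preimage continuous_quotient_mk')
  bijective := by
    constructor
    · intro a b
      induction a using Quotient.inductionOn with
      | _ x =>
        induction b using Quotient.inductionOn with
        | _ y =>
          intro h
          obtain ⟨f, hf, hx, rfl⟩ := 𝒱.exists_transition h
          exact Quotient.sound ⟨FullPseudogroup.germ f hf x hx, rfl, rfl⟩
    · intro q
      obtain ⟨x, rfl⟩ := 𝒱.surjective_π q
      exact ⟨𝒱.Ψ.groupoid.pr x, rfl⟩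

/-- The groupoid `Γ(𝒱)` of germs of elements of `Ψ(𝒱)`, marked by `Q` through `α`. -/
def Γ : MarkedLieGroupoid.{u} Q where
  toLieGroupoid := 𝒱.Ψ.groupoid
  mark := 𝒱.isHomeomorph_α.homeomorph

end AtlasRep


/-! ### Charted orbifold maps -/

section Pseudo

variable {n : ℕ} {M : Type u} [TopologicalSpace M] [ChartedSpace (EuclideanSpace ℝ (Fin n)) M]

/-- Quasi-pseudogroups: sets of transitions closed under inversion and composition of germs. -/
structure IsQuasiPseudogroup (P : Set (Transition n M)) : Prop where
  inv : ∀ f ∈ P, ∀ x ∈ f.source, ∃ g ∈ P, f x ∈ g.source ∧ ∀ᶠ y in 𝓝 x, g (f y) = y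
  comp : ∀ f ∈ P, ∀ g ∈ P, ∀ x ∈ f.source, f x ∈ g.source →
    ∃ h ∈ P, x ∈ h.source ∧ ∀ᶠ y in 𝓝 x, g (f y) = h y

/-- The pseudogroup `A` is generated by `B`. -/
def Generates (B A : Set (Transition n M)) : Prop :=
  B ⊆ A ∧ ∀ f ∈ A, ∀ x ∈ f.source, ∃ g ∈ B, x ∈ g.source ∧ ∀ᶠ y in 𝓝 x, f y = g y

end Pseudo

/-- The open subset `W` of `∐ V_i`, together with the restriction of `π`, underlies an orbifold
chart `(W, H, χ)` of the orbifold structure. -/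
def AtlasRep.IsChartDomain {S : OrbStr Q} (𝒱 : AtlasRep S) (W : Set 𝒱.Base) : Prop :=
  ∃ c ∈ S.charts, ∃ j : c.V → 𝒱.Base, IsOpenEmbedding j ∧ IsLocalDiffeomorph (𝓡 S.n) (𝓡 S.n) ∞ j ∧
    range j = W ∧ ∀ x, 𝒱.π (j x) = c.φ x

/-- Representatives `(f, {f̃_i}, P, ν)` of orbifold maps with domain atlas `𝒱` and range family in
`𝒱'`; `f̃_i : V_i → V'_{tgt i}` is denoted by `lift i`. -/
structure OrbRep {S : OrbStr Q} {S' : OrbStr Q'} (𝒱 : AtlasRep S) (𝒱' : AtlasRep S') where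
  f : Q → Q'
  continuous_f : Continuous f
  tgt : 𝒱.I → 𝒱'.I
  lift : ∀ i, (𝒱.chart i).V → (𝒱'.chart (tgt i)).V
  smooth_lift : ∀ i, ContMDiff (𝓡 S.n) (𝓡 S'.n) ∞ (lift i)
  φ_lift : ∀ i x, (𝒱'.chart (tgt i)).φ (lift i x) = f ((𝒱.chart i).φ x)
  P : Set (Transition S.n 𝒱.Base)
  quasi : IsQuasiPseudogroup P
  /-- The elements of `P` are changes of charts. -/
  changes : ∀ l ∈ P, IsConnected l.source ∧ ∃ i j : 𝒱.I,
    l.source ⊆ range (Sigma.mk i) ∧ l.target ⊆ range (Sigma.mk j)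
  generates : Generates P 𝒱.Ψ.carrier
  ν : P → Transition S'.n 𝒱'.Base
  /-- With `π ∘ f̃ = f ∘ π`, this and `ν_source` say that `ν l` is an open embedding between
  orbifold charts. -/
  ν_mem : ∀ l, ν l ∈ 𝒱'.Ψ.carrier
  ν_source : ∀ l, 𝒱'.IsChartDomain (ν l).source
  ν_lift : ∀ (l : P) (x : 𝒱.Base), x ∈ l.1.source →
    Sigma.map tgt lift x ∈ (ν l).source ∧
      Sigma.map tgt lift (l.1 x) = ν l (Sigma.map tgt lift x)
  ν_germ : ∀ (l m : P) (x : 𝒱.Base), x ∈ l.1.source → x ∈ m.1.source →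
    (∀ᶠ y in 𝓝 x, l.1 y = m.1 y) → ∀ᶠ y in 𝓝 (Sigma.map tgt lift x), ν l y = ν m y
  ν_mul : ∀ (l m h : P) (x : 𝒱.Base), x ∈ l.1.source → l.1 x ∈ m.1.source → x ∈ h.1.source →
    (∀ᶠ y in 𝓝 x, m.1 (l.1 y) = h.1 y) →
    ∀ᶠ y in 𝓝 (Sigma.map tgt lift x), ν m (ν l y) = ν h y
  ν_one : ∀ (l : P) (x : 𝒱.Base), x ∈ l.1.source → (∀ᶠ y in 𝓝 x, l.1 y = y) →
    ∀ᶠ y in 𝓝 (Sigma.map tgt lift x), ν l y = y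

namespace OrbRep

variable {S : OrbStr Q} {S' : OrbStr Q'} {S'' : OrbStr Q''} {𝒱 : AtlasRep S} {𝒱' : AtlasRep S'}
  {𝒱'' : AtlasRep S''}

/-- The map `ψ = ∐ f̃_i`. -/
def ψ (f : OrbRep 𝒱 𝒱') : 𝒱.Base → 𝒱'.Base := Sigma.map f.tgt f.lift

variable (𝒱 𝒱') in
/-- Equivalence of representatives of orbifold maps. -/
def setoid : Setoid (OrbRep 𝒱 𝒱') where
  r f g := f.f = g.f ∧ f.ψ = g.ψ ∧ ∀ (l : f.P) (m : g.P) (x : 𝒱.Base), x ∈ l.1.source →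
    x ∈ m.1.source → (∀ᶠ y in 𝓝 x, l.1 y = m.1 y) → ∀ᶠ y in 𝓝 (f.ψ x), f.ν l y = g.ν m y
  iseqv :=
    { refl := fun f => ⟨rfl, rfl, f.ν_germ⟩
      symm := fun {f g} ⟨h1, h2, h3⟩ => ⟨h1.symm, h2.symm, fun l m x hl hm h => by
        rw [← h2]
        exact (h3 m l x hm hl (h.mono fun _ => Eq.symm)).mono fun _ => Eq.symm⟩
      trans := fun {f g k} ⟨h1, h2, h3⟩ ⟨k1, k2, k3⟩ => ⟨h1.trans k1, h2.trans k2,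
        fun l m x hl hm h => by
          obtain ⟨p, hp, hx, hlp⟩ := g.generates.2 l.1 (f.generates.1 l.2) x hl
          have a := h3 l ⟨p, hp⟩ x hl hx hlp
          have b := k3 ⟨p, hp⟩ m x hx hm ((hlp.and h).mono fun _ h => h.1.symm.trans h.2)
          rw [← h2] at b
          exact (a.and b).mono fun _ h => h.1.trans h.2⟩ }

/-- `h` is a representative of the composition `g ∘ f`: whenever `l ∈ P_h` has at `x` the germ of
`m ∈ P_f`, and `ν_f m` has at `ψ_f x` the germ of `ξ ∈ P_g`, then `ν_h l` and `ν_g ξ` have the same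
germ at `ψ_h x`. -/
def IsComp (f : OrbRep 𝒱 𝒱') (g : OrbRep 𝒱' 𝒱'') (h : OrbRep 𝒱 𝒱'') : Prop :=
  h.f = g.f ∘ f.f ∧ h.ψ = g.ψ ∘ f.ψ ∧
    ∀ (l : h.P) (m : f.P) (ξ : g.P) (x : 𝒱.Base), x ∈ l.1.source → x ∈ m.1.source →
      f.ψ x ∈ ξ.1.source → (∀ᶠ y in 𝓝 x, l.1 y = m.1 y) →
      (∀ᶠ y in 𝓝 (f.ψ x), ξ.1 y = f.ν m y) →
      ∀ᶠ y in 𝓝 (h.ψ x), h.ν l y = g.ν ξ y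

/-- `φ : Γ(𝒱) → Γ(𝒱')` is the homomorphism `F₁(f̂)`: it is given by `φ₀ = ∐ f̃_i` and
`φ₁(germ_x l) = germ_{φ₀ x} ν(l)` for `l ∈ P`. -/
def Induces (f : OrbRep 𝒱 𝒱') (φ : MarkedLieGroupoid.Hom 𝒱.Γ 𝒱'.Γ) : Prop :=
  φ.obj = f.ψ ∧ ∀ (l : f.P) (x : 𝒱.Base) (hx : x ∈ l.1.source),
    φ.arr (FullPseudogroup.germ l.1 (f.generates.1 l.2) x hx) =
      FullPseudogroup.germ (f.ν l) (f.ν_mem l) (f.ψ x) (f.ν_lift l x hx).1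

end OrbRep

section ChartedMap

variable {S : OrbStr Q} {S' : OrbStr Q'} {S'' : OrbStr Q''}

/-- Orbifold maps with domain atlas `𝒱` and range atlas `𝒱'` ("charted orbifold maps"). -/
def ChartedMap (𝒱 : AtlasRep S) (𝒱' : AtlasRep S') : Type u := Quotient (OrbRep.setoid 𝒱 𝒱')

namespace ChartedMap

variable {𝒱 𝒲 : AtlasRep S} {𝒱' 𝒲' : AtlasRep S'} {𝒱'' : AtlasRep S''}

/-- The class of a representative of an orbifold map. -/
def mk (f : OrbRep 𝒱 𝒱') : ChartedMap 𝒱 𝒱' := Quotient.mk (OrbRep.setoid 𝒱 𝒱') f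

/-- `h = g ∘ f` for charted orbifold maps. -/
def IsComp (f : ChartedMap 𝒱 𝒱') (g : ChartedMap 𝒱' 𝒱'') (h : ChartedMap 𝒱 𝒱'') : Prop :=
  ∃ a b c, mk a = f ∧ mk b = g ∧ mk c = h ∧ OrbRep.IsComp a b c

/-- `φ = F₁(f)`. -/
def Induces (f : ChartedMap 𝒱 𝒱') (φ : MarkedLieGroupoid.Hom 𝒱.Γ 𝒱'.Γ) : Prop :=
  ∃ a, mk a = f ∧ OrbRep.Induces a φ

/-- The continuous map `Q → Q'` underlying a charted orbifold map. -/
def toFun (f : ChartedMap 𝒱 𝒱') : Q → Q' :=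
  Quotient.lift (s := OrbRep.setoid 𝒱 𝒱') (fun a => a.f) (fun _ _ h => h.1) f

/-- Lifts of the identity. -/
def IsLiftOfId (f : ChartedMap 𝒱 𝒲) : Prop :=
  ∃ a, mk a = f ∧ a.f = id ∧ ∀ i, IsLocalDiffeomorph (𝓡 S.n) (𝓡 S.n) ∞ (a.lift i)

/-- The square `f ∘ ε = ε' ∘ h` commutes. -/
def Square (ε : ChartedMap 𝒲 𝒱) (f : ChartedMap 𝒱 𝒱') (h : ChartedMap 𝒲 𝒲')
    (ε' : ChartedMap 𝒲' 𝒱') : Prop :=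
  ∃ k, IsComp ε f k ∧ IsComp h ε' k

end ChartedMap

end ChartedMap

/-- Equivalence of charted orbifold maps `f₁ ∈ Orb(𝒱₁, 𝒱₁')` and `f₂ ∈ Orb(𝒱₂, 𝒱₂')`: up to lifts of
the identities, both are induced from one charted orbifold map `h ∈ Orb(𝒲, 𝒲')`. -/
def OrbEquiv {S : OrbStr Q} {S' : OrbStr Q'} {𝒱₁ 𝒱₂ : AtlasRep S} {𝒱₁' 𝒱₂' : AtlasRep S'}
    (f₁ : ChartedMap 𝒱₁ 𝒱₁') (f₂ : ChartedMap 𝒱₂ 𝒱₂') : Prop :=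
  ∃ (𝒲 : AtlasRep S) (𝒲' : AtlasRep S') (h : ChartedMap 𝒲 𝒲') (ε₁ : ChartedMap 𝒲 𝒱₁)
    (ε₂ : ChartedMap 𝒲 𝒱₂) (ε₁' : ChartedMap 𝒲' 𝒱₁') (ε₂' : ChartedMap 𝒲' 𝒱₂'),
    ε₁.IsLiftOfId ∧ ε₂.IsLiftOfId ∧ ε₁'.IsLiftOfId ∧ ε₂'.IsLiftOfId ∧
      ChartedMap.Square ε₁ f₁ h ε₁' ∧ ChartedMap.Square ε₂ f₂ h ε₂'

end Orbifold

/-! ### The category of reduced orbifolds -/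

/-- Reduced orbifolds. -/
structure Orbifold : Type (u + 1) where
  Q : Type u
  [topQ : TopologicalSpace Q]
  [t2Q : T2Space Q]
  [secondCountableQ : SecondCountableTopology Q]
  str : OrbStr Q

attribute [instance] Orbifold.topQ Orbifold.t2Q Orbifold.secondCountableQ

/-- Charted orbifold maps, bundled with their domain and range atlases. -/
abbrev AnyChartedMap (O O' : Orbifold.{u}) : Type (u + 1) :=
  Σ (𝒱 : AtlasRep O.str) (𝒱' : AtlasRep O'.str), ChartedMap 𝒱 𝒱'

/-- Orbifold maps: equivalence classes of charted orbifold maps. -/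
def OrbMap (O O' : Orbifold.{u}) : Type (u + 1) :=
  Quot fun a b : AnyChartedMap O O' => OrbEquiv a.2.2 b.2.2

/-- The orbifold map represented by a charted orbifold map. -/
def OrbMap.mk {O O' : Orbifold.{u}} {𝒱 : AtlasRep O.str} {𝒱' : AtlasRep O'.str} (f : ChartedMap 𝒱 𝒱') :
    OrbMap O O' := Quot.mk _ ⟨𝒱, 𝒱', f⟩

/-- The orbifold map `c` arises as the composition `[g] ∘ [f]`. -/
def OrbMap.IsComp {O O' O'' : Orbifold.{u}} {𝒱 : AtlasRep O.str} {𝒱' 𝒲' : AtlasRep O'.str}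
    {𝒲'' : AtlasRep O''.str} (f : ChartedMap 𝒱 𝒱') (g : ChartedMap 𝒲' 𝒲'') (c : OrbMap O O'') : Prop :=
  ∃ (𝒦 : AtlasRep O.str) (𝒦' : AtlasRep O'.str) (𝒦'' : AtlasRep O''.str) (ε : ChartedMap 𝒦 𝒱)
    (ε₁' : ChartedMap 𝒦' 𝒱') (ε₂' : ChartedMap 𝒦' 𝒲') (ε'' : ChartedMap 𝒦'' 𝒲'')
    (h : ChartedMap 𝒦 𝒦') (k : ChartedMap 𝒦' 𝒦'') (l : ChartedMap 𝒦 𝒦''),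
    ε.IsLiftOfId ∧ ε₁'.IsLiftOfId ∧ ε₂'.IsLiftOfId ∧ ε''.IsLiftOfId ∧
      ChartedMap.Square ε f h ε₁' ∧ ChartedMap.Square ε₂' g k ε'' ∧
      ChartedMap.IsComp h k l ∧ c = OrbMap.mk l

/-! ### The category of marked atlas groupoids -/

/-- Marked atlas groupoids `(Γ(𝒱), α_𝒱, X)` over `X`. -/
def IsMarkedAtlasGroupoid {X : Type u} [TopologicalSpace X] (G : MarkedLieGroupoid.{u} X) : Prop :=
  T2Space X ∧ SecondCountableTopology X ∧ ∃ (S : OrbStr X) (𝒱 : AtlasRep S), G = 𝒱.Γ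

section Morita

variable {X : Type u} [TopologicalSpace X] {Y : Type u} [TopologicalSpace Y]

/-- Unit Morita equivalence of homomorphisms of marked Lie groupoids. -/
def UnitMoritaEquiv {G₁ G₂ : MarkedLieGroupoid.{u} X} {H₁ H₂ : MarkedLieGroupoid.{u} Y}
    (ψ₁ : MarkedLieGroupoid.Hom G₁ H₁) (ψ₂ : MarkedLieGroupoid.Hom G₂ H₂) : Prop :=
  ∃ (G : MarkedLieGroupoid.{u} X) (H : MarkedLieGroupoid.{u} Y) (χ : MarkedLieGroupoid.Hom G H)
    (ε₁ : MarkedLieGroupoid.Hom G G₁) (ε₂ : MarkedLieGroupoid.Hom G G₂)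
    (δ₁ : MarkedLieGroupoid.Hom H H₁) (δ₂ : MarkedLieGroupoid.Hom H H₂),
    IsMarkedAtlasGroupoid G ∧ IsMarkedAtlasGroupoid H ∧
      MarkedLieGroupoid.IsUnitWeakEquivalence ε₁ ∧ MarkedLieGroupoid.IsUnitWeakEquivalence ε₂ ∧
      MarkedLieGroupoid.IsUnitWeakEquivalence δ₁ ∧ MarkedLieGroupoid.IsUnitWeakEquivalence δ₂ ∧
      ψ₁.comp ε₁ = δ₁.comp χ ∧ ψ₂.comp ε₂ = δ₂.comp χ

end Morita

/-- A class of Lie groupoids marked by a space `X`. -/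
structure MarkedClass : Type (u + 1) where
  X : Type u
  [topX : TopologicalSpace X]
  carrier : Set (MarkedLieGroupoid.{u} X)

attribute [instance] MarkedClass.topX

/-- The class `Γ(Q, 𝒰)` of all `(Γ(𝒱), α_𝒱, Q)`, where `𝒱` is a representative of `𝒰`. -/
def Orbifold.Γ (O : Orbifold.{u}) : MarkedClass.{u} where
  X := O.Q
  carrier := {G | ∃ 𝒱 : AtlasRep O.str, G = 𝒱.Γ}

/-- The objects of the category of marked atlas groupoids: all classes `Γ(Q, 𝒰)`. -/
def Agr : Type (u + 1) := {A : MarkedClass.{u} // ∃ O : Orbifold.{u}, A = O.Γ}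

/-- The class `Γ(Q, 𝒰)` as an object of the category of marked atlas groupoids. -/
def Agr.of (O : Orbifold.{u}) : Agr.{u} := ⟨O.Γ, O, rfl⟩

/-- Homomorphisms between members of `A` and members of `B`. -/
abbrev AnyHom (A B : Agr.{u}) : Type (u + 1) :=
  Σ (G : A.1.carrier) (H : B.1.carrier), MarkedLieGroupoid.Hom G.1 H.1

/-- The morphisms of the category of marked atlas groupoids: unit Morita equivalence classes. -/
def AgrMap (A B : Agr.{u}) : Type (u + 1) :=
  Quot fun a b : AnyHom A B => UnitMoritaEquiv a.2.2 b.2.2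

/-- The unit Morita equivalence class `[φ]`. -/
def AgrMap.mk {A B : Agr.{u}} {G : A.1.carrier} {H : B.1.carrier}
    (φ : MarkedLieGroupoid.Hom G.1 H.1) : AgrMap A B := Quot.mk _ ⟨G, H, φ⟩

/-- The morphism `c` arises as the composition `[ψ] ∘ [φ]`. -/
def AgrMap.IsComp {A B C : Agr.{u}} {G : A.1.carrier} {G' H' : B.1.carrier} {H'' : C.1.carrier}
    (φ : MarkedLieGroupoid.Hom G.1 G'.1) (ψ : MarkedLieGroupoid.Hom H'.1 H''.1)
    (c : AgrMap A C) : Prop :=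
  ∃ (K : A.1.carrier) (K' : B.1.carrier) (K'' : C.1.carrier) (ε : MarkedLieGroupoid.Hom K.1 G.1)
    (ε₁' : MarkedLieGroupoid.Hom K'.1 G'.1) (ε₂' : MarkedLieGroupoid.Hom K'.1 H'.1)
    (ε'' : MarkedLieGroupoid.Hom K''.1 H''.1) (χ : MarkedLieGroupoid.Hom K.1 K'.1)
    (κ : MarkedLieGroupoid.Hom K'.1 K''.1),
    MarkedLieGroupoid.IsUnitWeakEquivalence ε ∧ MarkedLieGroupoid.IsUnitWeakEquivalence ε₁' ∧
      MarkedLieGroupoid.IsUnitWeakEquivalence ε₂' ∧ MarkedLieGroupoid.IsUnitWeakEquivalence ε'' ∧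
      φ.comp ε = ε₁'.comp χ ∧ ψ.comp ε₂' = ε''.comp κ ∧ c = AgrMap.mk (κ.comp χ)

/-- The member `(Γ(𝒱), α_𝒱, Q)` of the class `Γ(Q, 𝒰)`. -/
def AtlasRep.mem_Γ {O : Orbifold.{u}} (𝒱 : AtlasRep O.str) : (Agr.of O).1.carrier := ⟨𝒱.Γ, 𝒱, rfl⟩

/-! ### The functors -/

/-- A category structure with given objects and given sets of morphisms;
`comp f g` is `g ∘ f`. -/
structure CategoryOn {Ob : Type (u + 1)} (Mor : Ob → Ob → Type (u + 1)) where
  id : ∀ A, Mor A A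
  comp : ∀ {A B C}, Mor A B → Mor B C → Mor A C
  id_comp : ∀ {A B} (f : Mor A B), comp (id A) f = f
  comp_id : ∀ {A B} (f : Mor A B), comp f (id B) = f
  assoc : ∀ {A B C D} (f : Mor A B) (g : Mor B C) (h : Mor C D),
    comp (comp f g) h = comp f (comp g h)

/-- The category given by a category structure. -/
@[reducible]
def CategoryOn.toCategory {Ob : Type (u + 1)} {Mor : Ob → Ob → Type (u + 1)} (C : CategoryOn Mor) :
    CategoryTheory.Category.{u + 1} Ob where
  Hom := Mor
  id := C.id
  comp := C.comp
  id_comp := C.id_comp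
  comp_id := C.comp_id
  assoc := C.assoc

/-- The category structure of reduced orbifolds: identities are given by the lifts of the identity,
and compositions by composing charted orbifold maps on common refinements. -/
def IsOrbCategory (C : CategoryOn OrbMap.{u}) : Prop :=
  (∀ (O : Orbifold.{u}) (𝒱 𝒲 : AtlasRep O.str) (f : ChartedMap 𝒱 𝒲),
    OrbMap.mk f = C.id O ↔ f.IsLiftOfId) ∧
  ∀ (O O' O'' : Orbifold.{u}) (𝒱 : AtlasRep O.str) (𝒱' 𝒲' : AtlasRep O'.str) (𝒲'' : AtlasRep O''.str)
    (f : ChartedMap 𝒱 𝒱') (g : ChartedMap 𝒲' 𝒲'') (c : OrbMap O O''),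
    C.comp (OrbMap.mk f) (OrbMap.mk g) = c ↔ OrbMap.IsComp f g c

/-- The category structure of marked atlas groupoids. -/
def IsAgrCategory (D : CategoryOn AgrMap.{u}) : Prop :=
  (∀ (A : Agr.{u}) (G H : A.1.carrier) (φ : MarkedLieGroupoid.Hom G.1 H.1),
    AgrMap.mk φ = D.id A ↔ MarkedLieGroupoid.IsUnitWeakEquivalence φ) ∧
  ∀ (A B C : Agr.{u}) (G : A.1.carrier) (G' H' : B.1.carrier) (H'' : C.1.carrier)
    (φ : MarkedLieGroupoid.Hom G.1 G'.1) (ψ : MarkedLieGroupoid.Hom H'.1 H''.1) (c : AgrMap A C),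
    D.comp (AgrMap.mk φ) (AgrMap.mk ψ) = c ↔ AgrMap.IsComp φ ψ c

/-- `c` is compatible with the marked Lie groupoid `G`: points of `V` and of `G₀` over the same
point of `X` are related by a diffeomorphism `h` between neighborhoods with `α ∘ pr ∘ h = φ`. -/
def IsChartOf {X : Type u} [TopologicalSpace X] (G : MarkedLieGroupoid.{u} X)
    (c : OrbChart X G.dimObj) : Prop :=
  ∀ (x : c.V) (y : G.Obj), c.φ x = G.mark (G.pr y) →
    ∃ h : PartialDiffeomorph (𝓡 G.dimObj) (𝓡 G.dimObj) c.V G.Obj ∞, x ∈ h.source ∧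
      h x = y ∧ ∀ z ∈ h.source, G.mark (G.pr (h z)) = c.φ z

end

end ReducedOrbifold

open ReducedOrbifold CategoryTheory

/-! Everything is reduced to one kind of object, `GermHom`: a smooth map of bases with a continuous
map of germs that respects source, target and multiplication. Units, inverses and smoothness on
arrows then come for free, because the source map is a local diffeomorphism; so a `GermHom` is the
same as a homomorphism of atlas groupoids. It is also the same as a charted orbifold map. By the
germ axioms, ν acts on germs, and the action is continuous (`OrbRep.toGermHom`). Conversely,
continuity of a map of germs forces it to be given near each germ by a single transition, and after
shrinking to small charts these transitions form P and ν (`GermHom.exists_orbRep`). This gives (1)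
and (2).

Under both identifications, lifts of the identity and unit weak equivalences become `IsLift`: object
maps that are local diffeomorphisms over Q. Such a map transports germs uniquely in both directions,
hence is a weak equivalence. Conversely, source and target agree near units, so the submersion
condition makes the differential of the object map surjective; fibers of π are locally finite, so
the dimensions agree and the inverse function theorem applies. The same argument shows that a unit
weak equivalence over a nonempty space forces the two orbifold structures to coincide. Therefore
both equivalence relations become the single relation `HEquiv` (`unitMoritaEquiv_iff`,
`orbEquiv_iff`).

The calculus of `HEquiv` rests on two facts. Any two lifts with the same domain and range are
naturally isomorphic (`GermHom.exists_iso`). And homomorphisms that become naturally isomorphic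
after composition with lifts are induced from one homomorphism, after refining the domain
(`GermHom.Iso.exists_refinement`); this uses the representative of `AtlasRep.exists_common`, which
has one chart for each suitable local diffeomorphism over Q. Transitivity and compatibility with
composition follow, which gives the category of groupoid classes; the category of orbifolds is
transported from it.

Finally F is bijective on objects, because the charts are recovered from any member of a class, and
bijective on morphisms, because both sides are quotients of the same homomorphisms by the same
relation. Such a functor has a strict inverse. -/

namespace ReducedOrbifold

noncomputable section

open FullPseudogroup

/-! ### Local diffeomorphisms at a point: inverses and cancellation. -/

section LocalDiffeomorphisms

variable {n : ℕ} {M N K : Type*}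
  [TopologicalSpace M] [ChartedSpace (EuclideanSpace ℝ (Fin n)) M]
  [TopologicalSpace N] [ChartedSpace (EuclideanSpace ℝ (Fin n)) N]
  [TopologicalSpace K] [ChartedSpace (EuclideanSpace ℝ (Fin n)) K]

/-- The restriction of a partial diffeomorphism to an open subset. -/
def partialRestr (Φ : PartialDiffeomorph (𝓡 n) (𝓡 n) M N ∞) (O : Set M) (hO : IsOpen O) :
    PartialDiffeomorph (𝓡 n) (𝓡 n) M N ∞ where
  toPartialEquiv := (Φ.toOpenPartialHomeomorph.restrOpen O hO).toPartialEquiv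
  open_source := (Φ.toOpenPartialHomeomorph.restrOpen O hO).open_source
  open_target := (Φ.toOpenPartialHomeomorph.restrOpen O hO).open_target
  contMDiffOn_toFun := Φ.contMDiffOn_toFun.mono inter_subset_left
  contMDiffOn_invFun := Φ.contMDiffOn_invFun.mono inter_subset_left

/-- A local diffeomorphism at a point is given by a partial diffeomorphism with small domain. -/
theorem exists_partial {f : M → N} {x : M} (hf : IsLocalDiffeomorphAt (𝓡 n) (𝓡 n) ∞ f x)
    {O : Set M} (hO : O ∈ 𝓝 x) :
    ∃ Φ : PartialDiffeomorph (𝓡 n) (𝓡 n) M N ∞, x ∈ Φ.source ∧ Φ.source ⊆ O ∧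
      ∀ y ∈ Φ.source, Φ y = f y := by
  obtain ⟨Φ, hx, h⟩ := hf
  refine ⟨partialRestr Φ (interior O) isOpen_interior, ⟨hx, mem_interior_iff_mem_nhds.2 hO⟩,
    fun y hy => interior_subset hy.2, fun y hy => (h hy.1).symm⟩

theorem localDiffeomorphAt_congr {f g : M → N} {x : M}
    (hf : IsLocalDiffeomorphAt (𝓡 n) (𝓡 n) ∞ f x) (h : f =ᶠ[𝓝 x] g) :
    IsLocalDiffeomorphAt (𝓡 n) (𝓡 n) ∞ g x := by
  obtain ⟨Φ, hx, hs, hΦ⟩ := exists_partial hf h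
  exact ⟨Φ, hx, fun y hy => ((hΦ y hy).trans (hs hy)).symm⟩

/-- The existence of local inverses. -/
theorem exists_localInverse {f : M → N} {x : M} (hf : IsLocalDiffeomorphAt (𝓡 n) (𝓡 n) ∞ f x) :
    ∃ g : N → M, IsLocalDiffeomorphAt (𝓡 n) (𝓡 n) ∞ g (f x) ∧ g (f x) = x ∧
      (∀ᶠ y in 𝓝 x, g (f y) = y) ∧ ∀ᶠ y in 𝓝 (f x), f (g y) = y :=
  ⟨hf.localInverse, hf.localInverse_isLocalDiffeomorphAt,
    hf.localInverse_left_inv hf.localInverse_mem_target, hf.localInverse_eventuallyEq_left,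
    hf.localInverse_eventuallyEq_right⟩

/-- With i a local inverse of g, f agrees near x with i ∘ (g ∘ f); continuity of f at x keeps its
values where i inverts g. -/
theorem localDiffeomorphAt_of_comp_left {f : M → N} {g : N → K} {x : M} (hc : ContinuousAt f x)
    (hg : IsLocalDiffeomorphAt (𝓡 n) (𝓡 n) ∞ g (f x))
    (h : IsLocalDiffeomorphAt (𝓡 n) (𝓡 n) ∞ (g ∘ f) x) :
    IsLocalDiffeomorphAt (𝓡 n) (𝓡 n) ∞ f x := by
  obtain ⟨i, hi, -, hl, -⟩ := exists_localInverse hg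
  exact localDiffeomorphAt_congr (h.comp (𝓡 n) N hi)
    (hc.eventually (p := fun y => i (g y) = y) hl)

theorem localDiffeomorphAt_of_comp_right {f : M → N} {g : N → K} {x : M}
    (hf : IsLocalDiffeomorphAt (𝓡 n) (𝓡 n) ∞ f x)
    (h : IsLocalDiffeomorphAt (𝓡 n) (𝓡 n) ∞ (g ∘ f) x) :
    IsLocalDiffeomorphAt (𝓡 n) (𝓡 n) ∞ g (f x) := by
  obtain ⟨i, hi, hx, -, hr⟩ := exists_localInverse hf
  rw [← hx] at h
  exact localDiffeomorphAt_congr (hi.comp (𝓡 n) K h) (hr.mono fun y hy => congrArg g hy)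

/-- This is what allows an identity of germs at f x to be checked only at the points f y with y near
x. -/
theorem localDiffeomorphAt_map_nhds {f : M → N} {x : M}
    (hf : IsLocalDiffeomorphAt (𝓡 n) (𝓡 n) ∞ f x) : map f (𝓝 x) = 𝓝 (f x) := by
  obtain ⟨Φ, hx, -, h⟩ := exists_partial hf univ_mem
  rw [← h x hx]
  have := Φ.toOpenPartialHomeomorph.map_nhds_eq hx
  refine (Filter.map_congr ?_).trans this
  filter_upwards [Φ.open_source.mem_nhds hx] with y hy
  exact (h y hy).symm

theorem localDiffeomorphAt_injective {f : M → N} {x : M}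
    (hf : IsLocalDiffeomorphAt (𝓡 n) (𝓡 n) ∞ f x) : ∃ O ∈ 𝓝 x, InjOn f O := by
  obtain ⟨i, -, -, hl, -⟩ := exists_localInverse hf
  exact ⟨_, hl, fun a ha b hb h => by
    rw [← show i (f a) = a from ha, ← show i (f b) = b from hb, h]⟩

theorem localDiffeomorphAt_id (x : M) :
    IsLocalDiffeomorphAt (𝓡 n) (𝓡 n) ∞ (id : M → M) x :=
  ⟨(Diffeomorph.refl (𝓡 n) M ∞).toPartialDiffeomorph, trivial, fun _ _ => rfl⟩

end LocalDiffeomorphisms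

/-! ### Germs represented by functions, and the germ topology in these terms. -/

namespace FullPseudogroup

variable {n : ℕ} {M : Type u} [TopologicalSpace M] [ChartedSpace (EuclideanSpace ℝ (Fin n)) M]
  {P : FullPseudogroup n M}

theorem exists_germ (γ : P.Germ) : ∃ (f : Transition n M) (hf : f ∈ P.carrier)
    (hx : src γ ∈ f.source), γ = germ f hf (src γ) hx := by
  induction γ using Germ.ind with
  | h f hf x hx => exact ⟨f, hf, hx, rfl⟩

/-- A function representing a germ near its source. -/
def app (γ : P.Germ) : M → M := (exists_germ γ).choose

/-- The function `app γ` is an arbitrary choice, tied to γ only near its source. Hence all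
identities for it are eventual ones. -/
theorem app_germ (f : Transition n M) (hf : f ∈ P.carrier) (x : M) (hx : x ∈ f.source) :
    app (germ f hf x hx : P.Germ) =ᶠ[𝓝 x] f :=
  ((germ_eq_iff.1 (exists_germ (germ f hf x hx : P.Germ)).choose_spec.choose_spec.choose_spec).2).mono
    fun _ => Eq.symm

@[simp] theorem app_src (γ : P.Germ) : app γ (src γ) = tgt γ := by
  induction γ using Germ.ind with
  | h f hf x hx => exact (app_germ f hf x hx).self_of_nhds

theorem app_localDiffeomorphAt (γ : P.Germ) :
    IsLocalDiffeomorphAt (𝓡 n) (𝓡 n) ∞ (app γ) (src γ) := by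
  induction γ using Germ.ind with
  | h f hf x hx =>
    exact localDiffeomorphAt_congr (f.isLocalDiffeomorphAt _ _ _ (x := x) hx)
      (app_germ f hf x hx).symm

theorem map_app_nhds (γ : P.Germ) : map (app γ) (𝓝 (src γ)) = 𝓝 (tgt γ) := by
  rw [← app_src]; exact localDiffeomorphAt_map_nhds (app_localDiffeomorphAt γ)

theorem tendsto_app (γ : P.Germ) : Tendsto (app γ) (𝓝 (src γ)) (𝓝 (tgt γ)) :=
  (map_app_nhds γ).le

theorem germ_ext {γ δ : P.Germ} (h : src γ = src δ) (e : app γ =ᶠ[𝓝 (src γ)] app δ) :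
    γ = δ := by
  induction γ using Germ.ind with
  | h f hf x hx =>
    induction δ using Germ.ind with
    | h g hg y hy =>
      have h : x = y := h
      subst h
      exact germ_eq_iff.2 ⟨rfl, (app_germ f hf x hx).symm.trans (e.trans (app_germ g hg x hy))⟩

/-- Germs can be compared after composing with a map which is open at a point. -/
theorem germ_ext_comp {N : Type*} [TopologicalSpace N] {γ δ : P.Germ} {ψ : N → M} {x : N}
    (hψ : map ψ (𝓝 x) = 𝓝 (ψ x)) (h : src γ = ψ x) (h' : src δ = ψ x)
    (e : ∀ᶠ y in 𝓝 x, app γ (ψ y) = app δ (ψ y)) : γ = δ := by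
  refine germ_ext (h.trans h'.symm) ?_
  rw [h, ← hψ]
  exact e

theorem tgt_germMul (p : {p : P.Germ × P.Germ // src p.1 = tgt p.2}) :
    tgt (germMul p) = tgt p.1.1 := by
  obtain ⟨⟨γ, δ⟩, h⟩ := p
  induction γ using Germ.ind
  induction δ using Germ.ind
  simp only [src_germ, tgt_germ] at h
  subst h
  rfl

theorem app_germMul (γ δ : P.Germ) (h : src γ = tgt δ) :
    app (germMul ⟨(γ, δ), h⟩) =ᶠ[𝓝 (src δ)] app γ ∘ app δ := by
  have ht := tendsto_app δ
  induction γ using Germ.ind with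
  | h g hg y hy =>
    induction δ using Germ.ind with
    | h f hf x hx =>
      have h : y = f x := h
      subst h
      refine (app_germ (f.trans g) (P.trans_mem _ hf _ hg) x (mem_trans_source hx hy)).trans ?_
      filter_upwards [app_germ f hf x hx, ht.eventually (app_germ g hg _ hy)] with z h1 h2
      change g (f z) = _
      rw [Function.comp, h2, h1]

theorem app_germOne (x : M) : app (germOne x : P.Germ) =ᶠ[𝓝 x] id := app_germ _ _ _ _

theorem tgt_germOne (x : M) : tgt (germOne x : P.Germ) = x := rfl

theorem src_germInv (γ : P.Germ) : src (germInv γ) = tgt γ := by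
  induction γ using Germ.ind
  rfl

/-- The local section of the source map through a germ. -/
theorem exists_section (γ : P.Germ) : ∃ s : M → P.Germ, s (src γ) = γ ∧
    ∀ᶠ y in 𝓝 (src γ), ContinuousAt s y ∧ src (s y) = y ∧ app (s y) =ᶠ[𝓝 y] app γ := by
  induction γ using Germ.ind with
  | h f hf x hx =>
    refine ⟨(srcHomeo ⟨f, hf⟩).symm, dif_pos hx, ?_⟩
    filter_upwards [f.open_source.mem_nhds hx, (app_germ f hf x hx).eventuallyEq_nhds] with y hy h
    have e : (srcHomeo ⟨f, hf⟩).symm y = germ f hf y hy := dif_pos hy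
    refine ⟨(srcHomeo ⟨f, hf⟩).continuousAt_symm hy, by rw [e]; rfl, ?_⟩
    rw [e]
    exact (app_germ f hf y hy).trans h.symm

/-- Images of sections are open, so a germ is near c p exactly if its source is near that of c p and
it is a germ of the same transition. Continuity of a family of germs thereby becomes a statement
about functions. -/
theorem continuousAt_germ_iff {N : Type*} [TopologicalSpace N] {c : N → P.Germ} {p : N} :
    ContinuousAt c p ↔ ContinuousAt (fun q => src (c q)) p ∧
      ∀ᶠ q in 𝓝 p, app (c q) =ᶠ[𝓝 (src (c q))] app (c p) := by
  obtain ⟨f, hf, hx, e⟩ := exists_germ (c p)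
  constructor
  · intro hc
    refine ⟨continuous_src.continuousAt.comp hc, ?_⟩
    have h1 := hc.preimage_mem_nhds ((isOpen_range_sec ⟨f, hf⟩).mem_nhds (x := c p)
      (e ▸ ⟨⟨_, hx⟩, rfl⟩))
    have h2 := (app_germ f hf _ hx).eventuallyEq_nhds
    filter_upwards [h1, (continuous_src.continuousAt.comp hc).eventually h2] with q ⟨y, hy⟩ hq
    have ey : src (c q) = y.1 := by rw [← hy]; rfl
    rw [← e] at hq
    refine EventuallyEq.trans ?_ hq.symm
    rw [ey, ← hy]
    exact app_germ f hf _ y.2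
  · rintro ⟨h1, h2⟩
    have hs : ContinuousAt ((srcHomeo ⟨f, hf⟩).symm ∘ fun q => src (c q)) p :=
      ContinuousAt.comp ((srcHomeo ⟨f, hf⟩).continuousAt_symm hx) h1
    refine hs.congr ?_
    have h3 := (app_germ f hf _ hx).eventuallyEq_nhds
    filter_upwards [h2, h1.eventually (f.open_source.mem_nhds hx), h1.eventually h3]
      with q hq hq1 hq2
    rw [← e] at hq2
    have e' : (srcHomeo ⟨f, hf⟩).symm (src (c q)) = germ f hf _ hq1 := dif_pos hq1
    refine e'.trans ?_
    exact germ_ext rfl ((app_germ f hf _ hq1).trans (hq2.symm.trans hq.symm))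

/-- Continuous families of germs with the same sources which agree at a point agree locally. -/
theorem eventuallyEq_germ {N : Type*} [TopologicalSpace N] {c d : N → P.Germ} {p : N}
    (hc : ContinuousAt c p) (hd : ContinuousAt d p) (h : ∀ᶠ q in 𝓝 p, src (c q) = src (d q))
    (e : c p = d p) : c =ᶠ[𝓝 p] d := by
  filter_upwards [h, (continuousAt_germ_iff.1 hc).2, (continuousAt_germ_iff.1 hd).2]
    with q hq h1 h2
  refine germ_ext hq (h1.trans ?_)
  rw [e, hq]
  exact h2.symm

end FullPseudogroup

/-! ### Homomorphisms as continuous maps of germs; lifts of the identity; natural isomorphisms. -/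

section GermHom

variable {Q : Type u} [TopologicalSpace Q] {Q' : Type u} [TopologicalSpace Q']
  {Q'' : Type u} [TopologicalSpace Q''] {Q''' : Type u} [TopologicalSpace Q''']
  {S : OrbStr Q} {S' : OrbStr Q'} {S'' : OrbStr Q''} {S''' : OrbStr Q'''}

namespace AtlasRep

theorem app_π {𝒱 : AtlasRep S} (γ : 𝒱.Ψ.Germ) : ∀ᶠ y in 𝓝 (src γ), 𝒱.π (app γ y) = 𝒱.π y := by
  induction γ using Germ.ind with
  | h f hf x hx =>
    filter_upwards [app_germ f hf x hx, f.open_source.mem_nhds hx] with y h hy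
    rw [h]; exact hf y hy

theorem π_tgt {𝒱 : AtlasRep S} (γ : 𝒱.Ψ.Germ) : 𝒱.π (tgt γ) = 𝒱.π (src γ) := by
  rw [← app_src]; exact (app_π γ).self_of_nhds

/-- Local diffeomorphisms over `Q` define germs in `Γ(𝒱)`. -/
theorem exists_germ_app (𝒱 : AtlasRep S) {f : 𝒱.Base → 𝒱.Base} {x : 𝒱.Base}
    (hf : IsLocalDiffeomorphAt (𝓡 S.n) (𝓡 S.n) ∞ f x) (hπ : ∀ᶠ y in 𝓝 x, 𝒱.π (f y) = 𝒱.π y) :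
    ∃ γ : 𝒱.Ψ.Germ, src γ = x ∧ app γ =ᶠ[𝓝 x] f := by
  obtain ⟨Φ, hx, hs, hΦ⟩ := exists_partial hf hπ
  have hm : Φ ∈ 𝒱.Ψ.carrier := fun y hy => by
    have := hs hy
    change 𝒱.π (Φ y) = _
    rw [hΦ y hy]; exact this
  refine ⟨germ Φ hm x hx, rfl, (app_germ Φ hm x hx).trans ?_⟩
  filter_upwards [Φ.open_source.mem_nhds hx] with y hy using hΦ y hy

end AtlasRep

/-- Homomorphisms `Γ(𝒱) → Γ(𝒱')`, described by continuous maps of germs. -/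
structure GermHom (𝒱 : AtlasRep S) (𝒱' : AtlasRep S') where
  obj : 𝒱.Base → 𝒱'.Base
  arr : 𝒱.Ψ.Germ → 𝒱'.Ψ.Germ
  smooth_obj : ContMDiff (𝓡 S.n) (𝓡 S'.n) ∞ obj
  continuous_arr : Continuous arr
  src_arr : ∀ γ, src (arr γ) = obj (src γ)
  tgt_arr : ∀ γ, tgt (arr γ) = obj (tgt γ)
  arr_mul : ∀ (γ δ : 𝒱.Ψ.Germ) (h : src γ = tgt δ), arr (germMul ⟨(γ, δ), h⟩) =
    germMul ⟨(arr γ, arr δ), (src_arr γ).trans ((congrArg obj h).trans (tgt_arr δ).symm)⟩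

namespace GermHom

variable {𝒱 : AtlasRep S} {𝒱' : AtlasRep S'} {𝒱'' : AtlasRep S''} {𝒱''' : AtlasRep S'''}

theorem ext {φ φ' : GermHom 𝒱 𝒱'} (h : ∀ x, φ.obj x = φ'.obj x) (k : ∀ γ, φ.arr γ = φ'.arr γ) :
    φ = φ' := by
  obtain ⟨a, b, _, _, _, _, _⟩ := φ
  obtain ⟨a', b', _, _, _, _, _⟩ := φ'
  obtain rfl : a = a' := funext h
  obtain rfl : b = b' := funext k
  rfl

/-- The composition `ψ ∘ φ`. -/
def comp (ψ : GermHom 𝒱' 𝒱'') (φ : GermHom 𝒱 𝒱') : GermHom 𝒱 𝒱'' where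
  obj x := ψ.obj (φ.obj x)
  arr γ := ψ.arr (φ.arr γ)
  smooth_obj := ψ.smooth_obj.comp φ.smooth_obj
  continuous_arr := ψ.continuous_arr.comp φ.continuous_arr
  src_arr γ := (ψ.src_arr _).trans (congrArg ψ.obj (φ.src_arr γ))
  tgt_arr γ := (ψ.tgt_arr _).trans (congrArg ψ.obj (φ.tgt_arr γ))
  arr_mul γ δ h := (congrArg ψ.arr (φ.arr_mul γ δ h)).trans (ψ.arr_mul _ _ _)

variable (𝒱) in
/-- The identity homomorphism. -/
def id : GermHom 𝒱 𝒱 where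
  obj x := x
  arr γ := γ
  smooth_obj := contMDiff_id
  continuous_arr := continuous_id
  src_arr _ := rfl
  tgt_arr _ := rfl
  arr_mul _ _ _ := rfl

theorem comp_assoc (χ : GermHom 𝒱'' 𝒱''') (ψ : GermHom 𝒱' 𝒱'') (φ : GermHom 𝒱 𝒱') :
    (χ.comp ψ).comp φ = χ.comp (ψ.comp φ) := rfl

theorem comp_id (φ : GermHom 𝒱 𝒱') : φ.comp (id 𝒱) = φ := rfl

theorem id_comp (φ : GermHom 𝒱 𝒱') : (id 𝒱').comp φ = φ := rfl

theorem obj_congr {φ φ' : GermHom 𝒱 𝒱'} (h : φ = φ') (x : 𝒱.Base) : φ.obj x = φ'.obj x := by rw [h]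

theorem arr_congr {φ φ' : GermHom 𝒱 𝒱'} (h : φ = φ') (γ : 𝒱.Ψ.Germ) : φ.arr γ = φ'.arr γ := by
  rw [h]

theorem continuous_obj (φ : GermHom 𝒱 𝒱') : Continuous φ.obj := φ.smooth_obj.continuous

/-- The image of a germ intertwines the map of objects. -/
theorem app_arr (φ : GermHom 𝒱 𝒱') (γ : 𝒱.Ψ.Germ) :
    ∀ᶠ y in 𝓝 (src γ), app (φ.arr γ) (φ.obj y) = φ.obj (app γ y) := by
  -- The images of the germs s y form a continuous family, so for y near src γ all of them are germs
  -- of the single function `app (φ.arr γ)`. Evaluating at their sources gives the claim.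
  obtain ⟨s, hs, h⟩ := exists_section γ
  have hc : ContinuousAt (fun y => φ.arr (s y)) (src γ) :=
    φ.continuous_arr.continuousAt.comp h.self_of_nhds.1
  filter_upwards [h, (continuousAt_germ_iff.1 hc).2] with y hy h3
  obtain ⟨-, h1, h2⟩ := hy
  have e := h3.self_of_nhds
  rw [app_src, φ.src_arr, φ.tgt_arr, h1, hs, ← app_src, h1, h2.self_of_nhds] at e
  exact e.symm

/-- Two points over the same point of Q are joined by an arrow, and its image joins their images. -/
theorem π_obj_eq (φ : GermHom 𝒱 𝒱') {x y : 𝒱.Base} (h : 𝒱.π x = 𝒱.π y) :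
    𝒱'.π (φ.obj x) = 𝒱'.π (φ.obj y) := by
  obtain ⟨f, hf, hx, rfl⟩ := 𝒱.exists_transition h
  have := AtlasRep.π_tgt (φ.arr (germ f hf x hx))
  rw [φ.tgt_arr, φ.src_arr] at this
  exact this.symm

/-- Lifts of the identity: the map of objects is a local diffeomorphism over `Q`. -/
structure IsLift {𝒱 𝒲 : AtlasRep S} (ε : GermHom 𝒱 𝒲) : Prop where
  localDiffeomorph : IsLocalDiffeomorph (𝓡 S.n) (𝓡 S.n) ∞ ε.obj
  π_obj : ∀ x, 𝒲.π (ε.obj x) = 𝒱.π x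

section Lift

variable {𝒱 𝒲 𝒰 : AtlasRep S}

theorem isLift_id : IsLift (id 𝒱) := ⟨fun x => localDiffeomorphAt_id x, fun _ => rfl⟩

theorem IsLift.comp {δ : GermHom 𝒲 𝒰} {ε : GermHom 𝒱 𝒲} (hδ : IsLift δ) (hε : IsLift ε) :
    IsLift (δ.comp ε) :=
  ⟨fun x => (hε.localDiffeomorph x).comp (𝓡 S.n) _ (hδ.localDiffeomorph _),
    fun x => (hδ.π_obj _).trans (hε.π_obj x)⟩

theorem IsLift.map_nhds {ε : GermHom 𝒱 𝒲} (hε : IsLift ε) (x : 𝒱.Base) :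
    map ε.obj (𝓝 x) = 𝓝 (ε.obj x) := localDiffeomorphAt_map_nhds (hε.localDiffeomorph x)

/-- A germ is determined along a pair of local diffeomorphisms. -/
theorem exists_germ_over {𝒲 : AtlasRep S} {N : Type*} [TopologicalSpace N]
    [ChartedSpace (EuclideanSpace ℝ (Fin S.n)) N] {a b : N → 𝒲.Base} {x : N}
    (ha : IsLocalDiffeomorphAt (𝓡 S.n) (𝓡 S.n) ∞ a x)
    (hb : IsLocalDiffeomorphAt (𝓡 S.n) (𝓡 S.n) ∞ b x)
    (hab : ∀ᶠ y in 𝓝 x, 𝒲.π (b y) = 𝒲.π (a y)) :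
    ∃ γ : 𝒲.Ψ.Germ, src γ = a x ∧ ∀ᶠ y in 𝓝 x, app γ (a y) = b y := by
  obtain ⟨i, hi, hx, hl, hr⟩ := exists_localInverse ha
  have hb' : IsLocalDiffeomorphAt (𝓡 S.n) (𝓡 S.n) ∞ b (i (a x)) := by rw [hx]; exact hb
  have ht : Tendsto i (𝓝 (a x)) (𝓝 x) := by
    have := hi.contMDiffAt.continuousAt
    rw [ContinuousAt, hx] at this
    exact this
  -- The germ is that of b ∘ i, where i is a local inverse of a.
  obtain ⟨γ, h1, h2⟩ := 𝒲.exists_germ_app (hi.comp (𝓡 S.n) _ hb') (by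
    filter_upwards [ht.eventually hab, hr] with y h3 h4
    rw [h4] at h3
    exact h3)
  refine ⟨γ, h1, ?_⟩
  filter_upwards [ha.contMDiffAt.continuousAt.eventually h2, hl] with y h3 h4
  rw [h3, Function.comp, h4]

/-- Every local diffeomorphism over `Q` is the map of objects of a lift of the identity. -/
theorem exists_lift {ψ : 𝒱.Base → 𝒲.Base} (hψ : IsLocalDiffeomorph (𝓡 S.n) (𝓡 S.n) ∞ ψ)
    (hπ : ∀ x, 𝒲.π (ψ x) = 𝒱.π x) : ∃ ε : GermHom 𝒱 𝒲, IsLift ε ∧ ε.obj = ψ := by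
  -- The image of γ is forced: it is the germ of ψ ∘ γ ∘ ψ⁻¹, which lies over Q because all factors
  -- do.
  have key : ∀ γ : 𝒱.Ψ.Germ, ∃ δ : 𝒲.Ψ.Germ, src δ = ψ (src γ) ∧
      ∀ᶠ y in 𝓝 (src γ), app δ (ψ y) = ψ (app γ y) := fun γ => by
    refine exists_germ_over (hψ _) ((app_localDiffeomorphAt γ).comp (𝓡 S.n) _ (hψ _)) ?_
    filter_upwards [AtlasRep.app_π γ] with y h
    rw [hπ, hπ, h]
  choose arr hs ha using key
  have map_nhds := fun x => localDiffeomorphAt_map_nhds (hψ x)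
  have ht : ∀ γ, tgt (arr γ) = ψ (tgt γ) := fun γ => by
    rw [← app_src, hs, (ha γ).self_of_nhds, app_src]
  refine ⟨⟨ψ, arr, hψ.contMDiff, ?_, hs, ht, ?_⟩, ⟨hψ, hπ⟩, rfl⟩
  · rw [continuous_iff_continuousAt]
    intro γ
    refine continuousAt_germ_iff.2 ⟨?_, ?_⟩
    · simp only [hs]
      exact (hψ.contMDiff.continuous.comp continuous_src).continuousAt
    · filter_upwards [(continuousAt_germ_iff.1 (continuousAt_id (x := γ))).2,
        continuous_src.continuousAt.eventually (ha γ).eventually_nhds] with δ h1 h2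
      rw [hs, ← map_nhds]
      refine eventually_map.2 ?_
      filter_upwards [h1, h2, ha δ] with y e1 e2 e3
      rw [e2, e3]
      exact congrArg ψ e1
  · intro γ δ h
    symm
    refine germ_ext_comp (map_nhds (src δ)) ?_ (hs _ |>.trans (by rw [src_germMul])) ?_
    · rw [src_germMul, hs]
    · have m1 := app_germMul (arr γ) (arr δ) ((hs γ).trans ((congrArg ψ h).trans (ht δ).symm))
      rw [hs, ← map_nhds] at m1
      have m2 := app_germMul γ δ h
      have m3 := ha (germMul ⟨(γ, δ), h⟩)
      rw [src_germMul] at m3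
      have m4 := ha γ
      rw [h] at m4
      filter_upwards [eventually_map.1 m1, m2, m3, ha δ, (tendsto_app δ).eventually m4]
        with y e1 e2 e3 e4 e5
      rw [e1, e3, e2, Function.comp, Function.comp, e4, e5]

/-- A germ between points in the images of two lifts comes from a local diffeomorphism. -/
theorem exists_local_over {𝒱₁ 𝒱₂ : AtlasRep S} {ε₁ : GermHom 𝒱₁ 𝒲} {ε₂ : GermHom 𝒱₂ 𝒲}
    (h₁ : IsLift ε₁) (h₂ : IsLift ε₂) {x : 𝒱₁.Base} {y : 𝒱₂.Base} {δ : 𝒲.Ψ.Germ}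
    (hx : src δ = ε₁.obj x) (hy : tgt δ = ε₂.obj y) :
    ∃ f : 𝒱₁.Base → 𝒱₂.Base, IsLocalDiffeomorphAt (𝓡 S.n) (𝓡 S.n) ∞ f x ∧ f x = y ∧
      ∀ᶠ z in 𝓝 x, ε₂.obj (f z) = app δ (ε₁.obj z) ∧ 𝒱₂.π (f z) = 𝒱₁.π z := by
  -- The map sought is ε₂⁻¹ ∘ δ ∘ ε₁, with the branch i of ε₂⁻¹ that returns to y.
  obtain ⟨i, hi, hiy, hl, hr⟩ := exists_localInverse (h₂.localDiffeomorph y)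
  have hδ : IsLocalDiffeomorphAt (𝓡 S.n) (𝓡 S.n) ∞ (app δ ∘ ε₁.obj) x :=
    (h₁.localDiffeomorph x).comp (𝓡 S.n) _ (by rw [← hx]; exact app_localDiffeomorphAt δ)
  have e0 : (app δ ∘ ε₁.obj) x = ε₂.obj y := by rw [Function.comp, ← hx, app_src, hy]
  have ht : Tendsto (app δ ∘ ε₁.obj) (𝓝 x) (𝓝 (ε₂.obj y)) := by
    rw [← e0]; exact hδ.contMDiffAt.continuousAt
  have hπ := AtlasRep.app_π δ
  rw [hx, ← h₁.map_nhds] at hπ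
  refine ⟨i ∘ (app δ ∘ ε₁.obj), hδ.comp (𝓡 S.n) _ (by rw [e0]; exact hi),
    by rw [Function.comp, e0, hiy], ?_⟩
  filter_upwards [ht.eventually hr, eventually_map.1 hπ] with z e1 e2
  refine ⟨e1, ?_⟩
  rw [Function.comp, ← h₂.π_obj, e1, Function.comp, e2, h₁.π_obj]

/-- The preimage is the germ at x of ε⁻¹ ∘ δ ∘ ε, with the branch of ε⁻¹ taken at y. -/
theorem IsLift.full {ε : GermHom 𝒱 𝒲} (hε : IsLift ε) {x y : 𝒱.Base} {δ : 𝒲.Ψ.Germ}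
    (hx : src δ = ε.obj x) (hy : tgt δ = ε.obj y) :
    ∃ γ : 𝒱.Ψ.Germ, src γ = x ∧ tgt γ = y ∧ ε.arr γ = δ := by
  obtain ⟨f, hf, hfx, h⟩ := exists_local_over hε hε hx hy
  obtain ⟨γ, h1, h2⟩ := 𝒱.exists_germ_app hf (h.mono fun _ h => h.2)
  refine ⟨γ, h1, ?_, ?_⟩
  · rw [← app_src, h1, h2.self_of_nhds, hfx]
  · have ha := ε.app_arr γ
    rw [h1] at ha
    refine germ_ext_comp (hε.map_nhds x) ((ε.src_arr γ).trans (by rw [h1])) hx ?_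
    filter_upwards [ha, h2, h] with z e1 e2 e3
    rw [e1, e2, e3.1]

/-- Near the common source, both germs take values in a neighborhood of the common target on which
`ε.obj` is injective. After applying `ε.obj`, both values are given by the same image germ. -/
theorem IsLift.faithful {ε : GermHom 𝒱 𝒲} (hε : IsLift ε) {γ γ' : 𝒱.Ψ.Germ}
    (hs : src γ = src γ') (ht : tgt γ = tgt γ') (h : ε.arr γ = ε.arr γ') : γ = γ' := by
  refine germ_ext hs ?_
  obtain ⟨O, hO, hinj⟩ := localDiffeomorphAt_injective (hε.localDiffeomorph (tgt γ))
  have h1 := tendsto_app γ' |>.eventually (ht ▸ hO)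
  have h2 := ε.app_arr γ'
  rw [← hs] at h1 h2
  filter_upwards [tendsto_app γ |>.eventually hO, h1, ε.app_arr γ, h2] with y e1 e2 e3 e4
  exact hinj e1 e2 (by rw [← e3, h, e4])

/-- The topological form of the fibered product property. Compare c with the section through c p
along the sources: the images under ε are continuous families with equal sources, so they agree near
p; the targets agree by local injectivity of `ε.obj`; faithfulness then identifies the two families.
-/
theorem IsLift.continuous_of_comp {ε : GermHom 𝒱 𝒲} (hε : IsLift ε) {N : Type*}
    [TopologicalSpace N] {c : N → 𝒱.Ψ.Germ} (hs : Continuous fun q => src (c q))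
    (ht : Continuous fun q => tgt (c q)) (ha : Continuous fun q => ε.arr (c q)) :
    Continuous c := by
  rw [continuous_iff_continuousAt]
  intro p
  obtain ⟨s, hsp, h⟩ := exists_section (c p)
  have h := hs.continuousAt.eventually h
  have hd : ContinuousAt (fun q => s (src (c q))) p :=
    ContinuousAt.comp (f := fun q => src (c q)) h.self_of_nhds.1 hs.continuousAt
  refine hd.congr ?_
  have e1 : (fun q => ε.arr (s (src (c q)))) =ᶠ[𝓝 p] fun q => ε.arr (c q) := by
    refine eventuallyEq_germ (ε.continuous_arr.continuousAt.comp hd) ha.continuousAt ?_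
      (by rw [hsp])
    filter_upwards [h] with q hq
    rw [ε.src_arr, ε.src_arr, hq.2.1]
  obtain ⟨O, hO, hinj⟩ := localDiffeomorphAt_injective (hε.localDiffeomorph (tgt (c p)))
  have ht' : ContinuousAt (fun q => tgt (s (src (c q)))) p :=
    continuous_tgt.continuousAt.comp hd
  have h3 : ∀ᶠ q in 𝓝 p, tgt (s (src (c q))) ∈ O := ht'.eventually_mem (by rw [hsp]; exact hO)
  filter_upwards [h, e1, h3, ht.continuousAt.eventually_mem hO] with q hq hq1 hq2 hq3
  refine hε.faithful hq.2.1 (hinj hq2 hq3 ?_) hq1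
  rw [← ε.tgt_arr, hq1, ε.tgt_arr]

end Lift

/-- Homomorphisms can be factored through lifts of the identity. -/
theorem IsLift.exists_factor {𝒲' : AtlasRep S'} {ε : GermHom 𝒲' 𝒱'} (hε : IsLift ε)
    (θ : GermHom 𝒱 𝒱') {h₀ : 𝒱.Base → 𝒲'.Base} (hc : Continuous h₀)
    (h : ∀ x, ε.obj (h₀ x) = θ.obj x) :
    ∃ χ : GermHom 𝒱 𝒲', χ.obj = h₀ ∧ ε.comp χ = θ := by
  -- Fullness gives a germ over θ(γ) between the prescribed end points. By faithfulness it is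
  -- unique, and uniqueness is what makes the choice multiplicative and continuous.
  have key : ∀ γ : 𝒱.Ψ.Germ, ∃ δ : 𝒲'.Ψ.Germ, src δ = h₀ (src γ) ∧ tgt δ = h₀ (tgt γ) ∧
      ε.arr δ = θ.arr γ := fun γ =>
    hε.full ((θ.src_arr γ).trans (h _).symm) ((θ.tgt_arr γ).trans (h _).symm)
  choose arr hs ht ha using key
  refine ⟨⟨h₀, arr, ?_, ?_, hs, ht, ?_⟩, rfl, GermHom.ext h ha⟩
  · exact contMDiff_of_comp_isLocalDiffeomorph hε.localDiffeomorph hc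
      (by rw [show ε.obj ∘ h₀ = θ.obj from funext h]; exact θ.smooth_obj)
  · refine hε.continuous_of_comp ?_ ?_ ?_
    · simp only [hs]; exact hc.comp continuous_src
    · simp only [ht]; exact hc.comp continuous_tgt
    · simpa only [ha] using θ.continuous_arr
  · intro γ δ hγ
    refine hε.faithful ?_ ?_ ?_
    · rw [hs, src_germMul, src_germMul, hs]
    · rw [ht, tgt_germMul, tgt_germMul, ht]
    · rw [ha, ε.arr_mul]
      simp only [ha, θ.arr_mul]

/-- Agreement on objects has to be assumed, since a lift need not be injective on objects.
Faithfulness takes care of the arrows. -/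
theorem IsLift.comp_left_cancel {𝒲' : AtlasRep S'} {ε : GermHom 𝒲' 𝒱'} (hε : IsLift ε)
    {χ χ' : GermHom 𝒱 𝒲'} (h : ∀ x, χ.obj x = χ'.obj x) (e : ε.comp χ = ε.comp χ') : χ = χ' := by
  refine GermHom.ext h fun γ => hε.faithful ?_ ?_ (arr_congr e γ)
  · rw [χ.src_arr, χ'.src_arr, h]
  · rw [χ.tgt_arr, χ'.tgt_arr, h]

/-- Natural isomorphisms `θ₁ ≅ θ₂`. -/
def Iso (θ₁ θ₂ : GermHom 𝒱 𝒱') (ν : 𝒱.Base → 𝒱'.Ψ.Germ) : Prop :=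
  Continuous ν ∧ ∃ (hs : ∀ x, src (ν x) = θ₁.obj x) (ht : ∀ x, tgt (ν x) = θ₂.obj x),
    ∀ γ, germMul ⟨(θ₂.arr γ, ν (src γ)), (θ₂.src_arr γ).trans (ht _).symm⟩ =
      germMul ⟨(ν (tgt γ), θ₁.arr γ), (hs _).trans (θ₁.tgt_arr γ).symm⟩

theorem Iso.post {θ₁ θ₂ : GermHom 𝒱 𝒱'} {ν} (h : Iso θ₁ θ₂ ν) (κ : GermHom 𝒱' 𝒱'') :
    Iso (κ.comp θ₁) (κ.comp θ₂) fun x => κ.arr (ν x) := by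
  obtain ⟨hc, hs, ht, hn⟩ := h
  refine ⟨κ.continuous_arr.comp hc, fun x => (κ.src_arr _).trans (congrArg κ.obj (hs x)),
    fun x => (κ.tgt_arr _).trans (congrArg κ.obj (ht x)), fun γ => ?_⟩
  exact (κ.arr_mul _ _ _).symm.trans ((congrArg κ.arr (hn γ)).trans (κ.arr_mul _ _ _))

theorem Iso.pre {θ₁ θ₂ : GermHom 𝒱' 𝒱''} {ν} (h : Iso θ₁ θ₂ ν) (χ : GermHom 𝒱 𝒱') :
    Iso (θ₁.comp χ) (θ₂.comp χ) fun x => ν (χ.obj x) := by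
  obtain ⟨hc, hs, ht, hn⟩ := h
  refine ⟨hc.comp χ.continuous_obj, fun x => hs _, fun x => ht _, fun γ => ?_⟩
  have := hn (χ.arr γ)
  simp only [χ.src_arr, χ.tgt_arr] at this
  exact this

/-- Any two lifts of the identity are isomorphic. -/
theorem exists_iso {𝒱 𝒲 : AtlasRep S} {a b : GermHom 𝒱 𝒲} (ha : IsLift a) (hb : IsLift b) :
    ∃ ν, Iso a b ν ∧ ∀ x, ∀ᶠ y in 𝓝 x, app (ν x) (a.obj y) = b.obj y := by
  -- The component at x is the germ of b ∘ a⁻¹ at a x. It is defined because both object maps lie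
  -- over the identity of Q.
  have key : ∀ x, ∃ δ : 𝒲.Ψ.Germ, src δ = a.obj x ∧ ∀ᶠ y in 𝓝 x, app δ (a.obj y) = b.obj y :=
    fun x => exists_germ_over (ha.localDiffeomorph x) (hb.localDiffeomorph x)
      (Eventually.of_forall fun y => (hb.π_obj y).trans (ha.π_obj y).symm)
  choose ν hs hν using key
  have ht : ∀ x, tgt (ν x) = b.obj x := fun x => by rw [← app_src, hs, (hν x).self_of_nhds]
  refine ⟨ν, ⟨?_, hs, ht, fun γ => ?_⟩, hν⟩
  · rw [continuous_iff_continuousAt]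
    intro x
    refine continuousAt_germ_iff.2 ⟨?_, ?_⟩
    · simpa only [hs] using a.continuous_obj.continuousAt
    · filter_upwards [(hν x).eventually_nhds] with y hy
      rw [hs, ← ha.map_nhds]
      refine eventually_map.2 ?_
      filter_upwards [hy, hν y] with z e1 e2
      rw [e1, e2]
  -- Naturality can be tested after composing with `a.obj`, which is open at each point: both sides
  -- then send y to b(γ y).
  · refine germ_ext_comp (ha.map_nhds (src γ)) (by rw [src_germMul, hs])
      (by rw [src_germMul, a.src_arr]) ?_
    have m1 := app_germMul (b.arr γ) (ν (src γ)) ((b.src_arr γ).trans (ht _).symm)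
    have m2 := app_germMul (ν (tgt γ)) (a.arr γ) ((hs _).trans (a.tgt_arr γ).symm)
    rw [hs, ← ha.map_nhds] at m1
    rw [a.src_arr, ← ha.map_nhds] at m2
    filter_upwards [eventually_map.1 m1, eventually_map.1 m2, hν (src γ), b.app_arr γ, a.app_arr γ,
      (tendsto_app γ).eventually (hν (tgt γ))] with y e1 e2 e3 e4 e5 e6
    rw [e1, e2, Function.comp, Function.comp, e3, e4, e5, e6]

end GermHom

end GermHom

/-! ### Small orbifold charts, refinements and common refinements of representatives. -/

section SmallCharts

variable {Q : Type u} [TopologicalSpace Q] {n : ℕ}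

/-- Manifolds are locally connected, so the connected component of x in a given domain is still an
open domain. Changes of charts are required to have connected domains. -/
theorem partialDiffeomorph_connected {M N : Type*} [TopologicalSpace M]
    [ChartedSpace (EuclideanSpace ℝ (Fin n)) M] [TopologicalSpace N]
    [ChartedSpace (EuclideanSpace ℝ (Fin n)) N] {f : M → N} {x : M}
    (hf : IsLocalDiffeomorphAt (𝓡 n) (𝓡 n) ∞ f x) {O : Set M} (hO : O ∈ 𝓝 x) :
    ∃ Φ : PartialDiffeomorph (𝓡 n) (𝓡 n) M N ∞, x ∈ Φ.source ∧ Φ.source ⊆ O ∧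
      IsConnected Φ.source ∧ ∀ y ∈ Φ.source, Φ y = f y := by
  have : LocallyConnectedSpace M := ChartedSpace.locallyConnectedSpace (EuclideanSpace ℝ (Fin n)) M
  obtain ⟨Φ, hx, hs, h⟩ := exists_partial hf hO
  have e : (partialRestr Φ (connectedComponentIn Φ.source x)
      Φ.open_source.connectedComponentIn).source = connectedComponentIn Φ.source x :=
    inter_eq_self_of_subset_right (connectedComponentIn_subset _ _)
  refine ⟨partialRestr Φ (connectedComponentIn Φ.source x) Φ.open_source.connectedComponentIn,
    ?_, ?_, ?_, fun y hy => h y hy.1⟩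
  · rw [e]; exact mem_connectedComponentIn hx
  · rw [e]; exact (connectedComponentIn_subset _ _).trans hs
  · rw [e]; exact isConnected_connectedComponentIn_iff.2 hx

/-- Connectedness of the domain costs nothing, as the domain may be shrunk. Without it,
compatibility is easy to invert and to compose. -/
theorem OrbChart.compatible_iff {c d : OrbChart Q n} : c.Compatible d ↔
    ∀ (x : c.V) (y : d.V), c.φ x = d.φ y → ∃ h : c.V → d.V, h x = y ∧
      IsLocalDiffeomorphAt (𝓡 n) (𝓡 n) ∞ h x ∧ ∀ᶠ z in 𝓝 x, d.φ (h z) = c.φ z := by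
  constructor
  · intro H x y hxy
    obtain ⟨h, -, hx, hy, he⟩ := H x y hxy
    exact ⟨h, hy, h.isLocalDiffeomorphAt _ _ _ hx,
      mem_of_superset (h.open_source.mem_nhds hx) he⟩
  · intro H x y hxy
    obtain ⟨h, hy, hx, he⟩ := H x y hxy
    obtain ⟨Φ, h1, h2, h3, h4⟩ := partialDiffeomorph_connected hx he
    exact ⟨Φ, h3, h1, (h4 x h1).trans hy, fun z hz => by rw [h4 z hz]; exact h2 hz⟩

theorem OrbChart.Compatible.symm {c d : OrbChart Q n} (H : c.Compatible d) : d.Compatible c := by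
  rw [OrbChart.compatible_iff] at H ⊢
  intro y x hxy
  obtain ⟨h, rfl, hx, he⟩ := H x y hxy.symm
  obtain ⟨i, hi, hix, hl, hr⟩ := exists_localInverse hx
  have ht : Tendsto i (𝓝 (h x)) (𝓝 x) := by
    have := hi.contMDiffAt.continuousAt
    rw [ContinuousAt, hix] at this
    exact this
  refine ⟨i, hix, hi, ?_⟩
  filter_upwards [ht.eventually he, hr] with z h1 h2
  rw [← h1, h2]

/-- Charts which locally map to charts of the orbifold structure belong to it. -/
theorem OrbStr.mem_charts_of {S : OrbStr Q} (c : OrbChart Q S.n)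
    (h : ∀ x : c.V, ∃ d ∈ S.charts, ∃ k : c.V → d.V, IsLocalDiffeomorphAt (𝓡 S.n) (𝓡 S.n) ∞ k x ∧
      ∀ᶠ z in 𝓝 x, d.φ (k z) = c.φ z) : c ∈ S.charts := by
  have key : ∀ d ∈ S.charts, c.Compatible d := fun d hd => by
    rw [OrbChart.compatible_iff]
    intro x y hxy
    obtain ⟨d', hd', k, hk, he⟩ := h x
    obtain ⟨l, hl1, hl2, hl3⟩ := OrbChart.compatible_iff.1 (S.maximal.prop.compatible d' hd' d hd)
      (k x) y (he.self_of_nhds.trans hxy)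
    refine ⟨l ∘ k, hl1, hk.comp (𝓡 S.n) _ hl2, ?_⟩
    filter_upwards [he, hk.contMDiffAt.continuousAt.eventually hl3] with z h1 h2
    exact h2.trans h1
  -- Adjoining c to the maximal atlas also requires compatibility of c with itself, which its group
  -- elements provide.
  have self : c.Compatible c := by
    rw [OrbChart.compatible_iff]
    intro x y hxy
    obtain ⟨g, hg, rfl⟩ := (c.φ_eq_iff x y).1 hxy
    exact ⟨g, rfl, g.isLocalDiffeomorph x,
      Eventually.of_forall fun z => ((c.φ_eq_iff z (g z)).2 ⟨g, hg, rfl⟩).symm⟩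
  have hA : IsOrbAtlas (insert c S.charts) := by
    refine ⟨?_, fun q => ?_⟩
    · rintro a (rfl | ha) b (rfl | hb)
      · exact self
      · exact key b hb
      · exact (key a ha).symm
      · exact S.maximal.prop.compatible a ha b hb
    · obtain ⟨d, hd, hq⟩ := S.maximal.prop.cover q
      exact ⟨d, mem_insert_of_mem _ hd, hq⟩
  exact S.maximal.le_of_ge hA (subset_insert c S.charts) (mem_insert c S.charts)

section Sub

variable (c : OrbChart Q n) (D : Set c.V) (hO : IsOpen D)

theorem isLocalHomeomorph_val {X : Type*} [TopologicalSpace X] {D : Set X} (hO : IsOpen D) :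
    IsLocalHomeomorph (Subtype.val : D → X) :=
  hO.isOpenEmbedding_subtypeVal.isLocalHomeomorph

/-- The group of restrictions to an open subset of elements of `G`. -/
def OrbChart.subGroup :
    letI := pullbackChartedSpace (n := n) (Subtype.val : D → c.V) (isLocalHomeomorph_val hO)
    Subgroup (D ≃ₘ^∞⟮𝓡 n, 𝓡 n⟯ D) :=
  letI := pullbackChartedSpace (n := n) (Subtype.val : D → c.V) (isLocalHomeomorph_val hO)
  { carrier := {k | ∃ g ∈ c.G, ∀ z, (k z : c.V) = g z}
    mul_mem' := by
      rintro k l ⟨g, hg, hk⟩ ⟨h, hh, hl⟩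
      refine ⟨g * h, mul_mem hg hh, fun z => ?_⟩
      change (k (l z) : c.V) = g (h z)
      rw [hk, hl]
    one_mem' := ⟨1, one_mem _, fun z => rfl⟩
    inv_mem' := by
      rintro k ⟨g, hg, hk⟩
      refine ⟨g⁻¹, inv_mem hg, fun z => ?_⟩
      change (k.symm z : c.V) = g.symm z
      have := hk (k.symm z)
      rw [k.apply_symm_apply] at this
      rw [this, g.symm_apply_apply] }

/-- The restriction of a chart to a connected open subset which is stable under those group elements
that do not move it off itself. -/
def OrbChart.sub (hc : IsConnected D)
    (hD : ∀ g ∈ c.G, ∀ x ∈ D, g x ∈ D → ∀ z ∈ D, g z ∈ D) : OrbChart Q n where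
  V := D
  chartedV := pullbackChartedSpace (n := n) (Subtype.val : D → c.V) (isLocalHomeomorph_val hO)
  manifoldV := pullback_isManifold _ _
  connectedV := isConnected_iff_connectedSpace.1 hc
  G := c.subGroup D hO
  finite_G := by
    let _ := pullbackChartedSpace (n := n) (Subtype.val : D → c.V) (isLocalHomeomorph_val hO)
    have := c.finite_G
    have key : ∀ k : c.subGroup D hO, ∃ g : c.G, ∀ z, (k.1 z : c.V) = g.1 z :=
      fun k => by
        obtain ⟨g, hg, h⟩ := k.2
        exact ⟨⟨g, hg⟩, h⟩
    -- A restriction may come from several elements of the group. Any choice is injective, because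
    -- the group element determines its restriction.
    choose f hf using key
    refine Finite.of_injective f fun k l h => Subtype.ext (Diffeomorph.ext fun z => Subtype.ext ?_)
    rw [hf, hf, h]
  φ z := c.φ z
  continuous_φ := c.continuous_φ.comp continuous_subtype_val
  isOpenMap_φ := c.isOpenMap_φ.comp hO.isOpenMap_subtype_val
  φ_eq_iff x y := by
    let _ := pullbackChartedSpace (n := n) (Subtype.val : D → c.V) (isLocalHomeomorph_val hO)
    have hv := pullback_isLocalDiffeomorph (n := n) (Subtype.val : D → c.V)
      (isLocalHomeomorph_val hO)
    rw [c.φ_eq_iff]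
    constructor
    · rintro ⟨g, hg, e⟩
      -- One point of D that stays in D forces g, and likewise its inverse, to preserve D; so g
      -- restricts to a diffeomorphism of D.
      have h1 : ∀ z ∈ D, g z ∈ D := hD g hg x x.2 (e ▸ y.2)
      have e' : g⁻¹ (y : c.V) = x := by
        rw [← e]; exact g.symm_apply_apply _
      have h2 : ∀ z ∈ D, g⁻¹ z ∈ D := hD _ (inv_mem hg) y y.2 (e' ▸ x.2)
      have smooth : ∀ (k : c.V ≃ₘ^∞⟮𝓡 n, 𝓡 n⟯ c.V) (hk : ∀ z ∈ D, k z ∈ D),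
          ContMDiff (𝓡 n) (𝓡 n) ∞ (fun z : D => (⟨k z, hk z z.2⟩ : D)) := fun k hk =>
        contMDiff_of_comp_isLocalDiffeomorph hv
          ((k.continuous.comp continuous_subtype_val).subtype_mk _)
          (k.contMDiff.comp hv.contMDiff)
      refine ⟨⟨⟨fun z => ⟨g z, h1 z z.2⟩, fun z => ⟨g⁻¹ (z : c.V), h2 z z.2⟩,
        fun z => Subtype.ext (g.symm_apply_apply _), fun z => Subtype.ext (g.apply_symm_apply _)⟩,
        smooth g h1, smooth g⁻¹ h2⟩, ⟨g, hg, fun z => rfl⟩, Subtype.ext e⟩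
    · rintro ⟨k, ⟨g, hg, h⟩, rfl⟩
      exact ⟨g, hg, (h x).symm⟩

end Sub

/-- Points of charts have arbitrarily small neighborhoods which are connected and stable under the
group elements that do not move them off themselves. -/
theorem OrbChart.exists_stable (c : OrbChart Q n) {x : c.V} {O : Set c.V} (hO : O ∈ 𝓝 x) :
    ∃ D : Set c.V, IsOpen D ∧ IsConnected D ∧ x ∈ D ∧ D ⊆ O ∧
      ∀ g ∈ c.G, ∀ y ∈ D, g y ∈ D → ∀ z ∈ D, g z ∈ D := by
  have := c.finite_G
  have : LocallyConnectedSpace c.V :=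
    ChartedSpace.locallyConnectedSpace (EuclideanSpace ℝ (Fin n)) c.V
  -- An element that moves x moves a neighborhood of x off itself. As the group is finite, only the
  -- stabilizer of x can return a point of the neighborhood U' below to U'.
  have h1 : ∀ g : c.G, ∃ U : Set c.V, IsOpen U ∧ x ∈ U ∧ ∀ y ∈ U, g.1 y ∈ U → g.1 x = x := by
    intro g
    by_cases hg : g.1 x = x
    · exact ⟨univ, isOpen_univ, trivial, fun _ _ _ => hg⟩
    · obtain ⟨A, B, hA, hB, hgx, hx, hAB⟩ := t2_separation hg
      refine ⟨B ∩ g.1 ⁻¹' A, hB.inter (hA.preimage g.1.continuous), ⟨hx, hgx⟩, ?_⟩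
      rintro y ⟨-, hy⟩ ⟨hy', -⟩
      exact (hAB.le_bot ⟨hy, hy'⟩).elim
  choose U hU hxU hUg using h1
  let U' : Set c.V := interior O ∩ ⋂ g, U g
  have hU' : IsOpen U' := isOpen_interior.inter (isOpen_iInter_of_finite hU)
  have hxU' : x ∈ U' := ⟨mem_interior_iff_mem_nhds.2 hO, mem_iInter.2 hxU⟩
  have hU'g : ∀ g ∈ c.G, ∀ y ∈ U', g y ∈ U' → g x = x := fun g hg y hy hgy =>
    hUg ⟨g, hg⟩ y (mem_iInter.1 hy.2 _) (mem_iInter.1 hgy.2 _)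
  -- The intersection of the translates of U' under the stabilizer of x. It is invariant under the
  -- stabilizer, hence so is its connected component of x.
  let U₁ : Set c.V := ⋂ g : c.G, {y | g.1 x = x → g.1 y ∈ U'}
  have hU₁ : IsOpen U₁ := isOpen_iInter_of_finite fun g => by
    by_cases hg : g.1 x = x
    · simp only [hg, true_imp_iff]; exact hU'.preimage g.1.continuous
    · simp [hg]
  have hxU₁ : x ∈ U₁ := mem_iInter.2 fun g hg => by rw [hg]; exact hxU'
  have hsub : U₁ ⊆ U' := fun y hy => mem_iInter.1 hy 1 rfl
  have hD := connectedComponentIn_subset U₁ x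
  refine ⟨connectedComponentIn U₁ x, hU₁.connectedComponentIn,
    isConnected_connectedComponentIn_iff.2 hxU₁, mem_connectedComponentIn hxU₁,
    (hD.trans hsub).trans (inter_subset_left.trans interior_subset), ?_⟩
  intro g hg y hy hgy z hz
  have hgx : g x = x := hU'g g hg y (hsub (hD hy)) (hsub (hD hgy))
  have h2 : g '' connectedComponentIn U₁ x ⊆ connectedComponentIn U₁ x := by
    refine (isPreconnected_connectedComponentIn.image g
      g.continuous.continuousOn).subset_connectedComponentIn
      ⟨x, mem_connectedComponentIn hxU₁, hgx⟩ ?_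
    rintro _ ⟨w, hw, rfl⟩
    refine mem_iInter.2 fun k hk => ?_
    refine mem_iInter.1 (hD hw) (k * ⟨g, hg⟩) ?_
    change k.1 (g x) = x
    rw [hgx, hk]
  exact h2 ⟨z, hz, rfl⟩

variable {S : OrbStr Q}

/-- The inclusion of a chart. -/
def AtlasRep.incl (𝒱 : AtlasRep S) (i : 𝒱.I) (v : (𝒱.chart i).V) : 𝒱.Base := ⟨i, v⟩

theorem AtlasRep.incl_localDiffeomorph (𝒱 : AtlasRep S) (i : 𝒱.I) :
    IsLocalDiffeomorph (𝓡 S.n) (𝓡 S.n) ∞ (𝒱.incl i) :=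
  sigmaMk_isLocalDiffeomorph (n := S.n) (fun i => (𝒱.chart i).V) i

theorem AtlasRep.incl_isOpenEmbedding (𝒱 : AtlasRep S) (i : 𝒱.I) : IsOpenEmbedding (𝒱.incl i) :=
  IsOpenEmbedding.sigmaMk (σ := fun i => (𝒱.chart i).V)

/-- A small stable neighborhood, with the group of restrictions, is itself an orbifold chart. It
belongs to the structure since its inclusion is a local diffeomorphism over Q. -/
theorem AtlasRep.exists_chartDomain (𝒱 : AtlasRep S) {x : 𝒱.Base} {O : Set 𝒱.Base}
    (hO : O ∈ 𝓝 x) : ∃ D ⊆ O, x ∈ D ∧ IsOpen D ∧ 𝒱.IsChartDomain D := by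
  obtain ⟨i, v⟩ := x
  have hO' : 𝒱.incl i ⁻¹' O ∈ 𝓝 v :=
    (𝒱.incl_isOpenEmbedding i).continuous.continuousAt.preimage_mem_nhds hO
  obtain ⟨D, h1, h2, h3, h4, h5⟩ := (𝒱.chart i).exists_stable hO'
  let _ := pullbackChartedSpace (n := S.n) (Subtype.val : D → (𝒱.chart i).V)
    (isLocalHomeomorph_val h1)
  have hv := pullback_isLocalDiffeomorph (n := S.n) (Subtype.val : D → (𝒱.chart i).V)
    (isLocalHomeomorph_val h1)
  have hr : range (𝒱.incl i ∘ (Subtype.val : D → (𝒱.chart i).V)) = 𝒱.incl i '' D := by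
    rw [range_comp, Subtype.range_val]
  refine ⟨𝒱.incl i '' D, image_subset_iff.2 h4, ⟨v, h3, rfl⟩,
    (𝒱.incl_isOpenEmbedding i).isOpenMap _ h1, (𝒱.chart i).sub D h1 h2 h5, ?_,
    𝒱.incl i ∘ (Subtype.val : D → (𝒱.chart i).V), ?_, ?_, hr, fun x => rfl⟩
  · exact OrbStr.mem_charts_of _ fun x => ⟨_, 𝒱.mem i, Subtype.val, hv x,
      Eventually.of_forall fun z => rfl⟩
  · exact (𝒱.incl_isOpenEmbedding i).comp h1.isOpenEmbedding_subtypeVal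
  · exact fun x => (hv x).comp (𝓡 S.n) _ (𝒱.incl_localDiffeomorph i _)

/-- The refinement of a representative by a family of chart domains. -/
theorem AtlasRep.exists_refinement (𝒱 : AtlasRep S) {I : Type u} (D : I → Set 𝒱.Base)
    (hD : ∀ i, 𝒱.IsChartDomain (D i)) (hcov : ∀ q, ∃ i, ∃ x ∈ D i, 𝒱.π x = q) :
    ∃ (𝒲 : AtlasRep S) (e : GermHom 𝒲 𝒱) (k : 𝒲.Base → I), e.IsLift ∧
      (∀ w, ∀ᶠ w' in 𝓝 w, k w' = k w) ∧ (∀ w, e.obj w ∈ D (k w)) ∧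
      ∀ i, ∃ σ : 𝒱.Base → 𝒲.Base, ∀ x ∈ D i,
        ContinuousAt σ x ∧ k (σ x) = i ∧ e.obj (σ x) = x := by
  choose c hc j hj hjd hr hπ using hD
  let 𝒲 : AtlasRep S := ⟨I, c, hc, fun q => by
    obtain ⟨i, x, hx, hq⟩ := hcov q
    rw [← hr] at hx
    obtain ⟨w, rfl⟩ := hx
    exact ⟨i, w, by rw [← hπ, hq]⟩⟩
  let ψ : 𝒲.Base → 𝒱.Base := fun w => j w.1 w.2
  have hψ : IsLocalDiffeomorph (𝓡 S.n) (𝓡 S.n) ∞ ψ := by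
    rintro ⟨i, w⟩
    exact localDiffeomorphAt_of_comp_right (f := 𝒲.incl i) (g := ψ)
      (𝒲.incl_localDiffeomorph i w) (hjd i w)
  obtain ⟨e, he, heψ⟩ := GermHom.exists_lift (𝒱 := 𝒲) (𝒲 := 𝒱) hψ (fun w => hπ w.1 w.2)
  refine ⟨𝒲, e, Sigma.fst, he, ?_, ?_, fun i => ?_⟩
  · rintro ⟨i, w⟩
    have : range (𝒲.incl i) ∈ 𝓝 (⟨i, w⟩ : 𝒲.Base) :=
      (𝒲.incl_isOpenEmbedding i).isOpen_range.mem_nhds ⟨w, rfl⟩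
    filter_upwards [this]
    rintro _ ⟨z, rfl⟩
    rfl
  · rintro ⟨i, w⟩
    rw [heψ, ← hr]
    exact ⟨w, rfl⟩
  · have : Nonempty (c i).V := inferInstance
    let l := (hj i).toOpenPartialHomeomorph (j i)
    -- Outside of D i the inverse takes irrelevant values; only points of D i are claimed to be
    -- sections.
    refine ⟨fun x => ⟨i, l.symm x⟩, fun x hx => ?_⟩
    have hx' : x ∈ l.target := by
      rw [← hr] at hx
      simpa [l] using hx
    refine ⟨?_, rfl, ?_⟩
    · exact ContinuousAt.comp (f := l.symm) (g := 𝒲.incl i)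
        (𝒲.incl_isOpenEmbedding i).continuous.continuousAt (l.continuousAt_symm hx')
    · rw [heψ]
      exact l.right_inv hx'

/-- Points of two representatives over the same point are related by a local diffeomorphism. -/
theorem AtlasRep.exists_local (𝒱 𝒲 : AtlasRep S) {x : 𝒱.Base} {y : 𝒲.Base} (h : 𝒱.π x = 𝒲.π y) :
    ∃ f : 𝒱.Base → 𝒲.Base, f x = y ∧ IsLocalDiffeomorphAt (𝓡 S.n) (𝓡 S.n) ∞ f x ∧
      ∀ᶠ z in 𝓝 x, 𝒲.π (f z) = 𝒱.π z := by
  obtain ⟨i, x⟩ := x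
  obtain ⟨j, y⟩ := y
  obtain ⟨k, hxy, hk, he⟩ := OrbChart.compatible_iff.1
    (S.maximal.prop.compatible _ (𝒱.mem i) _ (𝒲.mem j)) x y h
  obtain ⟨l, hl, hlx, -, hlr⟩ := exists_localInverse
    (𝒱.incl_localDiffeomorph i x)
  have ht : Tendsto l (𝓝 (𝒱.incl i x)) (𝓝 x) := by
    have := hl.contMDiffAt.continuousAt
    rw [ContinuousAt, hlx] at this
    exact this
  have hk' : IsLocalDiffeomorphAt (𝓡 S.n) (𝓡 S.n) ∞ k (l (𝒱.incl i x)) := by rw [hlx]; exact hk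
  refine ⟨fun z => 𝒲.incl j (k (l z)), ?_, ?_, ?_⟩
  · change 𝒲.incl j (k (l (𝒱.incl i x))) = _
    rw [hlx, hxy]; rfl
  · exact (hl.comp (𝓡 S.n) _ hk').comp (𝓡 S.n) _
      (𝒲.incl_localDiffeomorph j _)
  · filter_upwards [ht.eventually he, hlr] with z h1 h2
    exact h1.trans (congrArg 𝒱.π h2)

/-- The representative of all germs of local diffeomorphisms over `Q` from `𝒱₁` to `𝒱₂`. -/
theorem AtlasRep.exists_common (𝒱₁ 𝒱₂ : AtlasRep S) :
    ∃ (𝒜 : AtlasRep S) (p₁ : GermHom 𝒜 𝒱₁) (p₂ : GermHom 𝒜 𝒱₂), p₁.IsLift ∧ p₂.IsLift ∧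
      ∀ (f : 𝒱₁.Base → 𝒱₂.Base) (x : 𝒱₁.Base), IsLocalDiffeomorphAt (𝓡 S.n) (𝓡 S.n) ∞ f x →
        (∀ᶠ z in 𝓝 x, 𝒱₂.π (f z) = 𝒱₁.π z) →
        ∃ σ : 𝒱₁.Base → 𝒜.Base, ∀ᶠ y in 𝓝 x, ContinuousAt σ y ∧ p₁.obj (σ y) = y ∧
          ∀ᶠ w in 𝓝 (σ y), p₂.obj w = f (p₁.obj w) := by
  -- One chart for each local diffeomorphism m over Q whose domain underlies a chart. On that
  -- summand p₁ is the inclusion of the domain and p₂ is m composed with it. Because all such m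
  -- occur, every local diffeomorphism over Q is locally p₂ after a section of p₁.
  let I : Type u := {m : PartialDiffeomorph (𝓡 S.n) (𝓡 S.n) 𝒱₁.Base 𝒱₂.Base ∞ //
    𝒱₁.IsChartDomain m.source ∧ ∀ z ∈ m.source, 𝒱₂.π (m z) = 𝒱₁.π z}
  have key : ∀ (f : 𝒱₁.Base → 𝒱₂.Base) (x : 𝒱₁.Base),
      IsLocalDiffeomorphAt (𝓡 S.n) (𝓡 S.n) ∞ f x → (∀ᶠ z in 𝓝 x, 𝒱₂.π (f z) = 𝒱₁.π z) →
      ∃ m : I, x ∈ m.1.source ∧ ∀ z ∈ m.1.source, m.1 z = f z := by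
    intro f x hf hπ
    obtain ⟨Φ, hx, hs, hΦ⟩ := exists_partial hf hπ
    obtain ⟨D, hDO, hxD, hD, hDc⟩ := 𝒱₁.exists_chartDomain (Φ.open_source.mem_nhds hx)
    have e : (partialRestr Φ D hD).source = D := inter_eq_self_of_subset_right hDO
    exact ⟨⟨partialRestr Φ D hD, by rw [e]; exact hDc, fun z hz => (congrArg _ (hΦ z hz.1)).trans (hs hz.1)⟩,
      ⟨hx, hxD⟩, fun z hz => hΦ z hz.1⟩
  obtain ⟨𝒜, p₁, k, hp₁, hk, hpD, hσ⟩ := 𝒱₁.exists_refinement (fun m : I => m.1.source)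
    (fun m => m.2.1) (fun q => by
      obtain ⟨x, rfl⟩ := 𝒱₁.surjective_π q
      obtain ⟨y, hy⟩ := 𝒱₂.surjective_π (𝒱₁.π x)
      obtain ⟨f, -, hf, hπ⟩ := AtlasRep.exists_local 𝒱₁ 𝒱₂ hy.symm
      obtain ⟨m, hm, -⟩ := key f x hf hπ
      exact ⟨m, x, hm, rfl⟩)
  let ψ : 𝒜.Base → 𝒱₂.Base := fun w => (k w).1 (p₁.obj w)
  have hψ : IsLocalDiffeomorph (𝓡 S.n) (𝓡 S.n) ∞ ψ := fun w => by
    refine localDiffeomorphAt_congr ((hp₁.localDiffeomorph w).comp (𝓡 S.n) _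
      ((k w).1.isLocalDiffeomorphAt _ _ _ (hpD w))) ?_
    filter_upwards [hk w] with w' hw
    simp only [ψ, hw, Function.comp]
  obtain ⟨p₂, hp₂, e₂⟩ := GermHom.exists_lift (𝒱 := 𝒜) (𝒲 := 𝒱₂) hψ (fun w =>
    ((k w).2.2 _ (hpD w)).trans (hp₁.π_obj w))
  refine ⟨𝒜, p₁, p₂, hp₁, hp₂, fun f x hf hπ => ?_⟩
  obtain ⟨m, hm, hmf⟩ := key f x hf hπ
  obtain ⟨σ, hσ⟩ := hσ m
  refine ⟨σ, ?_⟩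
  filter_upwards [m.1.open_source.mem_nhds hm] with y hy
  obtain ⟨h1, h2, h3⟩ := hσ y hy
  refine ⟨h1, h3, ?_⟩
  filter_upwards [hk (σ y)] with w hw
  rw [e₂, ← hmf, ← h2, ← hw]
  rw [← h2, ← hw]
  exact hpD w

end SmallCharts

theorem FullPseudogroup.germMul_congr {n : ℕ} {M : Type u} [TopologicalSpace M]
    [ChartedSpace (EuclideanSpace ℝ (Fin n)) M] {P : FullPseudogroup n M} {a a' b b' : P.Germ}
    (ha : a = a') (hb : b = b') (h : src a = tgt b) :
    germMul ⟨(a, b), h⟩ = germMul ⟨(a', b'), ha ▸ hb ▸ h⟩ := by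
  subst ha hb
  rfl

/-- The function representing the right factor maps neighborhoods of its source onto neighborhoods
of its target, so agreement after precomposition is agreement of germs. -/
theorem FullPseudogroup.germMul_right_cancel {n : ℕ} {M : Type u} [TopologicalSpace M]
    [ChartedSpace (EuclideanSpace ℝ (Fin n)) M] {P : FullPseudogroup n M} {a a' b b' : P.Germ}
    {h : src a = tgt b} {h' : src a' = tgt b'} (hb : b = b')
    (e : germMul ⟨(a, b), h⟩ = germMul ⟨(a', b'), h'⟩) : a = a' := by
  subst hb
  refine germ_ext (h.trans h'.symm) ?_
  rw [h, ← map_app_nhds]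
  refine eventually_map.2 ?_
  have e1 := app_germMul a b h
  rw [e] at e1
  exact e1.symm.trans (app_germMul a' b h')

/-! ### Equivalence of homomorphisms up to lifts of the identities. -/

section Equivalence

variable {Q : Type u} [TopologicalSpace Q] {Q' : Type u} [TopologicalSpace Q']
  {Q'' : Type u} [TopologicalSpace Q'']
  {S : OrbStr Q} {S' : OrbStr Q'} {S'' : OrbStr Q''}

namespace GermHom

/-- If `θ` has local sections along a lift `p` of the identity, it factors through `p` after
refining its domain. -/
theorem exists_refined_factor {𝒰 : AtlasRep S} {𝒜 𝒱' : AtlasRep S'} (θ : GermHom 𝒰 𝒱')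
    {p : GermHom 𝒜 𝒱'} (hp : IsLift p) (R : 𝒰.Base → 𝒜.Base → Prop)
    (h : ∀ x, ∃ s : 𝒰.Base → 𝒜.Base, ∀ᶠ y in 𝓝 x,
      ContinuousAt s y ∧ p.obj (s y) = θ.obj y ∧ R y (s y)) :
    ∃ (𝒲 : AtlasRep S) (e : GermHom 𝒲 𝒰) (χ : GermHom 𝒲 𝒜), IsLift e ∧ p.comp χ = θ.comp e ∧
      ∀ w, R (e.obj w) (χ.obj w) := by
  choose s hs using h
  -- Each chart of the refinement lies where one fixed local section works. Using that section on
  -- the whole summand makes the glued map continuous.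
  choose D hDs hxD hDo hD using fun x => 𝒰.exists_chartDomain (hs x)
  obtain ⟨𝒲, e, k, he, hk, hkD, -⟩ := 𝒰.exists_refinement D hD (fun q => by
    obtain ⟨x, rfl⟩ := 𝒰.surjective_π q
    exact ⟨x, x, hxD x, rfl⟩)
  have hc : Continuous fun w => s (k w) (e.obj w) := by
    rw [continuous_iff_continuousAt]
    intro w
    have h1 : ContinuousAt (fun w' => s (k w) (e.obj w')) w :=
      ContinuousAt.comp (f := e.obj) (hDs _ (hkD w)).1 e.continuous_obj.continuousAt
    refine h1.congr ?_
    filter_upwards [hk w] with w' hw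
    rw [hw]
  obtain ⟨χ, hχ, hpχ⟩ := hp.exists_factor (θ.comp e) hc fun w => (hDs _ (hkD w)).2.1
  exact ⟨𝒲, e, χ, he, hpχ, fun w => by rw [hχ]; exact (hDs _ (hkD w)).2.2⟩

/-- Homomorphisms into the range of a lift from a common refinement can be lifted after refining
the domain. -/
theorem exists_lift_to_common {𝒰 : AtlasRep S} {𝒱₁ 𝒱₂ : AtlasRep S'} (θ : GermHom 𝒰 𝒱₁) :
    ∃ (𝒜 : AtlasRep S') (p₁ : GermHom 𝒜 𝒱₁) (p₂ : GermHom 𝒜 𝒱₂) (𝒲 : AtlasRep S)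
      (e : GermHom 𝒲 𝒰) (χ : GermHom 𝒲 𝒜),
      IsLift p₁ ∧ IsLift p₂ ∧ IsLift e ∧ p₁.comp χ = θ.comp e := by
  obtain ⟨𝒜, p₁, p₂, h₁, h₂, hσ⟩ := AtlasRep.exists_common 𝒱₁ 𝒱₂
  obtain ⟨𝒲, e, χ, he, hχ, -⟩ := exists_refined_factor θ h₁ (fun _ _ => True) fun x => by
    obtain ⟨y, hy⟩ := 𝒱₂.surjective_π (𝒱₁.π (θ.obj x))
    -- Any local diffeomorphism over Q' from near θ x to 𝒱₂ yields a section of p₁ near θ x; which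
    -- one is taken does not matter.
    obtain ⟨f, -, hf, hπ⟩ := AtlasRep.exists_local 𝒱₁ 𝒱₂ hy.symm
    obtain ⟨σ, h⟩ := hσ f _ hf hπ
    refine ⟨fun y => σ (θ.obj y), ?_⟩
    filter_upwards [θ.continuous_obj.continuousAt.eventually h] with y hy
    exact ⟨ContinuousAt.comp (f := θ.obj) hy.1 θ.continuous_obj.continuousAt, hy.2.1, trivial⟩
  exact ⟨𝒜, p₁, p₂, 𝒲, e, χ, h₁, h₂, he, hχ⟩

/-- `θ₁` and `θ₂` are equivalent: up to lifts of the identities, both are induced from one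
homomorphism. -/
def HEquiv {𝒱₁ 𝒱₂ : AtlasRep S} {𝒱₁' 𝒱₂' : AtlasRep S'} (θ₁ : GermHom 𝒱₁ 𝒱₁')
    (θ₂ : GermHom 𝒱₂ 𝒱₂') : Prop :=
  ∃ (𝒲 : AtlasRep S) (𝒲' : AtlasRep S') (χ : GermHom 𝒲 𝒲') (ε₁ : GermHom 𝒲 𝒱₁)
    (ε₂ : GermHom 𝒲 𝒱₂) (ε₁' : GermHom 𝒲' 𝒱₁') (ε₂' : GermHom 𝒲' 𝒱₂'),
    IsLift ε₁ ∧ IsLift ε₂ ∧ IsLift ε₁' ∧ IsLift ε₂' ∧ θ₁.comp ε₁ = ε₁'.comp χ ∧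
      θ₂.comp ε₂ = ε₂'.comp χ

section

variable {𝒰 𝒱₁ 𝒱₂ 𝒱₃ 𝒱 : AtlasRep S} {𝒱₁' 𝒱₂' 𝒱₃' 𝒱' 𝒲' : AtlasRep S'}

/-- Homomorphisms which become naturally isomorphic after composing with lifts of the identity are
induced from one homomorphism. -/
theorem Iso.exists_refinement {θ₁ : GermHom 𝒰 𝒱₁'} {θ₂ : GermHom 𝒰 𝒱₂'} {ε₁ : GermHom 𝒱₁' 𝒱'}
    {ε₂ : GermHom 𝒱₂' 𝒱'} (h₁ : IsLift ε₁) (h₂ : IsLift ε₂) {ν : 𝒰.Base → 𝒱'.Ψ.Germ}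
    (hν : Iso (ε₁.comp θ₁) (ε₂.comp θ₂) ν) :
    ∃ (𝒲 : AtlasRep S) (𝒜 : AtlasRep S') (e : GermHom 𝒲 𝒰) (χ : GermHom 𝒲 𝒜)
      (p₁ : GermHom 𝒜 𝒱₁') (p₂ : GermHom 𝒜 𝒱₂'), IsLift e ∧ IsLift p₁ ∧ IsLift p₂ ∧
      p₁.comp χ = θ₁.comp e ∧ p₂.comp χ = θ₂.comp e := by
  obtain ⟨𝒜, p₁, p₂, hp₁, hp₂, hσ⟩ := AtlasRep.exists_common 𝒱₁' 𝒱₂'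
  -- Over 𝒜 the two lifts ε₁ ∘ p₁ and ε₂ ∘ p₂ are canonically isomorphic through μ. The aim is a map
  -- χ into 𝒜 along which μ pulls back to the given ν.
  obtain ⟨μ, hμ, hμa⟩ := exists_iso (h₁.comp hp₁) (h₂.comp hp₂)
  obtain ⟨hνc, hνs, hνt, hνn⟩ := hν
  obtain ⟨hμc, hμs, hμt, hμn⟩ := hμ
  -- Near x, the germ ν x corresponds through ε₁ and ε₂ to a local diffeomorphism f that takes θ₁ x
  -- to θ₂ x. The section of p₁ belonging to f sends θ₁ y to a point of 𝒜 which p₂ maps to θ₂ y and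
  -- at which μ equals ν y.
  obtain ⟨𝒲, e, χ, he, hχ, hR⟩ := exists_refined_factor θ₁ hp₁
    (fun y a => p₂.obj a = θ₂.obj y ∧ μ a = ν y) fun x => by
      obtain ⟨f, hf, hfx, hfe⟩ := exists_local_over h₁ h₂ (hνs x) (hνt x)
      obtain ⟨σ, h⟩ := hσ f _ hf (hfe.mono fun _ h => h.2)
      refine ⟨fun y => σ (θ₁.obj y), ?_⟩
      obtain ⟨O, hO, hinj⟩ := localDiffeomorphAt_injective (h₂.localDiffeomorph (θ₂.obj x))
      have hfO : ∀ᶠ z in 𝓝 (θ₁.obj x), f z ∈ O :=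
        hf.contMDiffAt.continuousAt.eventually_mem (by rw [hfx]; exact hO)
      have c₁ : ContinuousAt θ₁.obj x := θ₁.continuous_obj.continuousAt
      filter_upwards [c₁.eventually h, c₁.eventually hfe.eventually_nhds,
        (continuousAt_germ_iff.1 (hνc.continuousAt (x := x))).2, c₁.eventually hfO,
        θ₂.continuous_obj.continuousAt.eventually_mem hO] with y hy1 hy2 hy3 hy4 hy5
      obtain ⟨s1, s2, s3⟩ := hy1
      refine ⟨ContinuousAt.comp (f := θ₁.obj) s1 θ₁.continuous_obj.continuousAt, s2, ?_, ?_⟩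
      · rw [s3.self_of_nhds, s2]
        -- The points f(θ₁ y) and θ₂ y both have image tgt (ν y) under ε₂, and both lie where
        -- `ε₂.obj` is injective.
        refine hinj hy4 hy5 ?_
        have e1 := hy3.self_of_nhds
        rw [app_src, hνt, hνs] at e1
        exact hy2.self_of_nhds.1.trans e1.symm
      · refine germ_ext_comp ((h₁.comp hp₁).map_nhds (σ (θ₁.obj y))) (hμs _)
          ((hνs y).trans (congrArg ε₁.obj s2.symm)) ?_
        have t1 : Tendsto p₁.obj (𝓝 (σ (θ₁.obj y))) (𝓝 (θ₁.obj y)) := by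
          have := p₁.continuous_obj.continuousAt (x := σ (θ₁.obj y))
          rw [ContinuousAt, s2] at this
          exact this
        have t2 : Tendsto ε₁.obj (𝓝 (θ₁.obj y)) (𝓝 (src (ν y))) := by
          rw [hνs]; exact ε₁.continuous_obj.continuousAt
        filter_upwards [hμa (σ (θ₁.obj y)), s3, t1.eventually hy2,
          (t2.comp t1).eventually hy3] with w e1 e2 e3 e4
        rw [e1]
        refine Eq.trans ?_ e4.symm
        change ε₂.obj (p₂.obj w) = _
        rw [e2, e3.1]
        rfl
  refine ⟨𝒲, 𝒜, e, χ, p₁, p₂, he, hp₁, hp₂, hχ, ?_⟩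
  refine h₂.comp_left_cancel (fun w => (hR w).1) (GermHom.ext (fun w => congrArg ε₂.obj (hR w).1)
    fun γ => ?_)
  -- The naturality squares of μ at χ(γ) and of ν at e(γ) now share three sides. Cancelling on the
  -- right identifies the fourth, which is the image under the second homomorphism.
  have e1 := hμn (χ.arr γ)
  have e2 := hνn (e.arr γ)
  have k1 : μ (src (χ.arr γ)) = ν (src (e.arr γ)) := by
    rw [χ.src_arr, e.src_arr, (hR _).2]
  have k2 : μ (tgt (χ.arr γ)) = ν (tgt (e.arr γ)) := by
    rw [χ.tgt_arr, e.tgt_arr, (hR _).2]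
  have k3 : (ε₁.comp p₁).arr (χ.arr γ) = (ε₁.comp θ₁).arr (e.arr γ) :=
    congrArg ε₁.arr (arr_congr hχ γ)
  rw [germMul_congr k2 k3] at e1
  exact germMul_right_cancel k1 (e1.trans e2.symm)

theorem Iso.hEquiv {θ₁ : GermHom 𝒰 𝒱'} {θ₂ : GermHom 𝒰 𝒱'} {ν : 𝒰.Base → 𝒱'.Ψ.Germ}
    (hν : Iso θ₁ θ₂ ν) : HEquiv θ₁ θ₂ := by
  obtain ⟨𝒲, 𝒜, e, χ, p₁, p₂, he, hp₁, hp₂, h1, h2⟩ :=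
    Iso.exists_refinement (θ₁ := θ₁) (θ₂ := θ₂) isLift_id isLift_id hν
  exact ⟨𝒲, 𝒜, χ, e, e, p₁, p₂, he, he, hp₁, hp₂, h1.symm, h2.symm⟩

theorem HEquiv.refl (θ : GermHom 𝒱 𝒱') : HEquiv θ θ :=
  ⟨𝒱, 𝒱', θ, id _, id _, id _, id _, isLift_id, isLift_id, isLift_id, isLift_id, rfl, rfl⟩

theorem HEquiv.symm {θ₁ : GermHom 𝒱₁ 𝒱₁'} {θ₂ : GermHom 𝒱₂ 𝒱₂'} (h : HEquiv θ₁ θ₂) :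
    HEquiv θ₂ θ₁ := by
  obtain ⟨𝒲, 𝒲', χ, a, b, c, d, ha, hb, hc, hd, e, f⟩ := h
  exact ⟨𝒲, 𝒲', χ, b, a, d, c, hb, ha, hd, hc, f, e⟩

theorem HEquiv.of_refine {θ : GermHom 𝒱 𝒱'} {ε : GermHom 𝒰 𝒱} {χ : GermHom 𝒰 𝒲'}
    {ε' : GermHom 𝒲' 𝒱'} (hε : IsLift ε) (hε' : IsLift ε') (h : θ.comp ε = ε'.comp χ) :
    HEquiv θ χ :=
  ⟨𝒰, 𝒲', χ, ε, id _, ε', id _, hε, isLift_id, hε', isLift_id, h, rfl⟩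

/-- Homomorphisms which induce the same homomorphism along lifts of the identities are
equivalent. -/
theorem HEquiv.of_coarsen {θ₁ : GermHom 𝒱₁ 𝒱₁'} {θ₂ : GermHom 𝒱₂ 𝒱₂'} {Φ : GermHom 𝒱 𝒱'}
    {ε₁ : GermHom 𝒱₁ 𝒱} {ε₂ : GermHom 𝒱₂ 𝒱} {ε₁' : GermHom 𝒱₁' 𝒱'} {ε₂' : GermHom 𝒱₂' 𝒱'}
    (h₁ : IsLift ε₁) (h₂ : IsLift ε₂) (h₁' : IsLift ε₁') (h₂' : IsLift ε₂')
    (e₁ : Φ.comp ε₁ = ε₁'.comp θ₁) (e₂ : Φ.comp ε₂ = ε₂'.comp θ₂) : HEquiv θ₁ θ₂ := by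
  obtain ⟨𝒜, p₁, p₂, hp₁, hp₂, -⟩ := AtlasRep.exists_common 𝒱₁ 𝒱₂
  -- Φ carries the canonical isomorphism ε₁ p₁ ≅ ε₂ p₂ to an isomorphism ε₁' θ₁ p₁ ≅ ε₂' θ₂ p₂, the
  -- input of `Iso.exists_refinement`.
  obtain ⟨ν, hν, -⟩ := exists_iso (h₁.comp hp₁) (h₂.comp hp₂)
  have hν' := hν.post Φ
  rw [← comp_assoc, ← comp_assoc, e₁, e₂] at hν'
  obtain ⟨𝒲, 𝒜', e, χ, p₁', p₂', he, hp₁', hp₂', k1, k2⟩ :=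
    Iso.exists_refinement (θ₁ := θ₁.comp p₁) (θ₂ := θ₂.comp p₂) h₁' h₂' hν'
  exact ⟨𝒲, 𝒜', χ, p₁.comp e, p₂.comp e, p₁', p₂', hp₁.comp he, hp₂.comp he, hp₁', hp₂',
    k1.symm, k2.symm⟩

/-- The middle homomorphism is a common coarsening of the two inducing homomorphisms, so these are
equivalent by `HEquiv.of_coarsen`; the lifts are then composed. -/
theorem HEquiv.trans {θ₁ : GermHom 𝒱₁ 𝒱₁'} {θ₂ : GermHom 𝒱₂ 𝒱₂'} {θ₃ : GermHom 𝒱₃ 𝒱₃'}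
    (h : HEquiv θ₁ θ₂) (k : HEquiv θ₂ θ₃) : HEquiv θ₁ θ₃ := by
  obtain ⟨𝒲, 𝒲', χ, a, b, c, d, ha, hb, hc, hd, e, f⟩ := h
  obtain ⟨𝒵, 𝒵', ξ, a', b', c', d', ha', hb', hc', hd', e', f'⟩ := k
  obtain ⟨𝒴, 𝒴', ζ, p, q, r, s, hp, hq, hr, hs, k1, k2⟩ := HEquiv.of_coarsen hb ha' hd hc' f e'
  refine ⟨𝒴, 𝒴', ζ, a.comp p, b'.comp q, c.comp r, d'.comp s, ha.comp hp, hb'.comp hq,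
    hc.comp hr, hd'.comp hs, ?_, ?_⟩
  · rw [← comp_assoc, e, comp_assoc, k1, comp_assoc]
  · rw [← comp_assoc, f', comp_assoc, k2, comp_assoc]

/-- If the orbifold is empty, all homomorphisms are equivalent. -/
theorem HEquiv.of_isEmpty [IsEmpty Q] (θ₁ : GermHom 𝒱₁ 𝒱₁') (θ₂ : GermHom 𝒱₂ 𝒱₂') :
    HEquiv θ₁ θ₂ := by
  obtain ⟨𝒜, p₁, p₂, hp₁, hp₂, -⟩ := AtlasRep.exists_common 𝒱₁ 𝒱₂
  obtain ⟨𝒜', p₁', p₂', 𝒲, e, χ, h₁, h₂, he, h⟩ :=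
    exists_lift_to_common (𝒱₂ := 𝒱₂') (θ₁.comp p₁)
  exact ⟨𝒲, 𝒜', χ, p₁.comp e, p₂.comp e, p₁', p₂', hp₁.comp he, hp₂.comp he, h₁, h₂, h.symm,
    GermHom.ext (fun x => isEmptyElim (𝒲.π x)) fun γ => isEmptyElim (𝒲.π (src γ))⟩

end

section

variable {𝒱₁ 𝒱₂ : AtlasRep S} {𝒱₁' 𝒱₂' : AtlasRep S'} {𝒱₁'' 𝒱₂'' : AtlasRep S''}

/-- Composition respects equivalence. -/
theorem HEquiv.comp {χ₁ : GermHom 𝒱₁ 𝒱₁'} {χ₂ : GermHom 𝒱₂ 𝒱₂'} {κ₁ : GermHom 𝒱₁' 𝒱₁''}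
    {κ₂ : GermHom 𝒱₂' 𝒱₂''} (h : HEquiv χ₁ χ₂) (k : HEquiv κ₁ κ₂) :
    HEquiv (κ₁.comp χ₁) (κ₂.comp χ₂) := by
  obtain ⟨ℒ, ℒ', χ, a₁, a₂, a₁', a₂', ha₁, ha₂, ha₁', ha₂', e₁, e₂⟩ := h
  obtain ⟨ℳ', ℳ'', κ, b₁', b₂', b₁'', b₂'', hb₁', hb₂', hb₁'', hb₂'', f₁, f₂⟩ := k
  -- The representative 𝒩' maps to both the range of χ and the domain of κ, so that κ and q ∘ η
  -- become composable. Both original composites will be shown equivalent to κ ∘ (q ∘ η).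
  obtain ⟨𝒩', p, q, 𝒲, e, η, hp, hq, he, hη⟩ := exists_lift_to_common (𝒱₂ := ℳ') χ
  have key : ∀ {𝒱 : AtlasRep S} {𝒱' : AtlasRep S'} {𝒱'' : AtlasRep S''} {θ : GermHom 𝒱 𝒱'}
      {τ : GermHom 𝒱' 𝒱''} {a : GermHom ℒ 𝒱} {a' : GermHom ℒ' 𝒱'} {b' : GermHom ℳ' 𝒱'}
      {b'' : GermHom ℳ'' 𝒱''}, IsLift a → IsLift a' → IsLift b' → IsLift b'' →
      θ.comp a = a'.comp χ → τ.comp b' = b''.comp κ →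
      HEquiv (τ.comp θ) (κ.comp (q.comp η)) := by
    intro 𝒱 𝒱' 𝒱'' θ τ a a' b' b'' ha ha' hb' hb'' e₀ f₀
    have s1 : HEquiv (τ.comp θ) (τ.comp ((a'.comp p).comp η)) :=
      HEquiv.of_refine (ha.comp he) isLift_id (by
        rw [id_comp, comp_assoc a', hη, ← comp_assoc a', ← e₀]
        rfl)
    -- The lifts a' ∘ p and b' ∘ q from 𝒩' to the middle representative need not be equal. A natural
    -- isomorphism between them is enough to exchange one for the other.
    obtain ⟨ν, hν, -⟩ := exists_iso (ha'.comp hp) (hb'.comp hq)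
    have s2 : HEquiv (τ.comp ((a'.comp p).comp η)) (τ.comp ((b'.comp q).comp η)) :=
      ((hν.pre η).post τ).hEquiv
    have s3 : HEquiv (τ.comp ((b'.comp q).comp η)) (κ.comp (q.comp η)) :=
      HEquiv.of_refine isLift_id hb'' (by
        rw [comp_id, comp_assoc b', ← comp_assoc τ, f₀, comp_assoc])
    exact (s1.trans s2).trans s3
  exact (key ha₁ ha₁' hb₁' hb₁'' e₁ f₁).trans (key ha₂ ha₂' hb₂' hb₂'' e₂ f₂).symm

end

section

variable {𝒱₁ 𝒱₁' 𝒱₂ 𝒱₂' : AtlasRep S}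

/-- Over a common refinement of the domains, both are induced from the identity homomorphism. -/
theorem IsLift.hEquiv {θ₁ : GermHom 𝒱₁ 𝒱₁'} {θ₂ : GermHom 𝒱₂ 𝒱₂'} (h₁ : IsLift θ₁)
    (h₂ : IsLift θ₂) : HEquiv θ₁ θ₂ := by
  obtain ⟨𝒜, p₁, p₂, hp₁, hp₂, -⟩ := AtlasRep.exists_common 𝒱₁ 𝒱₂
  exact ⟨𝒜, 𝒜, id _, p₁, p₂, θ₁.comp p₁, θ₂.comp p₂, hp₁, hp₂, h₁.comp hp₁, h₂.comp hp₂, rfl, rfl⟩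

/-- The property of being a lift of the identity descends along refinements of the domain. -/
theorem IsLift.of_comp_right {θ : GermHom 𝒱₂ 𝒱₂'} {ε : GermHom 𝒱₁ 𝒱₂} (hε : IsLift ε)
    (h : IsLift (θ.comp ε)) : IsLift θ := by
  have key : ∀ x : 𝒱₂.Base, IsLocalDiffeomorphAt (𝓡 S.n) (𝓡 S.n) ∞ θ.obj x ∧
      𝒱₂'.π (θ.obj x) = 𝒱₂.π x := fun x => by
    -- The object map of ε need not be onto, but x is joined by a germ γ to some ε w. As θ
    -- intertwines γ with its image germ, the behavior of θ at ε w passes to x.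
    obtain ⟨w, hw⟩ := 𝒱₁.surjective_π (𝒱₂.π x)
    obtain ⟨k, hk, hx, hkx⟩ := 𝒱₂.exists_transition (hw.symm.trans (hε.π_obj w).symm)
    have hwθ : IsLocalDiffeomorphAt (𝓡 S.n) (𝓡 S.n) ∞ θ.obj (ε.obj w) :=
      localDiffeomorphAt_of_comp_right (hε.localDiffeomorph w) (h.localDiffeomorph w)
    let γ : 𝒱₂.Ψ.Germ := germ k hk x hx
    have e1 := θ.app_arr γ
    have h1 : IsLocalDiffeomorphAt (𝓡 S.n) (𝓡 S.n) ∞ (θ.obj ∘ app γ) x :=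
      (app_localDiffeomorphAt γ).comp (𝓡 S.n) _ (by
        rw [app_src]
        change IsLocalDiffeomorphAt (𝓡 S.n) (𝓡 S.n) ∞ θ.obj (k x)
        rw [hkx]
        exact hwθ)
    constructor
    · refine localDiffeomorphAt_of_comp_left (g := app (θ.arr γ)) θ.continuous_obj.continuousAt ?_
        (localDiffeomorphAt_congr h1 (e1.mono fun _ => Eq.symm))
      have := app_localDiffeomorphAt (θ.arr γ)
      rw [θ.src_arr] at this
      exact this
    · rw [θ.π_obj_eq (hw.symm.trans (hε.π_obj w).symm)]
      exact (h.π_obj w).trans hw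
  exact ⟨fun x => (key x).1, fun x => (key x).2⟩

/-- The property of being a lift of the identity descends along lifts. -/
theorem IsLift.of_comp_left {θ : GermHom 𝒱₁ 𝒱₂} {ε : GermHom 𝒱₂ 𝒱₂'} (hε : IsLift ε)
    (h : IsLift (ε.comp θ)) : IsLift θ :=
  ⟨fun x => localDiffeomorphAt_of_comp_left θ.continuous_obj.continuousAt
    (hε.localDiffeomorph _) (h.localDiffeomorph x),
    fun x => (hε.π_obj _).symm.trans (h.π_obj x)⟩

/-- Being a lift passes from θ₂ to the inducing homomorphism by cancelling on the left, and from
there to θ₁ by descent along the domain. With `IsLift.hEquiv`, the lifts form one whole equivalence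
class, the identity morphism. -/
theorem HEquiv.isLift {θ₁ : GermHom 𝒱₁ 𝒱₁'} {θ₂ : GermHom 𝒱₂ 𝒱₂'} (h : HEquiv θ₁ θ₂)
    (h₂ : IsLift θ₂) : IsLift θ₁ := by
  obtain ⟨𝒲, 𝒲', χ, a, b, c, d, ha, hb, hc, hd, e, f⟩ := h
  have hχ : IsLift χ := hd.of_comp_left (by rw [← f]; exact h₂.comp hb)
  exact ha.of_comp_right (by rw [e]; exact hc.comp hχ)

end

end GermHom

end Equivalence

/-! ### Inverse and implicit functions for maps with surjective differential. -/

section InverseFunction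

variable {m n : ℕ}

theorem localDiffeomorphAt_of_surjective_fderiv
    {F : EuclideanSpace ℝ (Fin n) → EuclideanSpace ℝ (Fin n)} {U : Set (EuclideanSpace ℝ (Fin n))}
    (hU : IsOpen U) (hF : ContDiffOn ℝ ∞ F U) {a : EuclideanSpace ℝ (Fin n)} (ha : a ∈ U)
    (hs : Function.Surjective (fderiv ℝ F a)) : IsLocalDiffeomorphAt (𝓡 n) (𝓡 n) ∞ F a := by
  have hFa : ∀ z ∈ U, ContDiffAt ℝ ∞ F z := fun z hz => hF.contDiffAt (hU.mem_nhds hz)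
  have hinj : Function.Injective (fderiv ℝ F a) :=
    (LinearMap.injective_iff_surjective (f := (fderiv ℝ F a).toLinearMap)).2 hs
  let e : EuclideanSpace ℝ (Fin n) ≃L[ℝ] EuclideanSpace ℝ (Fin n) :=
    (LinearEquiv.ofBijective (fderiv ℝ F a).toLinearMap ⟨hinj, hs⟩).toContinuousLinearEquiv
  have hdiff : ∀ z ∈ U, HasFDerivAt F (fderiv ℝ F z) z := fun z hz =>
    ((hFa z hz).differentiableAt (by simp)).hasFDerivAt
  have hd : HasFDerivAt F (e : EuclideanSpace ℝ (Fin n) →L[ℝ] EuclideanSpace ℝ (Fin n)) a := by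
    have : (e : EuclideanSpace ℝ (Fin n) →L[ℝ] EuclideanSpace ℝ (Fin n)) = fderiv ℝ F a := by
      ext v; rfl
    rw [this]
    exact hdiff a ha
  let h := (hFa a ha).toOpenPartialHomeomorph F hd (by simp)
  have hc : ContinuousOn (fderiv ℝ F) U := hF.continuousOn_fderiv_of_isOpen hU (by simp)
  -- Invertibility of the derivative is an open condition. Restricting to the points where it holds
  -- makes the inverse smooth on its whole domain, not merely at F a.
  let O := U ∩ fderiv ℝ F ⁻¹'
    range ((↑) : (EuclideanSpace ℝ (Fin n) ≃L[ℝ] EuclideanSpace ℝ (Fin n)) → _)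
  have hO : IsOpen O := hc.isOpen_inter_preimage hU ContinuousLinearEquiv.isOpen
  have haO : a ∈ O := ⟨ha, e, by ext v; rfl⟩
  let k := h.restrOpen O hO
  have hk : ∀ z, k z = F z := fun z => rfl
  refine ⟨⟨k.toPartialEquiv, k.open_source, k.open_target, ?_, ?_⟩,
    ⟨(hFa a ha).mem_toOpenPartialHomeomorph_source hd (by simp), haO⟩, fun z _ => rfl⟩
  · refine ContDiffOn.contMDiffOn ?_
    exact hF.mono fun z hz => hz.2.1
  · refine ContDiffOn.contMDiffOn fun y hy => ?_
    have hy' : k.symm y ∈ k.source := k.map_target hy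
    obtain ⟨e', he'⟩ := hy'.2.2
    refine (k.contDiffAt_symm hy (f₀' := e') ?_ (hFa _ hy'.2.1)).contDiffWithinAt
    rw [he']
    exact hdiff _ hy'.2.1

/-- If m were larger than n, the implicit function theorem would put a nonconstant injective arc
into the fiber through a, hence infinitely many points of it near a. -/
theorem le_of_surjective_fderiv
    {F : EuclideanSpace ℝ (Fin m) → EuclideanSpace ℝ (Fin n)} {a : EuclideanSpace ℝ (Fin m)}
    (hF : ContDiffAt ℝ ∞ F a) (hs : Function.Surjective (fderiv ℝ F a))
    {O : Set (EuclideanSpace ℝ (Fin m))} (hO : O ∈ 𝓝 a) (hfin : (O ∩ F ⁻¹' {F a}).Finite) :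
    m ≤ n := by
  by_contra! hmn
  have hstrict : HasStrictFDerivAt F (fderiv ℝ F a) a := hF.hasStrictFDerivAt (by simp)
  have hr : (fderiv ℝ F a).range = ⊤ := LinearMap.range_eq_top.2 hs
  obtain ⟨v, hv, hv0⟩ : ∃ v ∈ (fderiv ℝ F a).ker, v ≠ 0 := by
    have : (fderiv ℝ F a).toLinearMap.ker ≠ ⊥ :=
      LinearMap.ker_ne_bot_of_finrank_lt (by simpa using hmn)
    exact Submodule.exists_mem_ne_zero_of_ne_bot this
  let h := hstrict.implicitToOpenPartialHomeomorph F _ hr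
  -- In implicit coordinates (value of F, component in the kernel), the value is kept fixed while
  -- moving along the kernel vector v.
  let c : ℝ → EuclideanSpace ℝ (Fin n) × (fderiv ℝ F a).ker := fun t => (F a, t • ⟨v, hv⟩)
  have hc : Continuous c := by fun_prop
  have hc0 : c 0 = (F a, 0) := by simp [c]
  have ht : c 0 ∈ h.target := by
    rw [hc0]; exact hstrict.mem_implicitToOpenPartialHomeomorph_target hr
  have h0 : h.symm (c 0) = a := by
    rw [hc0, ← hstrict.implicitToOpenPartialHomeomorph_self hr]
    exact h.left_inv (hstrict.mem_implicitToOpenPartialHomeomorph_source hr)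
  have hcs : ContinuousAt (fun t => h.symm (c t)) 0 :=
    ContinuousAt.comp (f := c) (h.continuousAt_symm ht) hc.continuousAt
  have h1 : ∀ᶠ t in 𝓝 (0 : ℝ), c t ∈ h.target ∧ h.symm (c t) ∈ O :=
    (hc.continuousAt.eventually_mem (h.open_target.mem_nhds ht)).and
      (hcs.eventually_mem (by rw [h0]; exact hO))
  refine (infinite_of_mem_nhds (0 : ℝ) h1) ?_
  refine Set.Finite.of_finite_image (f := fun t => h.symm (c t)) (hfin.subset ?_) ?_
  · rintro _ ⟨t, ⟨h2, h3⟩, rfl⟩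
    exact ⟨h3, congrArg Prod.fst (h.right_inv h2)⟩
  · intro s hs' t ht' hst
    have e1 : c s = c t := by
      rw [← h.right_inv hs'.1, ← h.right_inv ht'.1]
      exact congrArg h hst
    have e2 : s • v = t • v := congrArg (fun z => (z.2 : EuclideanSpace ℝ (Fin m))) e1
    exact smul_left_injective ℝ hv0 e2

variable {M N : Type*} [TopologicalSpace M] [ChartedSpace (EuclideanSpace ℝ (Fin m)) M]
  [IsManifold (𝓡 m) ∞ M] [TopologicalSpace N] [ChartedSpace (EuclideanSpace ℝ (Fin n)) N]
  [IsManifold (𝓡 n) ∞ N]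

theorem chartAt_localDiffeomorphAt (x y : N) (hy : y ∈ (chartAt (EuclideanSpace ℝ (Fin n)) x).source) :
    IsLocalDiffeomorphAt (𝓡 n) (𝓡 n) ∞ (chartAt (EuclideanSpace ℝ (Fin n)) x) y := by
  let c : OpenPartialHomeomorph N (EuclideanSpace ℝ (Fin n)) := chartAt _ x
  exact ⟨⟨c.toPartialEquiv, c.open_source, c.open_target, contMDiffOn_chart,
    contMDiffOn_chart_symm⟩, hy, fun _ _ => rfl⟩

/-- The coordinate expression of a smooth map. -/
theorem exists_coordinates {f : M → N} (hf : ContMDiff (𝓡 m) (𝓡 n) ∞ f) (x : M) :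
    ∃ (F : EuclideanSpace ℝ (Fin m) → EuclideanSpace ℝ (Fin n)) (U : Set (EuclideanSpace ℝ (Fin m))),
      IsOpen U ∧ ContDiffOn ℝ ∞ F U ∧ chartAt (EuclideanSpace ℝ (Fin m)) x x ∈ U ∧
      (∀ v, mfderiv (𝓡 m) (𝓡 n) f x v = fderiv ℝ F (chartAt (EuclideanSpace ℝ (Fin m)) x x) v) ∧
      ∀ y ∈ (chartAt (EuclideanSpace ℝ (Fin m)) x).source,
        F (chartAt (EuclideanSpace ℝ (Fin m)) x y) =
          chartAt (EuclideanSpace ℝ (Fin n)) (f x) (f y) := by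
  refine ⟨writtenInExtChartAt (𝓡 m) (𝓡 n) x f, _, ?_, (contMDiff_iff.1 hf).2 x (f x), ?_, ?_, ?_⟩
  · refine (continuousOn_extChartAt_symm x).isOpen_inter_preimage (isOpen_extChartAt_target x) ?_
    exact (isOpen_extChartAt_source (f x)).preimage hf.continuous
  · refine ⟨mem_extChartAt_target x, ?_⟩
    change f ((extChartAt (𝓡 m) x).symm (extChartAt (𝓡 m) x x)) ∈ (extChartAt (𝓡 n) (f x)).source
    rw [extChartAt_to_inv]
    exact mem_extChartAt_source (f x)
  · intro v
    refine (DFunLike.congr_fun (hf.mdifferentiable (by simp) x).mfderiv v).trans ?_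
    change fderivWithin ℝ (writtenInExtChartAt (𝓡 m) (𝓡 n) x f) (range (𝓡 m)) _ v = _
    rw [ModelWithCorners.range_eq_univ, fderivWithin_univ]
    rfl
  · intro y hy
    change chartAt (EuclideanSpace ℝ (Fin n)) (f x) (f ((chartAt _ x).symm (chartAt _ x y))) = _
    rw [(chartAt (EuclideanSpace ℝ (Fin m)) x).left_inv hy]

theorem dim_le_of_surjective_mfderiv {f : M → N} (hf : ContMDiff (𝓡 m) (𝓡 n) ∞ f) (x : M)
    (hs : Function.Surjective (mfderiv (𝓡 m) (𝓡 n) f x)) : n ≤ m := by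
  obtain ⟨F, U, -, -, -, hd, -⟩ := exists_coordinates hf x
  have hs' : Function.Surjective
      (fderiv ℝ F (chartAt (EuclideanSpace ℝ (Fin m)) x x)).toLinearMap := fun w => by
    obtain ⟨v, hv⟩ := hs w
    exact ⟨v, (hd v).symm.trans hv⟩
  simpa using LinearMap.finrank_le_finrank_of_surjective hs'

theorem dim_le_of_finite_fiber {f : M → N} (hf : ContMDiff (𝓡 m) (𝓡 n) ∞ f) (x : M)
    (hs : Function.Surjective (mfderiv (𝓡 m) (𝓡 n) f x)) {O : Set M} (hO : O ∈ 𝓝 x)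
    (hfin : (O ∩ f ⁻¹' {f x}).Finite) : m ≤ n := by
  obtain ⟨F, U, hU, hF, hx, hd, hfF⟩ := exists_coordinates hf x
  let c : OpenPartialHomeomorph M (EuclideanSpace ℝ (Fin m)) := chartAt _ x
  let d : OpenPartialHomeomorph N (EuclideanSpace ℝ (Fin n)) := chartAt _ (f x)
  have hxc : x ∈ c.source := mem_chart_source _ x
  have hs' : Function.Surjective (fderiv ℝ F (c x)) := fun w => by
    obtain ⟨v, hv⟩ := hs w
    exact ⟨v, (hd v).symm.trans hv⟩
  have hO' : c.symm ⁻¹' (O ∩ f ⁻¹' d.source) ∩ c.target ∈ 𝓝 (c x) := by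
    refine inter_mem ?_ (c.open_target.mem_nhds (c.map_source hxc))
    refine (c.continuousAt_symm (c.map_source hxc)).preimage_mem_nhds ?_
    rw [c.left_inv hxc]
    exact inter_mem hO (hf.continuous.continuousAt.preimage_mem_nhds
      (d.open_source.mem_nhds (mem_chart_source _ _)))
  refine le_of_surjective_fderiv (hF.contDiffAt (hU.mem_nhds hx)) hs' hO' ?_
  refine (hfin.image c).subset ?_
  rintro z ⟨⟨⟨h1, h2⟩, h3⟩, h4⟩
  refine ⟨c.symm z, ⟨h1, ?_⟩, c.right_inv h3⟩
  have e1 := hfF _ (c.map_target h3)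
  have e2 := hfF x hxc
  have e3 : c (c.symm z) = z := c.right_inv h3
  have h4 : F z = F (c x) := h4
  refine d.injOn h2 (mem_chart_source _ _) ?_
  exact e1.symm.trans ((congrArg F e3).trans (h4.trans e2))

end InverseFunction

theorem localDiffeomorphAt_of_surjective_mfderiv {n : ℕ} {M N : Type*} [TopologicalSpace M]
    [ChartedSpace (EuclideanSpace ℝ (Fin n)) M] [IsManifold (𝓡 n) ∞ M] [TopologicalSpace N]
    [ChartedSpace (EuclideanSpace ℝ (Fin n)) N] [IsManifold (𝓡 n) ∞ N] {f : M → N}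
    (hf : ContMDiff (𝓡 n) (𝓡 n) ∞ f) (x : M)
    (hs : Function.Surjective (mfderiv (𝓡 n) (𝓡 n) f x)) :
    IsLocalDiffeomorphAt (𝓡 n) (𝓡 n) ∞ f x := by
  obtain ⟨F, U, hU, hF, hx, hd, hfF⟩ := exists_coordinates hf x
  have hs' : Function.Surjective (fderiv ℝ F (chartAt (EuclideanSpace ℝ (Fin n)) x x)) := fun w => by
    obtain ⟨v, hv⟩ := hs w
    exact ⟨v, (hd v).symm.trans hv⟩
  have h1 := localDiffeomorphAt_of_surjective_fderiv hU hF hx hs'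
  have h2 := (chartAt_localDiffeomorphAt x x (mem_chart_source _ x)).comp (𝓡 n) _ h1
  refine localDiffeomorphAt_of_comp_left hf.continuous.continuousAt
    (chartAt_localDiffeomorphAt (f x) (f x) (mem_chart_source _ _))
    (localDiffeomorphAt_congr h2 ?_)
  filter_upwards [(chartAt (EuclideanSpace ℝ (Fin n)) x).open_source.mem_nhds
    (mem_chart_source _ x)] with y hy using hfF y hy

/-! ### Unit weak equivalences of atlas groupoids are the lifts of the identity. -/

section Groupoids

variable {Q : Type u} [TopologicalSpace Q] {Q' : Type u} [TopologicalSpace Q']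
  {Q'' : Type u} [TopologicalSpace Q'']
  {S T : OrbStr Q} {S' : OrbStr Q'} {S'' : OrbStr Q''}

namespace GermHom

variable {𝒱 : AtlasRep S} {𝒱' : AtlasRep S'} {𝒱'' : AtlasRep S''}

/-- The image of a unit is idempotent, and cancellation shows that an idempotent arrow is a unit. -/
theorem arr_one (φ : GermHom 𝒱 𝒱') (x : 𝒱.Base) : φ.arr (germOne x) = germOne (φ.obj x) := by
  have e1 : germMul ⟨((germOne x : 𝒱.Ψ.Germ), germOne x), rfl⟩ = germOne x :=
    𝒱.Ψ.groupoid.one_mul (germOne x : 𝒱.Ψ.Germ)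
  have e2 := φ.arr_mul (germOne x) (germOne x) rfl
  rw [e1] at e2
  have e3 : germMul ⟨((germOne (tgt (φ.arr (germOne x))) : 𝒱'.Ψ.Germ), φ.arr (germOne x)), rfl⟩ =
      φ.arr (germOne x) := 𝒱'.Ψ.groupoid.one_mul (φ.arr (germOne x))
  have e4 := germMul_right_cancel rfl (e2.symm.trans e3.symm)
  rw [e4, φ.tgt_arr, tgt_germOne]

theorem arr_inv (φ : GermHom 𝒱 𝒱') (γ : 𝒱.Ψ.Germ) : φ.arr (germInv γ) = germInv (φ.arr γ) := by
  have e1 : germMul ⟨(germInv γ, γ), src_germInv γ⟩ = germOne (src γ) := 𝒱.Ψ.groupoid.inv_mul γ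
  have e2 := φ.arr_mul (germInv γ) γ (src_germInv γ)
  have e3 : germMul ⟨(germInv (φ.arr γ), φ.arr γ), src_germInv _⟩ = germOne (src (φ.arr γ)) :=
    𝒱'.Ψ.groupoid.inv_mul (φ.arr γ)
  rw [e1, φ.arr_one] at e2
  rw [φ.src_arr] at e3
  exact germMul_right_cancel rfl (e2.symm.trans e3.symm)

theorem smooth_arr (φ : GermHom 𝒱 𝒱') : ContMDiff (𝓡 S.n) (𝓡 S'.n) ∞ φ.arr := by
  refine contMDiff_of_comp_isLocalDiffeomorph isLocalDiffeomorph_src φ.continuous_arr ?_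
  rw [show src ∘ φ.arr = φ.obj ∘ src from funext φ.src_arr]
  exact φ.smooth_obj.comp isLocalDiffeomorph_src.contMDiff

/-- The homomorphism of Lie groupoids given by a continuous map of germs. -/
def toHom (φ : GermHom 𝒱 𝒱') : MarkedLieGroupoid.Hom 𝒱.Γ 𝒱'.Γ where
  obj := φ.obj
  arr := φ.arr
  map_s := φ.src_arr
  map_t := φ.tgt_arr
  map_mul p := φ.arr_mul p.1.1 p.1.2 p.2
  map_one := φ.arr_one
  map_inv := φ.arr_inv
  smooth_obj := φ.smooth_obj
  smooth_arr := φ.smooth_arr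

/-- The continuous map of germs given by a homomorphism of Lie groupoids. -/
def ofHom (φ : MarkedLieGroupoid.Hom 𝒱.Γ 𝒱'.Γ) : GermHom 𝒱 𝒱' where
  obj := φ.obj
  arr := φ.arr
  smooth_obj := φ.smooth_obj
  continuous_arr := φ.smooth_arr.continuous
  src_arr := φ.map_s
  tgt_arr := φ.map_t
  arr_mul γ δ h := φ.map_mul ⟨(γ, δ), h⟩

theorem toHom_injective {φ ψ : GermHom 𝒱 𝒱'} (h : φ.toHom = ψ.toHom) : φ = ψ :=
  congrArg ofHom h

end GermHom

namespace AtlasRep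

theorem mark_pr (𝒱 : AtlasRep S) (x : 𝒱.Base) : 𝒱.Γ.mark (𝒱.Γ.pr x) = 𝒱.π x := rfl

theorem mark_symm_π (𝒱 : AtlasRep S) (x : 𝒱.Base) : 𝒱.Γ.mark.symm (𝒱.π x) = 𝒱.Γ.pr x := by
  rw [← mark_pr, Homeomorph.symm_apply_apply]

end AtlasRep

theorem mark_orbitMap {𝒱 : AtlasRep S} {𝒱' : AtlasRep S'} (φ : MarkedLieGroupoid.Hom 𝒱.Γ 𝒱'.Γ)
    (x : 𝒱.Base) : 𝒱'.Γ.mark (φ.orbitMap (𝒱.Γ.mark.symm (𝒱.π x))) =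
      𝒱'.π ((GermHom.ofHom φ).obj x) := by
  rw [AtlasRep.mark_symm_π]
  rfl

-- The structures T and S on Q are deliberately independent: a groupoid intervening in a unit Morita
-- equivalence may come from any orbifold structure on the same space.
open MarkedLieGroupoid in
theorem unitWeakEquivalence_π {𝒲 : AtlasRep T} {𝒱 : AtlasRep S} {ε : Hom 𝒲.Γ 𝒱.Γ}
    (h : IsUnitWeakEquivalence ε) (x : 𝒲.Base) : 𝒱.π ((GermHom.ofHom ε).obj x) = 𝒲.π x := by
  rw [← mark_orbitMap]
  exact h.2 _

/-- Germs close to a unit are germs of the identity. Hence source and target have the same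
differential at units. -/
theorem eventually_src_eq_tgt {n : ℕ} {M : Type u} [TopologicalSpace M]
    [ChartedSpace (EuclideanSpace ℝ (Fin n)) M] {P : FullPseudogroup n M} (x : M) :
    (src : P.Germ → M) =ᶠ[𝓝 (germOne x)] tgt := by
  have h1 : ∀ᶠ y in 𝓝 (src (germOne x : P.Germ)), app (germOne x : P.Germ) =ᶠ[𝓝 y] _root_.id :=
    (app_germOne x).eventuallyEq_nhds
  filter_upwards [(continuousAt_germ_iff.1 (continuousAt_id (x := (germOne x : P.Germ)))).2,
    continuous_src.continuousAt.eventually h1] with γ h2 h3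
  rw [← app_src γ]
  exact (h2.self_of_nhds.trans h3.self_of_nhds).symm

-- At the unit over ε(x), the submersion condition yields a and b with dε(b) = ds(a) and dt(a) = w;
-- there ds = dt, so dε(b) = w.
open MarkedLieGroupoid in
theorem unitWeakEquivalence_surjective {𝒲 : AtlasRep T} {𝒱 : AtlasRep S} {ε : Hom 𝒲.Γ 𝒱.Γ}
    (h : IsUnitWeakEquivalence ε) (x : 𝒲.Base) :
    Function.Surjective (mfderiv (𝓡 T.n) (𝓡 S.n) (GermHom.ofHom ε).obj x) := by
  intro w
  obtain ⟨a, b, h1, h2⟩ := h.1.submersion (germOne (P := 𝒱.Ψ) ((GermHom.ofHom ε).obj x)) x rfl w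
  have e : mfderiv (𝓡 S.n) (𝓡 S.n) (src : 𝒱.Ψ.Germ → 𝒱.Base)
      (germOne ((GermHom.ofHom ε).obj x)) = mfderiv (𝓡 S.n) (𝓡 S.n) (tgt : 𝒱.Ψ.Germ → 𝒱.Base)
      (germOne ((GermHom.ofHom ε).obj x)) := (eventually_src_eq_tgt _).mfderiv_eq
  refine ⟨b, h1.symm.trans ?_⟩
  exact (DFunLike.congr_fun e a).trans h2

/-- Within a single chart, a fiber of π is an orbit of the finite group of that chart. -/
theorem AtlasRep.finite_fiber (𝒱 : AtlasRep S) (x : 𝒱.Base) :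
    ∃ O ∈ 𝓝 x, (O ∩ 𝒱.π ⁻¹' {𝒱.π x}).Finite := by
  obtain ⟨i, v⟩ := x
  refine ⟨range (𝒱.incl i), (𝒱.incl_isOpenEmbedding i).isOpen_range.mem_nhds ⟨v, rfl⟩, ?_⟩
  have := (𝒱.chart i).finite_G
  refine (Set.finite_range fun g : (𝒱.chart i).G => 𝒱.incl i (g.1 v)).subset ?_
  rintro _ ⟨⟨w, rfl⟩, hw⟩
  obtain ⟨g, hg, rfl⟩ := ((𝒱.chart i).φ_eq_iff v w).1 (Eq.symm hw)
  exact ⟨⟨g, hg⟩, rfl⟩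

-- Surjectivity of the differential gives S.n ≤ T.n. Conversely, fibers of ε lie in fibers of π,
-- which are locally finite, and a submersion with a locally finite fiber cannot lower the
-- dimension.
open MarkedLieGroupoid in
theorem dim_eq_of_unitWeakEquivalence {𝒲 : AtlasRep T} {𝒱 : AtlasRep S} {ε : Hom 𝒲.Γ 𝒱.Γ}
    (h : IsUnitWeakEquivalence ε) (x : 𝒲.Base) : T.n = S.n := by
  have hs := unitWeakEquivalence_surjective h x
  obtain ⟨O, hO, hfin⟩ := 𝒲.finite_fiber x
  refine le_antisymm (dim_le_of_finite_fiber (GermHom.ofHom ε).smooth_obj x hs hO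
    (hfin.subset ?_)) (dim_le_of_surjective_mfderiv (GermHom.ofHom ε).smooth_obj x hs)
  rintro y ⟨hy, hy'⟩
  refine ⟨hy, ?_⟩
  have hy' : (GermHom.ofHom ε).obj y = (GermHom.ofHom ε).obj x := hy'
  change 𝒲.π y = 𝒲.π x
  rw [← unitWeakEquivalence_π h, hy', unitWeakEquivalence_π h]

/-- The orbifold structure consists of the charts which are compatible with a representative. -/
theorem AtlasRep.mem_charts_iff (𝒱 : AtlasRep S) (c : OrbChart Q S.n) : c ∈ S.charts ↔
    ∀ (x : c.V) (y : 𝒱.Base), c.φ x = 𝒱.π y → ∃ h : c.V → 𝒱.Base, h x = y ∧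
      IsLocalDiffeomorphAt (𝓡 S.n) (𝓡 S.n) ∞ h x ∧ ∀ᶠ z in 𝓝 x, 𝒱.π (h z) = c.φ z := by
  constructor
  · rintro hc x ⟨j, y⟩ hxy
    obtain ⟨k, rfl, hk, he⟩ := OrbChart.compatible_iff.1
      (S.maximal.prop.compatible _ hc _ (𝒱.mem j)) x y hxy
    exact ⟨𝒱.incl j ∘ k, rfl, hk.comp (𝓡 S.n) _ (𝒱.incl_localDiffeomorph j _), he⟩
  · intro h
    refine OrbStr.mem_charts_of c fun x => ?_
    obtain ⟨⟨j, y⟩, hy⟩ := 𝒱.surjective_π (c.φ x)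
    obtain ⟨k, hkx, hk, he⟩ := h x ⟨j, y⟩ hy.symm
    obtain ⟨l, hl, hlx, -, hlr⟩ := exists_localInverse (𝒱.incl_localDiffeomorph j y)
    have hl' : IsLocalDiffeomorphAt (𝓡 S.n) (𝓡 S.n) ∞ l (k x) := by rw [hkx]; exact hl
    have ht : Tendsto k (𝓝 x) (𝓝 (𝒱.incl j y)) := by
      have := hk.contMDiffAt.continuousAt
      rw [ContinuousAt, hkx] at this
      exact this
    refine ⟨_, 𝒱.mem j, l ∘ k, hk.comp (𝓡 S.n) _ hl', ?_⟩
    filter_upwards [he, ht.eventually hlr] with z h1 h2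
    rw [← h1]
    exact congrArg 𝒱.π h2

theorem AtlasRep.isChartOf_iff (𝒱 : AtlasRep S) (c : OrbChart Q S.n) :
    IsChartOf 𝒱.Γ c ↔ c ∈ S.charts := by
  rw [𝒱.mem_charts_iff]
  change (∀ (x : c.V) (y : 𝒱.Base), c.φ x = 𝒱.π y →
    ∃ h : PartialDiffeomorph (𝓡 S.n) (𝓡 S.n) c.V 𝒱.Base ∞, x ∈ h.source ∧ h x = y ∧
      ∀ z ∈ h.source, 𝒱.π (h z) = c.φ z) ↔ _
  constructor
  · intro H x y hxy
    obtain ⟨h, hx, hy, he⟩ := H x y hxy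
    exact ⟨h, hy, h.isLocalDiffeomorphAt _ _ _ hx, mem_of_superset (h.open_source.mem_nhds hx) he⟩
  · intro H x y hxy
    obtain ⟨h, hy, hx, he⟩ := H x y hxy
    obtain ⟨Φ, h1, h2, h3⟩ := exists_partial hx he
    exact ⟨Φ, h1, (h3 x h1).trans hy, fun z hz => (congrArg 𝒱.π (h3 z hz)).trans (h2 hz)⟩

theorem OrbStr.eq_of_le {n : ℕ} {C D : Set (OrbChart Q n)} {hC : Maximal IsOrbAtlas C}
    {hD : Maximal IsOrbAtlas D} (h : C ⊆ D) : (⟨n, C, hC⟩ : OrbStr Q) = ⟨n, D, hD⟩ := by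
  obtain rfl : C = D := hC.eq_of_subset hD.prop h
  rfl

/-- A unit weak equivalence between nonempty marked atlas groupoids determines the orbifold
structure. -/
theorem orbStr_eq_of_unitWeakEquivalence [Nonempty Q] {𝒲 : AtlasRep T} {𝒱 : AtlasRep S}
    {ε : MarkedLieGroupoid.Hom 𝒲.Γ 𝒱.Γ} (h : MarkedLieGroupoid.IsUnitWeakEquivalence ε) :
    T = S := by
  -- A point is needed to compare dimensions: the dimension of a structure on the empty space is
  -- arbitrary.
  obtain ⟨x₀, -⟩ := 𝒲.surjective_π (Classical.arbitrary Q)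
  have hn := dim_eq_of_unitWeakEquivalence h x₀
  obtain ⟨n, C, hC⟩ := T
  obtain ⟨m, D, hD⟩ := S
  obtain rfl : n = m := hn
  refine OrbStr.eq_of_le fun c hc => ?_
  refine (𝒱.mem_charts_iff c).2 fun x y hxy => ?_
  obtain ⟨w, hw⟩ := 𝒲.surjective_π (c.φ x)
  obtain ⟨k, rfl, hk, he⟩ := (𝒲.mem_charts_iff c).1 hc x w hw.symm
  have hl := localDiffeomorphAt_of_surjective_mfderiv (GermHom.ofHom ε).smooth_obj (k x)
    (unitWeakEquivalence_surjective h (k x))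
  have hy : 𝒱.π ((GermHom.ofHom ε).obj (k x)) = 𝒱.π y := by
    rw [unitWeakEquivalence_π h, hw, hxy]
  -- Composing a local map from c to 𝒲 with ε reaches some point over c.φ x; a local diffeomorphism
  -- of 𝒱 over Q moves it to the prescribed point y.
  obtain ⟨f, hfy, hf, hfe⟩ := AtlasRep.exists_local 𝒱 𝒱 hy
  have hc := hk.comp (𝓡 n) _ hl
  refine ⟨fun z => f ((GermHom.ofHom ε).obj (k z)), hfy, hc.comp (𝓡 n) _ hf, ?_⟩
  filter_upwards [he, hc.contMDiffAt.continuousAt.eventually hfe] with z h1 h2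
  exact h2.trans ((unitWeakEquivalence_π h _).trans h1)

theorem isLift_of_unitWeakEquivalence {𝒲 𝒱 : AtlasRep S} {ε : MarkedLieGroupoid.Hom 𝒲.Γ 𝒱.Γ}
    (h : MarkedLieGroupoid.IsUnitWeakEquivalence ε) : (GermHom.ofHom ε).IsLift :=
  ⟨fun x => localDiffeomorphAt_of_surjective_mfderiv (GermHom.ofHom ε).smooth_obj x
    (unitWeakEquivalence_surjective h x), unitWeakEquivalence_π h⟩

theorem surjective_mfderiv_of_localDiffeomorphAt {n : ℕ} {M N : Type*} [TopologicalSpace M]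
    [ChartedSpace (EuclideanSpace ℝ (Fin n)) M] [IsManifold (𝓡 n) ∞ M] [TopologicalSpace N]
    [ChartedSpace (EuclideanSpace ℝ (Fin n)) N] [IsManifold (𝓡 n) ∞ N] {f : M → N} {x : M}
    (hf : IsLocalDiffeomorphAt (𝓡 n) (𝓡 n) ∞ f x) :
    Function.Surjective (mfderiv (𝓡 n) (𝓡 n) f x) :=
  (hf.mfderivToContinuousLinearEquiv (by simp)).surjective

theorem GermHom.IsLift.unitWeakEquivalence {𝒲 𝒱 : AtlasRep S} {ε : GermHom 𝒲 𝒱} (h : ε.IsLift) :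
    MarkedLieGroupoid.IsUnitWeakEquivalence ε.toHom := by
  refine ⟨⟨fun y => ?_, fun γ x hx w => ?_, fun x y γ hx hy => ?_, fun d U c h1 h2 h3 => ?_⟩, ?_⟩
  · obtain ⟨x, hx⟩ := 𝒲.surjective_π (𝒱.π y)
    obtain ⟨f, hf, hfx, hy⟩ := 𝒱.exists_transition ((h.π_obj x).trans hx)
    exact ⟨germ f hf _ hfx, x, rfl, hy⟩
  -- The target map is a local diffeomorphism, so a is determined by w alone. Then b exists because
  -- the differential of ε is also onto.
  · obtain ⟨a, ha⟩ := surjective_mfderiv_of_localDiffeomorphAt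
      (isLocalDiffeomorph_tgt (P := 𝒱.Ψ) γ) w
    obtain ⟨b, hb⟩ := surjective_mfderiv_of_localDiffeomorphAt (h.localDiffeomorph x)
      (mfderiv (𝓡 S.n) (𝓡 S.n) (src : 𝒱.Ψ.Germ → 𝒱.Base) γ a)
    exact ⟨a, b, hb.symm, ha⟩
  · obtain ⟨δ, hδx, hδy, hδ⟩ := h.full (δ := γ) hx hy
    refine ⟨δ, ⟨hδx, hδy, hδ⟩, ?_⟩
    rintro δ' ⟨hx', hy', hδ'⟩
    exact h.faithful (Eq.trans hx' hδx.symm) (Eq.trans hy' hδy.symm) (Eq.trans hδ' hδ.symm)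
  · exact contMDiff_of_comp_isLocalDiffeomorph (n := S.n) (A := 𝒲.Ψ.Germ) (M := 𝒲.Base)
      isLocalDiffeomorph_src
      (h.continuous_of_comp h1.continuous h2.continuous h3.continuous) h1
  · intro q
    obtain ⟨x, rfl⟩ := 𝒲.surjective_π q
    rw [mark_orbitMap]
    exact h.π_obj x

theorem unitWeakEquivalence_iff {𝒲 𝒱 : AtlasRep S} (ε : MarkedLieGroupoid.Hom 𝒲.Γ 𝒱.Γ) :
    MarkedLieGroupoid.IsUnitWeakEquivalence ε ↔ (GermHom.ofHom ε).IsLift :=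
  ⟨isLift_of_unitWeakEquivalence, GermHom.IsLift.unitWeakEquivalence (ε := GermHom.ofHom ε)⟩

/-- Over a nonempty Q, the intermediate structures are forced to be S and S'; Q' is nonempty too,
since a homomorphism maps into it. Over the empty space nothing is forced, but there all
homomorphisms are equivalent. -/
theorem unitMoritaEquiv_iff [T2Space Q] [SecondCountableTopology Q] [T2Space Q']
    [SecondCountableTopology Q'] {𝒱₁ 𝒱₂ : AtlasRep S} {𝒱₁' 𝒱₂' : AtlasRep S'}
    (φ₁ : MarkedLieGroupoid.Hom 𝒱₁.Γ 𝒱₁'.Γ) (φ₂ : MarkedLieGroupoid.Hom 𝒱₂.Γ 𝒱₂'.Γ) :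
    UnitMoritaEquiv φ₁ φ₂ ↔ GermHom.HEquiv (GermHom.ofHom φ₁) (GermHom.ofHom φ₂) := by
  constructor
  · rintro ⟨G, H, χ, ε₁, ε₂, δ₁, δ₂, ⟨-, -, T, 𝒲, rfl⟩, ⟨-, -, T', 𝒲', rfl⟩, h₁, h₂, k₁, k₂, e₁, e₂⟩
    rcases isEmpty_or_nonempty Q with hQ | hQ
    · exact GermHom.HEquiv.of_isEmpty _ _
    · have hQ' : Nonempty Q' := by
        obtain ⟨x, -⟩ := 𝒲.surjective_π (Classical.arbitrary Q)
        exact ⟨𝒲'.π ((GermHom.ofHom χ).obj x)⟩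
      obtain rfl := orbStr_eq_of_unitWeakEquivalence h₁
      obtain rfl := orbStr_eq_of_unitWeakEquivalence k₁
      exact ⟨𝒲, 𝒲', GermHom.ofHom χ, GermHom.ofHom ε₁, GermHom.ofHom ε₂, GermHom.ofHom δ₁,
        GermHom.ofHom δ₂, isLift_of_unitWeakEquivalence h₁, isLift_of_unitWeakEquivalence h₂,
        isLift_of_unitWeakEquivalence k₁, isLift_of_unitWeakEquivalence k₂,
        congrArg GermHom.ofHom e₁, congrArg GermHom.ofHom e₂⟩
  · rintro ⟨𝒲, 𝒲', χ, ε₁, ε₂, δ₁, δ₂, h₁, h₂, k₁, k₂, e₁, e₂⟩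
    exact ⟨𝒲.Γ, 𝒲'.Γ, χ.toHom, ε₁.toHom, ε₂.toHom, δ₁.toHom, δ₂.toHom,
      ⟨inferInstance, inferInstance, S, 𝒲, rfl⟩, ⟨inferInstance, inferInstance, S', 𝒲', rfl⟩,
      h₁.unitWeakEquivalence, h₂.unitWeakEquivalence, k₁.unitWeakEquivalence,
      k₂.unitWeakEquivalence, congrArg GermHom.toHom e₁, congrArg GermHom.toHom e₂⟩

end Groupoids

theorem FullPseudogroup.eventually_germ_eq {n : ℕ} {M : Type u} [TopologicalSpace M]
    [ChartedSpace (EuclideanSpace ℝ (Fin n)) M] {P : FullPseudogroup n M} (f : Transition n M)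
    (hf : f ∈ P.carrier) (x : M) (hx : x ∈ f.source) :
    ∀ᶠ γ in 𝓝 (germ f hf x hx : P.Germ), ∃ h : src γ ∈ f.source, γ = germ f hf (src γ) h :=
  eventually_sec continuous_id (germ f hf x hx) (f := ⟨f, hf⟩) (x := ⟨x, hx⟩) rfl

/-! ### Charted orbifold maps correspond to homomorphisms of germ groupoids. -/

section Charted

variable {Q : Type u} [TopologicalSpace Q] {Q' : Type u} [TopologicalSpace Q']
  {Q'' : Type u} [TopologicalSpace Q'']
  {S : OrbStr Q} {S' : OrbStr Q'} {S'' : OrbStr Q''}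
  {𝒱 𝒲 : AtlasRep S} {𝒱' : AtlasRep S'} {𝒱'' : AtlasRep S''}

namespace OrbRep

theorem π_ψ (f : OrbRep 𝒱 𝒱') (x : 𝒱.Base) : 𝒱'.π (f.ψ x) = f.f (𝒱.π x) := f.φ_lift x.1 x.2

theorem smooth_ψ (f : OrbRep 𝒱 𝒱') : ContMDiff (𝓡 S.n) (𝓡 S'.n) ∞ f.ψ := by
  rintro ⟨i, v⟩
  obtain ⟨l, hl, hlv, -, hr⟩ := exists_localInverse (𝒱.incl_localDiffeomorph i v)
  have h1 : ContMDiff (𝓡 S.n) (𝓡 S'.n) ∞ (𝒱'.incl (f.tgt i) ∘ f.lift i) :=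
    (𝒱'.incl_localDiffeomorph _).contMDiff.comp (f.smooth_lift i)
  refine ((h1 _).comp _ hl.contMDiffAt).congr_of_eventuallyEq ?_
  filter_upwards [hr] with y hy
  exact (congrArg f.ψ hy).symm

/-- Every germ is the germ of an element of `P`. -/
theorem exists_mem_P (f : OrbRep 𝒱 𝒱') (γ : 𝒱.Ψ.Germ) : ∃ (l : f.P) (h : src γ ∈ l.1.source),
    γ = germ l.1 (f.generates.1 l.2) (src γ) h := by
  induction γ using Germ.ind with
  | h k hk x hx =>
    obtain ⟨l, hl, hxl, e⟩ := f.generates.2 k hk x hx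
    exact ⟨⟨l, hl⟩, hxl, germ_eq_iff.2 ⟨rfl, e⟩⟩

/-- The action of an orbifold map on germs. -/
def arr (f : OrbRep 𝒱 𝒱') (γ : 𝒱.Ψ.Germ) : 𝒱'.Ψ.Germ :=
  germ (f.ν (f.exists_mem_P γ).choose) (f.ν_mem _) (f.ψ (src γ))
    (f.ν_lift _ _ (f.exists_mem_P γ).choose_spec.choose).1

/-- The representative in P was chosen arbitrarily; `ν_germ` removes the dependence on it. -/
theorem arr_germ (f : OrbRep 𝒱 𝒱') (l : f.P) (x : 𝒱.Base) (hx : x ∈ l.1.source) :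
    f.arr (germ l.1 (f.generates.1 l.2) x hx) =
      germ (f.ν l) (f.ν_mem l) (f.ψ x) (f.ν_lift l x hx).1 := by
  have h := f.exists_mem_P (germ l.1 (f.generates.1 l.2) x hx)
  have e := germ_eq_iff.1 h.choose_spec.choose_spec
  exact germ_eq_iff.2 ⟨rfl, f.ν_germ _ l x h.choose_spec.choose hx (e.2.mono fun _ => Eq.symm)⟩

theorem src_arr (f : OrbRep 𝒱 𝒱') (γ : 𝒱.Ψ.Germ) : src (f.arr γ) = f.ψ (src γ) := rfl

theorem tgt_arr (f : OrbRep 𝒱 𝒱') (γ : 𝒱.Ψ.Germ) :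
    FullPseudogroup.tgt (f.arr γ) = f.ψ (FullPseudogroup.tgt γ) := by
  obtain ⟨l, h, e⟩ := f.exists_mem_P γ
  rw [e, f.arr_germ]
  exact (f.ν_lift l _ h).2.symm

/-- Near γ all germs are germs of one l in P, so all of their images are germs of the one transition
ν(l). -/
theorem continuous_arr (f : OrbRep 𝒱 𝒱') : Continuous f.arr := by
  rw [continuous_iff_continuousAt]
  intro γ
  have hs : Continuous fun δ : 𝒱.Ψ.Germ => f.ψ (src δ) :=
    f.smooth_ψ.continuous.comp continuous_src
  refine continuousAt_germ_iff.2 ⟨hs.continuousAt, ?_⟩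
  obtain ⟨l, h, e⟩ := f.exists_mem_P γ
  have h1 := eventually_germ_eq l.1 (f.generates.1 l.2) (src γ) h
  rw [← e] at h1
  have h2 := app_germ (f.ν l) (f.ν_mem l) (f.ψ (src γ)) (f.ν_lift l _ h).1
  rw [← f.arr_germ l _ h, ← e] at h2
  filter_upwards [h1, hs.continuousAt.eventually h2.eventuallyEq_nhds] with δ h3 h4
  obtain ⟨hδ, eδ⟩ := h3
  refine EventuallyEq.trans ?_ h4.symm
  have h5 := app_germ (f.ν l) (f.ν_mem l) (f.ψ (src δ)) (f.ν_lift l _ hδ).1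
  rw [← f.arr_germ l _ hδ, ← eδ] at h5
  exact h5

/-- The homomorphism `F₁(f̂)`. -/
def toGermHom (f : OrbRep 𝒱 𝒱') : GermHom 𝒱 𝒱' where
  obj := f.ψ
  arr := f.arr
  smooth_obj := f.smooth_ψ
  continuous_arr := f.continuous_arr
  src_arr := f.src_arr
  tgt_arr := f.tgt_arr
  arr_mul γ δ h := by
    obtain ⟨l, hl, el⟩ := f.exists_mem_P γ
    obtain ⟨m, hm, em⟩ := f.exists_mem_P δ
    obtain ⟨k, hk, ek⟩ := f.exists_mem_P (germMul ⟨(γ, δ), h⟩)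
    generalize hx : src δ = x at *
    have ek' := ek
    simp only [src_germMul, hx] at ek' hk
    have htm : FullPseudogroup.tgt δ = m.1 x := by rw [em]; rfl
    have hy : src γ = m.1 x := h.trans htm
    simp only [hy] at el hl
    replace el : γ = germ l.1 (f.generates.1 l.2) (m.1 x) hl := el
    replace em : δ = germ m.1 (f.generates.1 m.2) x hm := em
    subst el em
    rw [ek', f.arr_germ k x hk]
    have e3 := germ_eq_iff.1 ((germMul_germ m.1 l.1 _ _ x (m.1 x) hm hl rfl).symm.trans ek')
    have e4 := f.ν_mul m l k x hm hl hk e3.2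
    have h5 := (f.ν_lift m x hm)
    have h6 := (f.ν_lift l (m.1 x) hl).1
    have e5 : f.arr (germ m.1 (f.generates.1 m.2) x hm) = _ := f.arr_germ m x hm
    have e6 : f.arr (germ l.1 (f.generates.1 l.2) (m.1 x) hl) = _ := f.arr_germ l _ hl
    refine (Eq.trans (germMul_congr e6 e5 _) ?_).symm
    have e7 := germMul_germ (P := 𝒱'.Ψ) (f.ν m) (f.ν l) (f.ν_mem m) (f.ν_mem l) (f.ψ x)
      (f.ψ (m.1 x)) h5.1 h6 h5.2
    exact e7.trans (germ_eq_iff.2 ⟨rfl, e4⟩)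

theorem induces_iff (f : OrbRep 𝒱 𝒱') (φ : MarkedLieGroupoid.Hom 𝒱.Γ 𝒱'.Γ) :
    f.Induces φ ↔ GermHom.ofHom φ = f.toGermHom := by
  constructor
  · rintro ⟨h1, h2⟩
    refine GermHom.ext (fun x => congrFun h1 x) fun γ => ?_
    obtain ⟨l, h, e⟩ := f.exists_mem_P γ
    rw [e]
    exact (h2 l _ h).trans (f.arr_germ l _ h).symm
  · intro h
    refine ⟨funext fun x => GermHom.obj_congr h x, fun l x hx => ?_⟩
    exact (GermHom.arr_congr h _).trans (f.arr_germ l x hx)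

/-- The relation remembers P and ν only through the action on germs. The map on Q is determined by
ψ, because π is onto. -/
theorem equiv_iff (f g : OrbRep 𝒱 𝒱') :
    (OrbRep.setoid 𝒱 𝒱').r f g ↔ f.toGermHom = g.toGermHom := by
  constructor
  · rintro ⟨-, h2, h3⟩
    refine GermHom.ext (fun x => congrFun h2 x) fun γ => ?_
    obtain ⟨l, hl, el⟩ := f.exists_mem_P γ
    obtain ⟨m, hm, em⟩ := g.exists_mem_P γ
    have e := h3 l m (src γ) hl hm (germ_eq_iff.1 (el.symm.trans em)).2
    change f.arr γ = g.arr γ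
    rw [show f.arr γ = _ from (congrArg f.arr el).trans (f.arr_germ l _ hl),
      show g.arr γ = _ from (congrArg g.arr em).trans (g.arr_germ m _ hm)]
    exact germ_eq_iff.2 ⟨congrFun h2 _, e⟩
  · intro h
    have hψ : f.ψ = g.ψ := funext fun x => GermHom.obj_congr h x
    refine ⟨funext fun q => ?_, hψ, fun l m x hl hm e => ?_⟩
    · obtain ⟨x, rfl⟩ := 𝒱.surjective_π q
      rw [← f.π_ψ, ← g.π_ψ, hψ]
    · have e1 := f.arr_germ l x hl
      have e2 := g.arr_germ m x hm
      have e3 : germ l.1 (f.generates.1 l.2) x hl = germ m.1 (g.generates.1 m.2) x hm :=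
        germ_eq_iff.2 ⟨rfl, e⟩
      have e4 := GermHom.arr_congr h (germ l.1 (f.generates.1 l.2) x hl)
      rw [e3] at e1 e4
      exact (germ_eq_iff.1 (e1.symm.trans ((congrArg f.arr e3.symm).trans
        ((GermHom.arr_congr h _).trans ((congrArg g.arr e3).trans e2))))).2

theorem isComp_iff (f : OrbRep 𝒱 𝒱') (g : OrbRep 𝒱' 𝒱'') (h : OrbRep 𝒱 𝒱'') :
    OrbRep.IsComp f g h ↔ h.toGermHom = g.toGermHom.comp f.toGermHom := by
  constructor
  · rintro ⟨-, h2, h3⟩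
    refine GermHom.ext (fun x => congrFun h2 x) fun γ => ?_
    obtain ⟨l, hl, el⟩ := h.exists_mem_P γ
    obtain ⟨m, hm, em⟩ := f.exists_mem_P γ
    obtain ⟨ξ, hξ, eξ⟩ := g.exists_mem_P (f.arr γ)
    have e0 : f.arr γ = _ := (congrArg f.arr em).trans (f.arr_germ m _ hm)
    have e := h3 l m ξ (src γ) hl hm hξ (germ_eq_iff.1 (el.symm.trans em)).2
      (germ_eq_iff.1 (eξ.symm.trans e0)).2
    change h.arr γ = g.arr (f.arr γ)
    rw [show h.arr γ = _ from (congrArg h.arr el).trans (h.arr_germ l _ hl),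
      show g.arr (f.arr γ) = _ from (congrArg g.arr eξ).trans (g.arr_germ ξ _ hξ)]
    exact germ_eq_iff.2 ⟨congrFun h2 _, e⟩
  · intro e
    have hψ : h.ψ = g.ψ ∘ f.ψ := funext fun x => GermHom.obj_congr e x
    refine ⟨funext fun q => ?_, hψ, fun l m ξ x hl hm hξ e1 e2 => ?_⟩
    · obtain ⟨x, rfl⟩ := 𝒱.surjective_π q
      rw [Function.comp, ← h.π_ψ, ← f.π_ψ, ← g.π_ψ, hψ]
      rfl
    · have k1 := h.arr_germ l x hl
      have k2 := f.arr_germ m x hm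
      have k3 := g.arr_germ ξ (f.ψ x) hξ
      have k4 : germ l.1 (h.generates.1 l.2) x hl = germ m.1 (f.generates.1 m.2) x hm :=
        germ_eq_iff.2 ⟨rfl, e1⟩
      have k5 : germ ξ.1 (g.generates.1 ξ.2) (f.ψ x) hξ =
        germ (f.ν m) (f.ν_mem m) (f.ψ x) (f.ν_lift m x hm).1 := germ_eq_iff.2 ⟨rfl, e2⟩
      have k6 := GermHom.arr_congr e (germ m.1 (f.generates.1 m.2) x hm)
      exact (germ_eq_iff.1 (k1.symm.trans ((congrArg h.arr k4).trans (k6.trans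
        ((congrArg g.arr (k2.trans k5.symm)).trans k3))))).2

end OrbRep

namespace GermHom

variable (φ : GermHom 𝒱 𝒱')

theorem exists_fun : ∃ f : Q → Q', ∀ x, f (𝒱.π x) = 𝒱'.π (φ.obj x) :=
  ⟨fun q => 𝒱'.π (φ.obj (𝒱.surjective_π q).choose),
    fun x => φ.π_obj_eq (𝒱.surjective_π (𝒱.π x)).choose_spec⟩

/-- A chart is connected, so its image lies in a single summand. -/
theorem exists_lift_chart (i : 𝒱.I) : ∃ (j : 𝒱'.I) (g : (𝒱.chart i).V → (𝒱'.chart j).V),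
    ∀ v, 𝒱'.incl j (g v) = φ.obj (𝒱.incl i v) := by
  obtain ⟨j, g, -, h⟩ := (φ.continuous_obj.comp
    (𝒱.incl_isOpenEmbedding i).continuous).exists_lift_sigma
  exact ⟨j, g, fun v => (congrFun h v).symm⟩

/-- The transitions on which a homomorphism is given by a single transition, whose domain underlies
an orbifold chart. -/
def quasi : Set (Transition S.n 𝒱.Base) :=
  {l | ∃ hl : l ∈ 𝒱.Ψ.carrier, (IsConnected l.source ∧ ∃ i j : 𝒱.I,
    l.source ⊆ range (Sigma.mk i) ∧ l.target ⊆ range (Sigma.mk j)) ∧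
    ∃ (k : Transition S'.n 𝒱'.Base) (hk : k ∈ 𝒱'.Ψ.carrier), 𝒱'.IsChartDomain k.source ∧
      ∀ x (hx : x ∈ l.source), ∃ h : φ.obj x ∈ k.source,
        φ.arr (germ l hl x hx) = germ k hk (φ.obj x) h}

/-- By continuity of the arrow map, the images of the germs of f at points near x are germs of a
single transition k₀. Its domain is cut down to a chart domain D, and then f is restricted to a
connected neighborhood of x that maps into D and has domain and range each inside one chart. -/
theorem quasi_generates : Generates φ.quasi 𝒱.Ψ.carrier := by
  refine ⟨fun l hl => hl.1, fun f hf x hx => ?_⟩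
  obtain ⟨k₀, hk₀, hxk, ek⟩ := exists_germ (φ.arr (germ f hf x hx))
  simp only [φ.src_arr, src_germ] at hxk ek
  obtain ⟨D, hDk, hxD, hDo, hD⟩ := 𝒱'.exists_chartDomain (k₀.open_source.mem_nhds hxk)
  have eD : (partialRestr k₀ D hDo).source = D := inter_eq_self_of_subset_right hDk
  have hk : partialRestr k₀ D hDo ∈ 𝒱'.Ψ.carrier := fun z hz => hk₀ z hz.1
  have hc : ContinuousAt (fun y => φ.arr ((srcHomeo ⟨f, hf⟩).symm y)) x :=
    φ.continuous_arr.continuousAt.comp ((srcHomeo ⟨f, hf⟩).continuousAt_symm hx)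
  have es : ∀ y (hy : y ∈ f.source), (srcHomeo (P := 𝒱.Ψ) ⟨f, hf⟩).symm y = germ f hf y hy :=
    fun y hy => dif_pos hy
  have h1 := (continuousAt_germ_iff.1 hc).2
  have h2 := (app_germ k₀ hk₀ _ hxk).eventuallyEq_nhds
  rw [← ek] at h2
  simp only [es x hx] at h1
  have good : ∀ᶠ y in 𝓝 x, y ∈ f.source ∧ φ.obj y ∈ D ∧
      app (φ.arr ((srcHomeo ⟨f, hf⟩).symm y)) =ᶠ[𝓝 (φ.obj y)] k₀ := by
    filter_upwards [h1, φ.continuous_obj.continuousAt.eventually h2,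
      f.open_source.mem_nhds hx, φ.continuous_obj.continuousAt.eventually_mem (hDo.mem_nhds hxD)]
      with y e1 e2 e3 e4
    refine ⟨e3, e4, ?_⟩
    rw [es y e3, φ.src_arr] at e1
    rw [es y e3]
    exact e1.trans e2
  have hi : range (𝒱.incl x.1) ∈ 𝓝 x :=
    (𝒱.incl_isOpenEmbedding _).isOpen_range.mem_nhds ⟨x.2, rfl⟩
  have hj : f ⁻¹' range (𝒱.incl (f x).1) ∈ 𝓝 x :=
    (tendsto_transition hx).eventually_mem
      ((𝒱.incl_isOpenEmbedding _).isOpen_range.mem_nhds ⟨(f x).2, rfl⟩)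
  obtain ⟨g, hxg, hgO, hgc, hg⟩ := partialDiffeomorph_connected
    (f.isLocalDiffeomorphAt _ _ _ (x := x) hx) (inter_mem good (inter_mem hi hj))
  have hgΨ : g ∈ 𝒱.Ψ.carrier := fun y hy => by
    have e := hf y (hgO hy).1.1
    change 𝒱.π (g y) = 𝒱.π y
    rw [hg y hy]; exact e
  refine ⟨g, ⟨hgΨ, ⟨hgc, x.1, (f x).1, fun y hy => (hgO hy).2.1, fun y hy => ?_⟩,
    partialRestr k₀ D hDo, hk, by rw [eD]; exact hD, fun y hy => ?_⟩, hxg, ?_⟩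
  · have e1 := (hgO (g.map_target hy)).2.2
    have e2 := hg _ (g.map_target hy)
    have e3 : g (g.symm y) = y := g.right_inv hy
    rw [← e3]
    refine mem_of_eq_of_mem e2 e1
  · obtain ⟨⟨e1, e2, e3⟩, -⟩ := hgO hy
    refine ⟨⟨hDk e2, e2⟩, ?_⟩
    have e4 : germ g hgΨ y hy = germ f hf y e1 := by
      refine germ_eq_iff.2 ⟨rfl, ?_⟩
      filter_upwards [g.open_source.mem_nhds hy] with z hz using hg z hz
    rw [e4]
    rw [es y e1] at e3
    refine germ_ext (φ.src_arr _) ?_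
    rw [φ.src_arr]
    exact e3.trans (app_germ (partialRestr k₀ D hDo) hk (φ.obj y) ⟨hDk e2, e2⟩).symm
  · filter_upwards [g.open_source.mem_nhds hxg] with z hz using (hg z hz).symm

/-- Closure is required only for germs, so it follows from every germ having a representative in the
set. -/
theorem quasi_isQuasiPseudogroup : IsQuasiPseudogroup φ.quasi where
  inv f hf x hx := by
    obtain ⟨g, hg, hxg, e⟩ := φ.quasi_generates.2 f.symm (𝒱.Ψ.symm_mem f hf.1) (f x)
      (f.map_source hx)
    refine ⟨g, hg, hxg, ?_⟩
    filter_upwards [(tendsto_transition hx).eventually e, f.open_source.mem_nhds hx] with y h1 h2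
    rw [← h1]
    exact f.left_inv h2
  comp f hf g hg x hx hy := by
    obtain ⟨h, hh, hxh, e⟩ := φ.quasi_generates.2 (f.trans g) (𝒱.Ψ.trans_mem f hf.1 g hg.1) x
      (mem_trans_source hx hy)
    exact ⟨h, hh, hxh, e⟩

/-- The orbifold map `F₂(φ)`. -/
theorem exists_orbRep : ∃ f : OrbRep 𝒱 𝒱', f.toGermHom = φ := by
  obtain ⟨f, hf⟩ := φ.exists_fun
  choose tgt lift hlift using φ.exists_lift_chart
  have hψ : Sigma.map tgt lift = φ.obj := by
    funext ⟨i, v⟩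
    exact hlift i v
  -- ν(l) is a transition whose germs are the images of all germs of l. The axioms for ν then
  -- restate that φ is a homomorphism on germs.
  choose hP hconn k hk hkD hkarr using fun l : φ.quasi => l.2
  let r : OrbRep 𝒱 𝒱' :=
    { f := f
      continuous_f := by
        rw [(𝒱.isOpenMap_π.isQuotientMap 𝒱.continuous_π 𝒱.surjective_π).continuous_iff]
        exact (𝒱'.continuous_π.comp φ.continuous_obj).congr fun x => (hf x).symm
      tgt := tgt
      lift := lift
      smooth_lift := fun i => by
        refine contMDiff_of_comp_isLocalDiffeomorph (𝒱'.incl_localDiffeomorph (tgt i)) ?_ ?_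
        · refine (𝒱'.incl_isOpenEmbedding (tgt i)).isInducing.continuous_iff.2 ?_
          rw [show 𝒱'.incl (tgt i) ∘ lift i = φ.obj ∘ 𝒱.incl i from funext (hlift i)]
          exact φ.continuous_obj.comp (𝒱.incl_isOpenEmbedding i).continuous
        · rw [show 𝒱'.incl (tgt i) ∘ lift i = φ.obj ∘ 𝒱.incl i from funext (hlift i)]
          exact φ.smooth_obj.comp (𝒱.incl_localDiffeomorph i).contMDiff
      φ_lift := fun i v => (congrArg 𝒱'.π (hlift i v)).trans (hf _).symm
      P := φ.quasi
      quasi := φ.quasi_isQuasiPseudogroup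
      changes := fun l hl => hl.2.1
      generates := φ.quasi_generates
      ν := k
      ν_mem := hk
      ν_source := hkD
      ν_lift := fun l x hx => by
        rw [hψ]
        obtain ⟨h, e⟩ := hkarr l x hx
        refine ⟨h, ?_⟩
        have := congrArg FullPseudogroup.tgt e
        rw [φ.tgt_arr] at this
        exact this
      ν_germ := fun l m x hl hm e => by
        rw [hψ]
        obtain ⟨h1, e1⟩ := hkarr l x hl
        obtain ⟨h2, e2⟩ := hkarr m x hm
        have e3 : germ l.1 (hP l) x hl = germ m.1 (hP m) x hm := germ_eq_iff.2 ⟨rfl, e⟩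
        exact (germ_eq_iff.1 (e1.symm.trans ((congrArg φ.arr e3).trans e2))).2
      ν_mul := fun l m h x hl hm hh e => by
        rw [hψ]
        obtain ⟨h1, e1⟩ := hkarr l x hl
        obtain ⟨h2, e2⟩ := hkarr m _ hm
        obtain ⟨h3, e3⟩ := hkarr h x hh
        have hy : φ.obj (l.1 x) = k l (φ.obj x) := by
          have := congrArg FullPseudogroup.tgt e1
          rw [φ.tgt_arr] at this
          exact this
        have e4 : germMul ⟨(germ m.1 (hP m) (l.1 x) hm, germ l.1 (hP l) x hl), rfl⟩ =
            germ h.1 (hP h) x hh := (germMul_germ l.1 m.1 _ _ x _ hl hm rfl).trans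
          (germ_eq_iff.2 ⟨rfl, e⟩)
        have e5 := φ.arr_mul (germ m.1 (hP m) (l.1 x) hm) (germ l.1 (hP l) x hl) rfl
        rw [e4, e3, germMul_congr e2 e1] at e5
        have e6 := germMul_germ (P := 𝒱'.Ψ) (k l) (k m) (hk l) (hk m) (φ.obj x) (φ.obj (l.1 x))
          h1 h2 hy
        exact (germ_eq_iff.1 (e6.symm.trans e5.symm)).2
      ν_one := fun l x hx e => by
        rw [hψ]
        obtain ⟨h1, e1⟩ := hkarr l x hx
        have e2 : germ l.1 (hP l) x hx = germOne x := germ_eq_iff.2 ⟨rfl, e⟩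
        rw [e2, φ.arr_one] at e1
        exact (germ_eq_iff.1 e1.symm).2 }
  refine ⟨r, GermHom.ext (fun x => congrFun hψ x) fun γ => ?_⟩
  obtain ⟨l, hl, e⟩ := r.exists_mem_P γ
  obtain ⟨h, e'⟩ := hkarr l (src γ) hl
  refine ((congrArg r.arr e).trans (r.arr_germ l _ hl)).trans ?_
  refine Eq.trans ?_ (e'.symm.trans (congrArg φ.arr e.symm))
  exact germ_eq_iff.2 ⟨congrFun hψ _, Eventually.of_forall fun _ => rfl⟩

end GermHom

namespace ChartedMap

/-- The bijection `F₁`. -/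
def toGermHom (f : ChartedMap 𝒱 𝒱') : GermHom 𝒱 𝒱' :=
  Quotient.lift (s := OrbRep.setoid 𝒱 𝒱') OrbRep.toGermHom
    (fun a b h => (OrbRep.equiv_iff a b).1 h) f

theorem exists_mk (f : ChartedMap 𝒱 𝒱') : ∃ a, mk a = f :=
  Quotient.exists_rep (s := OrbRep.setoid 𝒱 𝒱') f

theorem toGermHom_injective : Function.Injective (toGermHom : ChartedMap 𝒱 𝒱' → GermHom 𝒱 𝒱') := by
  intro f g h
  obtain ⟨a, rfl⟩ := f.exists_mk
  obtain ⟨b, rfl⟩ := g.exists_mk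
  exact Quotient.sound (s := OrbRep.setoid 𝒱 𝒱') ((OrbRep.equiv_iff a b).2 h)

theorem toGermHom_surjective :
    Function.Surjective (toGermHom : ChartedMap 𝒱 𝒱' → GermHom 𝒱 𝒱') := by
  intro φ
  obtain ⟨a, rfl⟩ := φ.exists_orbRep
  exact ⟨mk a, rfl⟩

theorem induces_iff (f : ChartedMap 𝒱 𝒱') (φ : MarkedLieGroupoid.Hom 𝒱.Γ 𝒱'.Γ) :
    f.Induces φ ↔ GermHom.ofHom φ = f.toGermHom := by
  constructor
  · rintro ⟨a, rfl, h⟩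
    exact (a.induces_iff φ).1 h
  · intro h
    obtain ⟨a, rfl⟩ := f.exists_mk
    exact ⟨a, rfl, (a.induces_iff φ).2 h⟩

theorem isComp_iff (f : ChartedMap 𝒱 𝒱') (g : ChartedMap 𝒱' 𝒱'') (h : ChartedMap 𝒱 𝒱'') :
    IsComp f g h ↔ h.toGermHom = g.toGermHom.comp f.toGermHom := by
  constructor
  · rintro ⟨a, b, c, rfl, rfl, rfl, k⟩
    exact (OrbRep.isComp_iff a b c).1 k
  · intro k
    obtain ⟨a, rfl⟩ := f.exists_mk
    obtain ⟨b, rfl⟩ := g.exists_mk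
    obtain ⟨c, rfl⟩ := h.exists_mk
    exact ⟨a, b, c, rfl, rfl, rfl, (OrbRep.isComp_iff a b c).2 k⟩

theorem square_iff {𝒲' : AtlasRep S'} (ε : ChartedMap 𝒲 𝒱) (f : ChartedMap 𝒱 𝒱')
    (h : ChartedMap 𝒲 𝒲') (ε' : ChartedMap 𝒲' 𝒱') : Square ε f h ε' ↔
      f.toGermHom.comp ε.toGermHom = ε'.toGermHom.comp h.toGermHom := by
  constructor
  · rintro ⟨k, h1, h2⟩
    exact ((isComp_iff _ _ _).1 h1).symm.trans ((isComp_iff _ _ _).1 h2)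
  · intro e
    obtain ⟨k, hk⟩ := toGermHom_surjective (f.toGermHom.comp ε.toGermHom)
    exact ⟨k, (isComp_iff _ _ _).2 hk, (isComp_iff _ _ _).2 (hk.trans e)⟩

theorem toFun_π (f : ChartedMap 𝒱 𝒱') (x : 𝒱.Base) :
    f.toFun (𝒱.π x) = 𝒱'.π (f.toGermHom.obj x) := by
  obtain ⟨a, rfl⟩ := f.exists_mk
  exact (a.π_ψ x).symm

theorem isLiftOfId_iff (f : ChartedMap 𝒱 𝒲) : f.IsLiftOfId ↔ f.toGermHom.IsLift := by
  constructor
  · rintro ⟨a, rfl, h1, h2⟩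
    refine ⟨?_, fun x => (a.π_ψ x).trans (by rw [h1]; rfl)⟩
    rintro ⟨i, v⟩
    exact localDiffeomorphAt_of_comp_right (f := 𝒱.incl i) (g := a.ψ)
      (𝒱.incl_localDiffeomorph i v) ((h2 i v).comp (𝓡 S.n) _ (𝒲.incl_localDiffeomorph _ _))
  · intro h
    obtain ⟨a, rfl⟩ := f.exists_mk
    refine ⟨a, rfl, funext fun q => ?_, fun i v => ?_⟩
    · obtain ⟨x, rfl⟩ := 𝒱.surjective_π q
      rw [← a.π_ψ]
      exact h.π_obj x
    · exact localDiffeomorphAt_of_comp_left (g := 𝒲.incl (a.tgt i))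
        (a.smooth_lift i).continuous.continuousAt (𝒲.incl_localDiffeomorph _ _)
        ((𝒱.incl_localDiffeomorph i v).comp (𝓡 S.n) _ (h.localDiffeomorph _))

end ChartedMap

/-- Together with `unitMoritaEquiv_iff`, this turns both relations into `HEquiv`, so that
equivalence and composition are treated only once. -/
theorem orbEquiv_iff {𝒱₁ 𝒱₂ : AtlasRep S} {𝒱₁' 𝒱₂' : AtlasRep S'}
    (f₁ : ChartedMap 𝒱₁ 𝒱₁') (f₂ : ChartedMap 𝒱₂ 𝒱₂') :
    OrbEquiv f₁ f₂ ↔ GermHom.HEquiv f₁.toGermHom f₂.toGermHom := by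
  constructor
  · rintro ⟨𝒲, 𝒲', h, ε₁, ε₂, δ₁, δ₂, h₁, h₂, k₁, k₂, e₁, e₂⟩
    exact ⟨𝒲, 𝒲', h.toGermHom, ε₁.toGermHom, ε₂.toGermHom, δ₁.toGermHom, δ₂.toGermHom,
      (ε₁.isLiftOfId_iff).1 h₁, (ε₂.isLiftOfId_iff).1 h₂, (δ₁.isLiftOfId_iff).1 k₁,
      (δ₂.isLiftOfId_iff).1 k₂, (ChartedMap.square_iff _ _ _ _).1 e₁,
      (ChartedMap.square_iff _ _ _ _).1 e₂⟩
  · rintro ⟨𝒲, 𝒲', χ, ε₁, ε₂, δ₁, δ₂, h₁, h₂, k₁, k₂, e₁, e₂⟩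
    obtain ⟨h, rfl⟩ := ChartedMap.toGermHom_surjective χ
    obtain ⟨ε₁, rfl⟩ := ChartedMap.toGermHom_surjective ε₁
    obtain ⟨ε₂, rfl⟩ := ChartedMap.toGermHom_surjective ε₂
    obtain ⟨δ₁, rfl⟩ := ChartedMap.toGermHom_surjective δ₁
    obtain ⟨δ₂, rfl⟩ := ChartedMap.toGermHom_surjective δ₂
    exact ⟨𝒲, 𝒲', h, ε₁, ε₂, δ₁, δ₂, (ε₁.isLiftOfId_iff).2 h₁, (ε₂.isLiftOfId_iff).2 h₂,
      (δ₁.isLiftOfId_iff).2 k₁, (δ₂.isLiftOfId_iff).2 k₂, (ChartedMap.square_iff _ _ _ _).2 e₁,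
      (ChartedMap.square_iff _ _ _ _).2 e₂⟩

end Charted

/-! ### The category of marked atlas groupoids -/

theorem OrbStr.exists_atlasRep {Q : Type u} [TopologicalSpace Q] (S : OrbStr Q) :
    Nonempty (AtlasRep S) := by
  choose c hc hq using S.maximal.prop.cover
  exact ⟨⟨Q, c, hc, fun q => ⟨q, hq q⟩⟩⟩

namespace AgrMap

theorem equivalence (A B : Agr.{u}) :
    _root_.Equivalence fun a b : AnyHom A B => UnitMoritaEquiv a.2.2 b.2.2 := by
  obtain ⟨_, O, rfl⟩ := A
  obtain ⟨_, O', rfl⟩ := B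
  have key {𝒱 𝒲 : AtlasRep O.str} {𝒱' 𝒲' : AtlasRep O'.str}
      (φ : MarkedLieGroupoid.Hom 𝒱.Γ 𝒱'.Γ) (χ : MarkedLieGroupoid.Hom 𝒲.Γ 𝒲'.Γ) :
      UnitMoritaEquiv φ χ ↔ GermHom.HEquiv (GermHom.ofHom φ) (GermHom.ofHom χ) :=
    unitMoritaEquiv_iff φ χ
  refine ⟨?_, ?_, ?_⟩
  · rintro ⟨⟨_, 𝒱, rfl⟩, ⟨_, 𝒱', rfl⟩, φ⟩
    exact (key φ φ).2 (.refl _)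
  · rintro ⟨⟨_, 𝒱, rfl⟩, ⟨_, 𝒱', rfl⟩, φ⟩ ⟨⟨_, 𝒲, rfl⟩, ⟨_, 𝒲', rfl⟩, χ⟩ h
    exact (key χ φ).2 ((key φ χ).1 h).symm
  · rintro ⟨⟨_, 𝒱, rfl⟩, ⟨_, 𝒱', rfl⟩, φ⟩ ⟨⟨_, 𝒲, rfl⟩, ⟨_, 𝒲', rfl⟩, χ⟩
      ⟨⟨_, 𝒰, rfl⟩, ⟨_, 𝒰', rfl⟩, κ⟩ h k
    exact (key φ κ).2
      (((key φ χ).1 h).trans ((key χ κ).1 k))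

theorem mk_eq_iff {A B : Agr.{u}} {G G' : A.1.carrier} {H H' : B.1.carrier}
    (φ : MarkedLieGroupoid.Hom G.1 H.1) (χ : MarkedLieGroupoid.Hom G'.1 H'.1) :
    (mk φ : AgrMap A B) = mk χ ↔ UnitMoritaEquiv φ χ :=
  (equivalence A B).quot_mk_eq_iff ⟨G, H, φ⟩ ⟨G', H', χ⟩

theorem exists_mk {A B : Agr.{u}} (f : AgrMap A B) :
    ∃ (G : A.1.carrier) (H : B.1.carrier) (φ : MarkedLieGroupoid.Hom G.1 H.1), mk φ = f := by
  induction f using Quot.ind with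
  | mk a => exact ⟨a.1, a.2.1, a.2.2, rfl⟩

/-- The class of a homomorphism of germ groupoids. -/
def ofGermHom {O O' : Orbifold.{u}} {𝒱 : AtlasRep O.str} {𝒱' : AtlasRep O'.str}
    (θ : GermHom 𝒱 𝒱') : AgrMap (Agr.of O) (Agr.of O') :=
  mk (G := 𝒱.mem_Γ) (H := 𝒱'.mem_Γ) θ.toHom

section

variable {O O' O'' : Orbifold.{u}}

theorem ofGermHom_eq_iff {𝒱 𝒲 : AtlasRep O.str} {𝒱' 𝒲' : AtlasRep O'.str} (θ : GermHom 𝒱 𝒱')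
    (η : GermHom 𝒲 𝒲') : ofGermHom θ = ofGermHom η ↔ GermHom.HEquiv θ η :=
  (mk_eq_iff (A := Agr.of O) (B := Agr.of O') (G := 𝒱.mem_Γ) (H := 𝒱'.mem_Γ) (G' := 𝒲.mem_Γ)
    (H' := 𝒲'.mem_Γ) θ.toHom η.toHom).trans (unitMoritaEquiv_iff θ.toHom η.toHom)

theorem exists_ofGermHom (f : AgrMap (Agr.of O) (Agr.of O')) :
    ∃ (𝒱 : AtlasRep O.str) (𝒱' : AtlasRep O'.str) (θ : GermHom 𝒱 𝒱'), ofGermHom θ = f := by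
  obtain ⟨⟨_, 𝒱, rfl⟩, ⟨_, 𝒱', rfl⟩, φ, rfl⟩ := f.exists_mk
  exact ⟨𝒱, 𝒱', GermHom.ofHom φ, rfl⟩

/-- Two morphisms have composable representatives, where the range of the second one can be
prescribed. -/
theorem exists_composable (f : AgrMap (Agr.of O) (Agr.of O')) {𝒲' : AtlasRep O'.str}
    {𝒲'' : AtlasRep O''.str} (η : GermHom 𝒲' 𝒲'') :
    ∃ (𝒦 : AtlasRep O.str) (𝒦' : AtlasRep O'.str) (χ : GermHom 𝒦 𝒦') (κ : GermHom 𝒦' 𝒲''),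
      ofGermHom χ = f ∧ ofGermHom κ = ofGermHom η := by
  obtain ⟨𝒱, 𝒱', θ, rfl⟩ := exists_ofGermHom f
  obtain ⟨𝒜, p₁, p₂, 𝒲, e, χ, h₁, h₂, he, h⟩ :=
    GermHom.exists_lift_to_common (𝒱₂ := 𝒲') θ
  exact ⟨𝒲, 𝒜, χ, η.comp p₂, (ofGermHom_eq_iff _ _).2 (GermHom.HEquiv.of_refine he h₁ h.symm).symm,
    (ofGermHom_eq_iff _ _).2 (GermHom.HEquiv.of_refine (θ := η)
      (χ := η.comp p₂) h₂ GermHom.isLift_id rfl).symm⟩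

end

/-- `exists_composable` supplies representatives that can be composed, and `HEquiv.comp` shows that
the class of the result does not depend on them. -/
theorem exists_comp {A B C : Agr.{u}} (f : AgrMap A B) (g : AgrMap B C) : ∃ c : AgrMap A C,
    ∀ (G : A.1.carrier) (H : B.1.carrier) (K : C.1.carrier) (χ : MarkedLieGroupoid.Hom G.1 H.1)
      (κ : MarkedLieGroupoid.Hom H.1 K.1), mk χ = f → mk κ = g → mk (κ.comp χ) = c := by
  obtain ⟨_, O, rfl⟩ := A
  obtain ⟨_, O', rfl⟩ := B
  obtain ⟨_, O'', rfl⟩ := C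
  obtain ⟨𝒲', 𝒲'', η, rfl⟩ := exists_ofGermHom g
  obtain ⟨𝒦, 𝒦', χ, κ, rfl, hκ⟩ := exists_composable f η
  refine ⟨ofGermHom (κ.comp χ), ?_⟩
  rintro ⟨_, 𝒢, rfl⟩ ⟨_, ℋ, rfl⟩ ⟨_, ℒ, rfl⟩ χ' κ' h k
  have h1 := (ofGermHom_eq_iff (GermHom.ofHom χ') χ).1 h
  have h2 := (ofGermHom_eq_iff (GermHom.ofHom κ') κ).1 (k.trans hκ.symm)
  exact (ofGermHom_eq_iff ((GermHom.ofHom κ').comp (GermHom.ofHom χ')) _).2 (h1.comp h2)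

/-- The composition of unit Morita equivalence classes. -/
def comp {A B C : Agr.{u}} (f : AgrMap A B) (g : AgrMap B C) : AgrMap A C :=
  (exists_comp f g).choose

theorem comp_mk {A B C : Agr.{u}} {G : A.1.carrier} {H : B.1.carrier} {K : C.1.carrier}
    (χ : MarkedLieGroupoid.Hom G.1 H.1) (κ : MarkedLieGroupoid.Hom H.1 K.1) :
    comp (mk χ : AgrMap A B) (mk κ : AgrMap B C) = mk (κ.comp χ) :=
  ((exists_comp (mk χ : AgrMap A B) (mk κ : AgrMap B C)).choose_spec G H K χ κ rfl rfl).symm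

/-- All lifts of the identity are equivalent, and whatever is equivalent to one of them is one. -/
theorem exists_id (A : Agr.{u}) : ∃ c : AgrMap A A,
    ∀ (G H : A.1.carrier) (φ : MarkedLieGroupoid.Hom G.1 H.1),
      mk φ = c ↔ MarkedLieGroupoid.IsUnitWeakEquivalence φ := by
  obtain ⟨_, O, rfl⟩ := A
  obtain ⟨𝒱⟩ := O.str.exists_atlasRep
  refine ⟨ofGermHom (GermHom.id 𝒱), ?_⟩
  rintro ⟨_, 𝒢, rfl⟩ ⟨_, ℋ, rfl⟩ φ
  refine (ofGermHom_eq_iff (GermHom.ofHom φ) (GermHom.id 𝒱)).trans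
    (Iff.trans ?_ (unitWeakEquivalence_iff φ).symm)
  exact ⟨fun h => h.isLift GermHom.isLift_id, fun h => h.hEquiv GermHom.isLift_id⟩

/-- The class of all unit weak equivalences. -/
def id (A : Agr.{u}) : AgrMap A A := (exists_id A).choose

theorem mk_eq_id_iff {A : Agr.{u}} {G H : A.1.carrier} (φ : MarkedLieGroupoid.Hom G.1 H.1) :
    mk φ = id A ↔ MarkedLieGroupoid.IsUnitWeakEquivalence φ :=
  (exists_id A).choose_spec G H φ

theorem ofGermHom_id {O : Orbifold.{u}} (𝒱 : AtlasRep O.str) :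
    ofGermHom (GermHom.id 𝒱) = id (Agr.of O) :=
  (mk_eq_id_iff (A := Agr.of O) (G := 𝒱.mem_Γ) (H := 𝒱.mem_Γ) (GermHom.id 𝒱).toHom).2
    GermHom.isLift_id.unitWeakEquivalence

theorem comp_ofGermHom {O O' O'' : Orbifold.{u}} {𝒱 : AtlasRep O.str} {𝒱' : AtlasRep O'.str}
    {𝒱'' : AtlasRep O''.str} (θ : GermHom 𝒱 𝒱') (η : GermHom 𝒱' 𝒱'') :
    comp (ofGermHom θ) (ofGermHom η) = ofGermHom (η.comp θ) :=
  comp_mk (A := Agr.of O) (B := Agr.of O') (C := Agr.of O'') (G := 𝒱.mem_Γ) (H := 𝒱'.mem_Γ)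
    (K := 𝒱''.mem_Γ) θ.toHom η.toHom

/-- Refinement does not change classes, so any data as in `IsComp` compute `comp`. Such data exist,
hence the result is both attained and unique. -/
theorem comp_eq_iff {A B C : Agr.{u}} {G : A.1.carrier} {G' H' : B.1.carrier} {H'' : C.1.carrier}
    (φ : MarkedLieGroupoid.Hom G.1 G'.1) (ψ : MarkedLieGroupoid.Hom H'.1 H''.1)
    (c : AgrMap A C) : comp (mk φ : AgrMap A B) (mk ψ) = c ↔ IsComp φ ψ c := by
  obtain ⟨_, O, rfl⟩ := A
  obtain ⟨_, O', rfl⟩ := B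
  obtain ⟨_, O'', rfl⟩ := C
  obtain ⟨_, 𝒱, rfl⟩ := G
  obtain ⟨_, 𝒱', rfl⟩ := G'
  obtain ⟨_, 𝒲', rfl⟩ := H'
  obtain ⟨_, 𝒲'', rfl⟩ := H''
  have key : ∀ c, IsComp (A := Agr.of O) (B := Agr.of O') (C := Agr.of O'') (G := 𝒱.mem_Γ)
      (G' := 𝒱'.mem_Γ) (H' := 𝒲'.mem_Γ) (H'' := 𝒲''.mem_Γ) φ ψ c →
      comp (ofGermHom (GermHom.ofHom φ)) (ofGermHom (GermHom.ofHom ψ)) = c := by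
    rintro _ ⟨⟨_, 𝒦, rfl⟩, ⟨_, 𝒦', rfl⟩, ⟨_, 𝒦'', rfl⟩, ε, ε₁, ε₂, ε', χ, κ, h, h₁, h₂, h', e₁, e₂, rfl⟩
    have k1 : ofGermHom (GermHom.ofHom φ) = ofGermHom (GermHom.ofHom χ) :=
      (ofGermHom_eq_iff _ _).2 (GermHom.HEquiv.of_refine (isLift_of_unitWeakEquivalence h)
        (isLift_of_unitWeakEquivalence h₁) (congrArg GermHom.ofHom e₁))
    have k2 : ofGermHom (GermHom.ofHom ψ) = ofGermHom (GermHom.ofHom κ) :=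
      (ofGermHom_eq_iff _ _).2 (GermHom.HEquiv.of_refine (isLift_of_unitWeakEquivalence h₂)
        (isLift_of_unitWeakEquivalence h') (congrArg GermHom.ofHom e₂))
    rw [k1, k2, comp_ofGermHom]
    rfl
  refine ⟨?_, key c⟩
  rintro rfl
  -- φ is lifted through p₁ after refining its domain, and ψ is precomposed with p₂. The range of ψ
  -- needs no refinement, so the identity serves there.
  obtain ⟨𝒜, p₁, p₂, 𝒲, e, χ, h₁, h₂, he, h⟩ :=
    GermHom.exists_lift_to_common (𝒱₂ := 𝒲') (GermHom.ofHom φ)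
  have h3 : IsComp (A := Agr.of O) (B := Agr.of O') (C := Agr.of O'') (G := 𝒱.mem_Γ)
      (G' := 𝒱'.mem_Γ) (H' := 𝒲'.mem_Γ) (H'' := 𝒲''.mem_Γ) φ ψ
      (ofGermHom (((GermHom.ofHom ψ).comp p₂).comp χ)) :=
    ⟨𝒲.mem_Γ, 𝒜.mem_Γ, 𝒲''.mem_Γ, e.toHom, p₁.toHom, p₂.toHom, (GermHom.id 𝒲'').toHom, χ.toHom,
      ((GermHom.ofHom ψ).comp p₂).toHom, he.unitWeakEquivalence, h₁.unitWeakEquivalence,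
      h₂.unitWeakEquivalence, GermHom.isLift_id.unitWeakEquivalence, congrArg GermHom.toHom h.symm,
      rfl, rfl⟩
  have h4 := key _ h3
  exact mem_of_eq_of_mem (s := {c | IsComp (A := Agr.of O) (B := Agr.of O') (C := Agr.of O'')
    (G := 𝒱.mem_Γ) (G' := 𝒱'.mem_Γ) (H' := 𝒲'.mem_Γ) (H'' := 𝒲''.mem_Γ) φ ψ c}) h4 h3

end AgrMap

/-- The category of marked atlas groupoids. -/
def agrCategory : CategoryOn AgrMap.{u} where
  id := AgrMap.id
  comp := AgrMap.comp
  id_comp {A B} f := by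
    obtain ⟨_, O, rfl⟩ := A
    obtain ⟨_, O', rfl⟩ := B
    obtain ⟨𝒱, 𝒱', θ, rfl⟩ := AgrMap.exists_ofGermHom f
    exact (congrArg (AgrMap.comp · _) (AgrMap.ofGermHom_id 𝒱).symm).trans
      (AgrMap.comp_ofGermHom _ θ)
  comp_id {A B} f := by
    obtain ⟨_, O, rfl⟩ := A
    obtain ⟨_, O', rfl⟩ := B
    obtain ⟨𝒱, 𝒱', θ, rfl⟩ := AgrMap.exists_ofGermHom f
    exact (congrArg (AgrMap.comp _ ·) (AgrMap.ofGermHom_id 𝒱').symm).trans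
      (AgrMap.comp_ofGermHom θ _)
  assoc {A B C D} f g h := by
    obtain ⟨_, O, rfl⟩ := A
    obtain ⟨_, O', rfl⟩ := B
    obtain ⟨_, O'', rfl⟩ := C
    obtain ⟨_, O''', rfl⟩ := D
    -- Representatives are aligned from right to left: each use of `exists_composable` keeps the
    -- range fixed, so the matches already made survive. Associativity is then that of strict
    -- composition.
    obtain ⟨𝒲'', 𝒲''', τ, rfl⟩ := AgrMap.exists_ofGermHom h
    obtain ⟨𝒲', 𝒱'', η, τ', rfl, hτ⟩ := AgrMap.exists_composable g τ
    rw [← hτ]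
    obtain ⟨𝒦, 𝒦', χ, κ, rfl, hκ⟩ := AgrMap.exists_composable f η
    rw [← hκ]
    have e₁ := AgrMap.comp_ofGermHom χ κ
    have e₂ := AgrMap.comp_ofGermHom (κ.comp χ) τ'
    have e₃ := AgrMap.comp_ofGermHom κ τ'
    have e₄ := AgrMap.comp_ofGermHom χ (τ'.comp κ)
    refine (congrArg (AgrMap.comp · _) e₁).trans (e₂.trans (Eq.trans ?_
      (e₄.symm.trans (congrArg (AgrMap.comp _) e₃.symm))))
    rw [GermHom.comp_assoc]

theorem isAgrCategory_agrCategory : IsAgrCategory agrCategory.{u} :=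
  ⟨fun _ _ _ φ => AgrMap.mk_eq_id_iff φ, fun _ _ _ _ _ _ _ φ ψ c => AgrMap.comp_eq_iff φ ψ c⟩

/-! ### The category of reduced orbifolds -/

theorem ChartedMap.exists_toHom_eq {Q Q' : Type u} [TopologicalSpace Q] [TopologicalSpace Q']
    {S : OrbStr Q} {S' : OrbStr Q'} {𝒱 : AtlasRep S} {𝒱' : AtlasRep S'}
    (φ : MarkedLieGroupoid.Hom 𝒱.Γ 𝒱'.Γ) : ∃ f : ChartedMap 𝒱 𝒱', f.toGermHom.toHom = φ := by
  obtain ⟨f, hf⟩ := toGermHom_surjective (GermHom.ofHom φ)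
  exact ⟨f, congrArg GermHom.toHom hf⟩

namespace OrbMap

variable {O O' O'' : Orbifold.{u}}

theorem equivalence (O O' : Orbifold.{u}) :
    _root_.Equivalence fun a b : AnyChartedMap O O' => OrbEquiv a.2.2 b.2.2 where
  refl _ := (orbEquiv_iff _ _).2 (.refl _)
  symm h := (orbEquiv_iff _ _).2 ((orbEquiv_iff _ _).1 h).symm
  trans h k := (orbEquiv_iff _ _).2 (((orbEquiv_iff _ _).1 h).trans ((orbEquiv_iff _ _).1 k))

/-- The map `[f̂] ↦ [F₁(f̂)]`. -/
def toAgrMap (f : OrbMap O O') : AgrMap (Agr.of O) (Agr.of O') :=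
  Quot.lift (fun a : AnyChartedMap O O' => AgrMap.ofGermHom a.2.2.toGermHom)
    (fun a b h => (AgrMap.ofGermHom_eq_iff _ _).2 ((orbEquiv_iff a.2.2 b.2.2).1 h)) f

theorem toAgrMap_mk {𝒱 : AtlasRep O.str} {𝒱' : AtlasRep O'.str} (f : ChartedMap 𝒱 𝒱') :
    (mk f).toAgrMap = AgrMap.ofGermHom f.toGermHom := rfl

theorem exists_mk (f : OrbMap O O') : ∃ (𝒱 : AtlasRep O.str) (𝒱' : AtlasRep O'.str)
    (a : ChartedMap 𝒱 𝒱'), mk a = f := by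
  induction f using Quot.ind with
  | mk a => exact ⟨a.1, a.2.1, a.2.2, rfl⟩

/-- Both sides are quotients of the same homomorphisms by `HEquiv`. -/
theorem toAgrMap_bijective :
    Function.Bijective (toAgrMap : OrbMap O O' → AgrMap (Agr.of O) (Agr.of O')) := by
  constructor
  · intro f g h
    obtain ⟨𝒱, 𝒱', a, rfl⟩ := f.exists_mk
    obtain ⟨𝒲, 𝒲', b, rfl⟩ := g.exists_mk
    exact Quot.sound ((orbEquiv_iff a b).2 ((AgrMap.ofGermHom_eq_iff _ _).1 h))
  · intro c
    obtain ⟨𝒱, 𝒱', θ, rfl⟩ := AgrMap.exists_ofGermHom c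
    obtain ⟨a, rfl⟩ := ChartedMap.toGermHom_surjective θ
    exact ⟨mk a, rfl⟩

/-- The bijection `[f̂] ↦ [F₁(f̂)]`. -/
def equivAgrMap (O O' : Orbifold.{u}) : OrbMap O O' ≃ AgrMap (Agr.of O) (Agr.of O') :=
  Equiv.ofBijective toAgrMap toAgrMap_bijective

theorem isComp_iff {𝒱 : AtlasRep O.str} {𝒱' 𝒲' : AtlasRep O'.str} {𝒲'' : AtlasRep O''.str}
    (f : ChartedMap 𝒱 𝒱') (g : ChartedMap 𝒲' 𝒲'') (c : OrbMap O O'') :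
    IsComp f g c ↔ AgrMap.IsComp (A := Agr.of O) (B := Agr.of O') (C := Agr.of O'')
      (G := 𝒱.mem_Γ) (G' := 𝒱'.mem_Γ) (H' := 𝒲'.mem_Γ) (H'' := 𝒲''.mem_Γ) f.toGermHom.toHom
      g.toGermHom.toHom c.toAgrMap := by
  constructor
  · rintro ⟨𝒦, 𝒦', 𝒦'', ε, ε₁, ε₂, ε', h, k, l, hε, h₁, h₂, h', e₁, e₂, e₃, rfl⟩
    refine ⟨𝒦.mem_Γ, 𝒦'.mem_Γ, 𝒦''.mem_Γ, ε.toGermHom.toHom, ε₁.toGermHom.toHom,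
      ε₂.toGermHom.toHom, ε'.toGermHom.toHom, h.toGermHom.toHom, k.toGermHom.toHom,
      ((ε.isLiftOfId_iff).1 hε).unitWeakEquivalence, ((ε₁.isLiftOfId_iff).1 h₁).unitWeakEquivalence,
      ((ε₂.isLiftOfId_iff).1 h₂).unitWeakEquivalence,
      ((ε'.isLiftOfId_iff).1 h').unitWeakEquivalence,
      congrArg GermHom.toHom ((ChartedMap.square_iff _ _ _ _).1 e₁),
      congrArg GermHom.toHom ((ChartedMap.square_iff _ _ _ _).1 e₂), ?_⟩
    rw [toAgrMap_mk, (ChartedMap.isComp_iff _ _ _).1 e₃]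
    rfl
  · rintro ⟨⟨_, 𝒦, rfl⟩, ⟨_, 𝒦', rfl⟩, ⟨_, 𝒦'', rfl⟩, ε, ε₁, ε₂, ε', χ, κ, hε, h₁, h₂, h', e₁, e₂, e₃⟩
    obtain ⟨a, rfl⟩ := ChartedMap.exists_toHom_eq (𝒱 := 𝒦) (𝒱' := 𝒱) ε
    obtain ⟨a₁, rfl⟩ := ChartedMap.exists_toHom_eq (𝒱 := 𝒦') (𝒱' := 𝒱') ε₁
    obtain ⟨a₂, rfl⟩ := ChartedMap.exists_toHom_eq (𝒱 := 𝒦') (𝒱' := 𝒲') ε₂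
    obtain ⟨a', rfl⟩ := ChartedMap.exists_toHom_eq (𝒱 := 𝒦'') (𝒱' := 𝒲'') ε'
    obtain ⟨h, rfl⟩ := ChartedMap.exists_toHom_eq (𝒱 := 𝒦) (𝒱' := 𝒦') χ
    obtain ⟨k, rfl⟩ := ChartedMap.exists_toHom_eq (𝒱 := 𝒦') (𝒱' := 𝒦'') κ
    obtain ⟨l, hl⟩ := ChartedMap.toGermHom_surjective (k.toGermHom.comp h.toGermHom)
    refine ⟨𝒦, 𝒦', 𝒦'', a, a₁, a₂, a', h, k, l,
      a.isLiftOfId_iff.2 (isLift_of_unitWeakEquivalence hε),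
      a₁.isLiftOfId_iff.2 (isLift_of_unitWeakEquivalence h₁),
      a₂.isLiftOfId_iff.2 (isLift_of_unitWeakEquivalence h₂),
      a'.isLiftOfId_iff.2 (isLift_of_unitWeakEquivalence h'),
      (ChartedMap.square_iff _ _ _ _).2 (GermHom.toHom_injective e₁),
      (ChartedMap.square_iff _ _ _ _).2 (GermHom.toHom_injective e₂),
      (ChartedMap.isComp_iff _ _ _).2 hl, toAgrMap_bijective.1 (e₃.trans ?_)⟩
    rw [toAgrMap_mk, hl]
    rfl

end OrbMap

/-- The category of reduced orbifolds. -/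
def orbCategory : CategoryOn OrbMap.{u} where
  id O := (OrbMap.equivAgrMap O O).symm (AgrMap.id (Agr.of O))
  comp f g := (OrbMap.equivAgrMap _ _).symm
    (AgrMap.comp (OrbMap.equivAgrMap _ _ f) (OrbMap.equivAgrMap _ _ g))
  id_comp f := by
    rw [Equiv.apply_symm_apply, Equiv.symm_apply_eq]
    exact agrCategory.id_comp _
  comp_id f := by
    rw [Equiv.apply_symm_apply, Equiv.symm_apply_eq]
    exact agrCategory.comp_id _
  assoc f g h := by
    rw [Equiv.apply_symm_apply, Equiv.apply_symm_apply]
    exact congrArg _ (agrCategory.assoc _ _ _)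

/-- The laws were transported from the groupoid side; here identities and compositions are matched
with their descriptions by charted maps. -/
theorem isOrbCategory_orbCategory : IsOrbCategory orbCategory.{u} := by
  refine ⟨fun O 𝒱 𝒲 f => ?_, fun O O' O'' 𝒱 𝒱' 𝒲' 𝒲'' f g c => ?_⟩
  · refine (Equiv.eq_symm_apply _).trans ?_
    refine (AgrMap.mk_eq_id_iff (A := Agr.of O) (G := 𝒱.mem_Γ) (H := 𝒲.mem_Γ)
      f.toGermHom.toHom).trans ?_
    exact (unitWeakEquivalence_iff f.toGermHom.toHom).trans f.isLiftOfId_iff.symm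
  · refine (Equiv.symm_apply_eq _).trans ?_
    exact (AgrMap.comp_eq_iff (A := Agr.of O) (B := Agr.of O') (C := Agr.of O'') (G := 𝒱.mem_Γ)
      (G' := 𝒱'.mem_Γ) (H' := 𝒲'.mem_Γ) (H'' := 𝒲''.mem_Γ) f.toGermHom.toHom g.toGermHom.toHom
      c.toAgrMap).trans (OrbMap.isComp_iff f g c).symm

/-! ### The isomorphism of categories -/

theorem AtlasRep.charts_eq {Q : Type u} [TopologicalSpace Q] {S : OrbStr Q} (𝒱 : AtlasRep S) :
    S.charts = {c | IsChartOf 𝒱.Γ c} :=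
  Set.ext fun c => (𝒱.isChartOf_iff c).symm

/-- Both the dimension and the charts are read off from the marked groupoid. They are compared as a
pair because the kind of charts depends on the dimension. -/
theorem OrbStr.eq_of_Γ_eq {Q : Type u} [TopologicalSpace Q] {S S' : OrbStr Q} {𝒱 : AtlasRep S}
    {𝒱' : AtlasRep S'} (h : 𝒱.Γ = 𝒱'.Γ) : S = S' := by
  have key : ∀ {T : OrbStr Q} (𝒲 : AtlasRep T), (⟨T.n, T.charts⟩ : Σ n, Set (OrbChart Q n)) =
      ⟨𝒲.Γ.dimObj, {c | IsChartOf 𝒲.Γ c}⟩ :=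
    fun {T} 𝒲 => congrArg (Sigma.mk T.n) 𝒲.charts_eq
  have e := key 𝒱
  rw [h, ← key 𝒱'] at e
  obtain ⟨n, C, hC⟩ := S
  obtain ⟨m, D, hD⟩ := S'
  cases e
  rfl

/-- If two classes coincide, the groupoid of a representative of one structure is also that of a
representative of the other, and a single groupoid already determines the structure. -/
theorem Agr.of_bijective : Function.Bijective Agr.of.{u} := by
  constructor
  · intro O O' h
    have h := congrArg Subtype.val h
    obtain ⟨Q, S⟩ := O
    obtain ⟨Q', S'⟩ := O'
    obtain ⟨𝒱⟩ := S.exists_atlasRep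
    simp only [Agr.of, Orbifold.Γ, MarkedClass.mk.injEq] at h
    obtain ⟨rfl, h1, h2⟩ := h
    obtain rfl := eq_of_heq h1
    have h3 : 𝒱.Γ ∈ {G | ∃ 𝒱' : AtlasRep S', G = 𝒱'.Γ} := by
      rw [← eq_of_heq h2]
      exact ⟨𝒱, rfl⟩
    obtain ⟨𝒱', h4⟩ := h3
    obtain rfl := OrbStr.eq_of_Γ_eq h4
    rfl
  · rintro ⟨_, O, rfl⟩
    exact ⟨O, rfl⟩

/-- Since F is bijective on objects, preimages of morphisms, corrected by the equalities F(o X) = X,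
give an inverse that is strict rather than up to natural isomorphism. Faithfulness of F yields the
functor laws. -/
theorem exists_inverse_functor {C D : Type*} [Category* C] [Category* D] (F : C ⥤ D)
    (h : Function.Bijective F.obj)
    (hF : ∀ X Y : C, Function.Bijective (F.map : (X ⟶ Y) → (F.obj X ⟶ F.obj Y))) :
    ∃ E : D ⥤ C, F ⋙ E = 𝟭 C ∧ E ⋙ F = 𝟭 D := by
  choose o ho using h.2
  let m {X Y : D} (f : X ⟶ Y) : o X ⟶ o Y :=
    ((hF _ _).2 (eqToHom (ho X) ≫ f ≫ eqToHom (ho Y).symm)).choose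
  have hm {X Y : D} (f : X ⟶ Y) : F.map (m f) = eqToHom (ho X) ≫ f ≫ eqToHom (ho Y).symm :=
    ((hF _ _).2 (eqToHom (ho X) ≫ f ≫ eqToHom (ho Y).symm)).choose_spec
  let E : D ⥤ C :=
    { obj := o
      map := m
      map_id := fun X => (hF _ _).1 (by simp [hm])
      map_comp := fun f g => (hF _ _).1 (by simp [hm]) }
  have ho' (X : C) : o (F.obj X) = X := h.1 (ho _)
  refine ⟨E, CategoryTheory.Functor.ext ho' fun X Y f => (hF _ _).1 ?_, CategoryTheory.Functor.ext ho fun X Y f => hm f⟩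
  simp [E, hm, eqToHom_map]

/-- The functor `F`. -/
def orbToAgr : letI := orbCategory.toCategory; letI := agrCategory.toCategory
    Orbifold.{u} ⥤ Agr.{u} :=
  letI := orbCategory.toCategory
  letI := agrCategory.toCategory
  { obj := Agr.of
    map := fun f => OrbMap.toAgrMap f
    map_id := fun O => (OrbMap.equivAgrMap O O).apply_symm_apply _
    map_comp := fun _ _ => (OrbMap.equivAgrMap _ _).apply_symm_apply _ }

theorem ChartedMap.toFun_eq {Q Q' : Type u} [TopologicalSpace Q] [TopologicalSpace Q']
    {S : OrbStr Q} {S' : OrbStr Q'} {𝒱 : AtlasRep S} {𝒱' : AtlasRep S'} {f : ChartedMap 𝒱 𝒱'}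
    {φ : MarkedLieGroupoid.Hom 𝒱.Γ 𝒱'.Γ} (h : f.Induces φ) :
    f.toFun = 𝒱'.Γ.mark ∘ φ.orbitMap ∘ 𝒱.Γ.mark.symm := by
  funext q
  obtain ⟨x, rfl⟩ := 𝒱.surjective_π q
  rw [f.toFun_π, ← (f.induces_iff φ).1 h]
  exact (mark_orbitMap φ x).symm

end

end ReducedOrbifold

theorem mainTheorem1 :
    -- charted orbifold maps have a composition
    (∀ (O O' O'' : Orbifold.{u}) (𝒱 : AtlasRep O.str) (𝒱' : AtlasRep O'.str) (𝒱'' : AtlasRep O''.str)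
      (f : ChartedMap 𝒱 𝒱') (g : ChartedMap 𝒱' 𝒱''),
      ∃! h : ChartedMap 𝒱 𝒱'', ChartedMap.IsComp f g h) ∧
    -- `F₁` is a bijection from charted orbifold maps to homomorphisms of atlas groupoids; its
    -- inverse is `F₂`
    (∀ (O O' : Orbifold.{u}) (𝒱 : AtlasRep O.str) (𝒱' : AtlasRep O'.str),
      (∀ f : ChartedMap 𝒱 𝒱', ∃! φ : MarkedLieGroupoid.Hom 𝒱.Γ 𝒱'.Γ, f.Induces φ) ∧
      (∀ φ : MarkedLieGroupoid.Hom 𝒱.Γ 𝒱'.Γ, ∃! f : ChartedMap 𝒱 𝒱', f.Induces φ) ∧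
      ∀ (f : ChartedMap 𝒱 𝒱') (φ : MarkedLieGroupoid.Hom 𝒱.Γ 𝒱'.Γ), f.Induces φ →
        f.toFun = 𝒱'.Γ.mark ∘ φ.orbitMap ∘ 𝒱.Γ.mark.symm) ∧
    -- the relations defining the morphisms are equivalence relations
    (∀ O O' : Orbifold.{u},
      _root_.Equivalence fun a b : AnyChartedMap O O' => OrbEquiv a.2.2 b.2.2) ∧
    (∀ A B : Agr.{u}, _root_.Equivalence fun a b : AnyHom A B => UnitMoritaEquiv a.2.2 b.2.2) ∧
    -- the two categories and the isomorphism between them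
    ∃ (C : CategoryOn OrbMap.{u}) (D : CategoryOn AgrMap.{u}),
      IsOrbCategory C ∧ IsAgrCategory D ∧
      letI := C.toCategory
      letI := D.toCategory
      ∃ (F : Orbifold.{u} ⥤ Agr.{u}) (E : Agr.{u} ⥤ Orbifold.{u}),
        (∀ O, F.obj O = Agr.of O) ∧
        (∀ (O O' : Orbifold.{u}) (𝒱 : AtlasRep O.str) (𝒱' : AtlasRep O'.str) (f : ChartedMap 𝒱 𝒱')
          (φ : MarkedLieGroupoid.Hom 𝒱.Γ 𝒱'.Γ), f.Induces φ →
          HEq (F.map (OrbMap.mk f : O ⟶ O'))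
            (AgrMap.mk (G := 𝒱.mem_Γ) (H := 𝒱'.mem_Γ) φ)) ∧
        F ⋙ E = 𝟭 Orbifold.{u} ∧ E ⋙ F = 𝟭 Agr.{u} ∧
        (∀ O, E.obj (Agr.of O) = O) ∧
        (∀ (O O' : Orbifold.{u}) (𝒱 : AtlasRep O.str) (𝒱' : AtlasRep O'.str) (f : ChartedMap 𝒱 𝒱')
          (φ : MarkedLieGroupoid.Hom 𝒱.Γ 𝒱'.Γ), f.Induces φ →
          HEq (E.map (AgrMap.mk (G := 𝒱.mem_Γ) (H := 𝒱'.mem_Γ) φ : Agr.of O ⟶ Agr.of O'))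
            (OrbMap.mk f)) ∧
        -- the orbifold structure is read off from any of its marked atlas groupoids
        (∀ (O : Orbifold.{u}) (𝒱 : AtlasRep O.str),
          O.str.charts = {c | IsChartOf 𝒱.Γ c}) := by
  refine ⟨fun O O' O'' 𝒱 𝒱' 𝒱'' f g => ?_, fun O O' 𝒱 𝒱' => ⟨fun f => ?_, fun φ => ?_, fun f φ h =>
    ChartedMap.toFun_eq h⟩, OrbMap.equivalence, AgrMap.equivalence, orbCategory, agrCategory,
    isOrbCategory_orbCategory, isAgrCategory_agrCategory, ?_⟩
  · obtain ⟨h, hh⟩ := ChartedMap.toGermHom_surjective (g.toGermHom.comp f.toGermHom)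
    exact ⟨h, (ChartedMap.isComp_iff f g h).2 hh, fun k hk =>
      ChartedMap.toGermHom_injective (((ChartedMap.isComp_iff f g k).1 hk).trans hh.symm)⟩
  · exact ⟨f.toGermHom.toHom, (f.induces_iff _).2 rfl, fun φ hφ =>
      congrArg GermHom.toHom ((f.induces_iff φ).1 hφ)⟩
  · obtain ⟨f, rfl⟩ := ChartedMap.exists_toHom_eq φ
    exact ⟨f, (f.induces_iff _).2 rfl, fun k hk =>
      ChartedMap.toGermHom_injective ((k.induces_iff _).1 hk).symm⟩
  let _ := orbCategory.{u}.toCategory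
  let _ := agrCategory.{u}.toCategory
  obtain ⟨E, hE₁, hE₂⟩ := exists_inverse_functor orbToAgr.{u} Agr.of_bijective
    fun _ _ => OrbMap.toAgrMap_bijective
  have key : ∀ (O O' : Orbifold.{u}) (𝒱 : AtlasRep O.str) (𝒱' : AtlasRep O'.str)
      (f : ChartedMap 𝒱 𝒱') (φ : MarkedLieGroupoid.Hom 𝒱.Γ 𝒱'.Γ), f.Induces φ →
      orbToAgr.map (OrbMap.mk f : O ⟶ O') = AgrMap.mk (G := 𝒱.mem_Γ) (H := 𝒱'.mem_Γ) φ :=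
    fun O O' 𝒱 𝒱' f φ h => by
      obtain rfl : φ = f.toGermHom.toHom := congrArg GermHom.toHom ((f.induces_iff φ).1 h)
      rfl
  refine ⟨orbToAgr, E, fun _ => rfl, fun O O' 𝒱 𝒱' f φ h => heq_of_eq (key O O' 𝒱 𝒱' f φ h), hE₁,
    hE₂, fun O => Functor.congr_obj hE₁ O, fun O O' 𝒱 𝒱' f φ h => ?_, fun O 𝒱 => 𝒱.charts_eq⟩
  -- Since [φ] is the image of [f] under F, the formula for E on [φ] is the identity F ⋙ E = 𝟭
  -- evaluated at [f].
  rw [← key O O' 𝒱 𝒱' f φ h]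
  exact Functor.hcongr_hom hE₁ (OrbMap.mk f : O ⟶ O')
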